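/- A \emph{funnel polygon} is a simple polygon $P$ whose vertices $v_1,\dots,v_n$, listed in clockwise order, form a convex edge $v_nv_1$ (both of its endpoints are convex vertices) and two reflex chains $v_1,v_2,\dots,v_t$ and $v_t,\dots,v_{n-1},v_n$, where $1<t<n$. That is, $v_1,v_t,v_n$ are the convex vertices of $P$ and every other vertex is strictly reflex. The polygon is regarded as a closed region. Two points $p,q\in P$ see each other if the segment $pq$ lies in $P$; a \emph{hidden set} in $P$ is a set of points of $P$ no two of which see each other; a \emph{convex cover} of $P$ is a set of convex polygons whose union is $P$. Let $hs(P)$ be the maximum cardinality of a hidden set in $P$ and $cc(P)$ the minimum cardinality of a convex cover of $P$. \textbf{Theorem.} For every funnel polygon $P$ there are a finite hidden set $H$ in $P$ and a finite convex cover $C$ of $P$ with $|H|=|C|$; consequently $hs(P)=|H|=|C|=cc(P)$. Moreover, $H$ can be taken on the boundary of $P$ and $C$ can be taken to be a convex decomposition of $P$ with Steiner points allowed (the pieces have pairwise disjoint interiors, and their vertices need not be vertices of $P$). Such a pair $(H,C)$ can be computed in linear time: there are a single program for the real RAM and a constant $\kappa$ such that, for every $n$ and every funnel polygon $P$ with $n$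 vertices, given as the list $v_1,\dots,v_n$ of the coordinates of its vertices, the program halts after at most $\kappa n$ elementary steps and outputs the points of $H$ and the polygons of $C$, each polygon as a list of its vertices in clockwise order (repeated points and points on the sides of the polygon are allowed in such a list). -/

import Mathlib

/-! ## Plane polygons -/

/-- The plane. Only its affine structure, its order on coordinates and its topology are used. -/
abbrev Plane : Type := ℝ × ℝ

/-- The orientation test: positive if `r` is to the left of `p, q` (a left turn is made at `q`
along `p, q, r`), negative if `r` is to the right, zero if the three points are collinear. -/
def orient (p q r : Plane) : ℝ :=
  (q.1 - p.1) * (r.2 - p.2) - (q.2 - p.2) * (r.1 - p.1)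

namespace Polygon

/-- `P` is a simple polygon: it has at least three vertices, its edges are nondegenerate, and two
different edges meet at most in a common endpoint of two consecutive edges. -/
structure IsSimple {n : ℕ} (P : Polygon Plane n) : Prop where
  three_le : 3 ≤ n
  nondegenerate : P.HasNondegenerateEdges
  inter : ∀ i j : Fin n, i ≠ j → ∀ x ∈ P.edgeSet ℝ i ∩ P.edgeSet ℝ j,
    (j = finRotate n i ∧ x = P j) ∨ (i = finRotate n j ∧ x = P i)

/-- Twice the signed area enclosed by the polygon. -/
def doubleSignedArea {n : ℕ} (P : Polygon Plane n) : ℝ :=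
  ∑ i : Fin n, ((P i).1 * (P (finRotate n i)).2 - (P (finRotate n i)).1 * (P i).2)

/-- The vertices are listed in clockwise order. -/
def IsClockwise {n : ℕ} (P : Polygon Plane n) : Prop :=
  P.doubleSignedArea < 0

/-- The closed region of the plane that a polygon encloses: its boundary together with the points
in the bounded components of the complement of the boundary. -/
def region {n : ℕ} (P : Polygon Plane n) : Set Plane :=
  P.boundary ℝ ∪
    {x | x ∉ P.boundary ℝ ∧ Bornology.IsBounded (connectedComponentIn (P.boundary ℝ)ᶜ x)}

/-- A vertex of a clockwise polygon is convex if a right turn is made there. -/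
def IsConvexVertex {n : ℕ} (P : Polygon Plane n) (i : Fin n) : Prop :=
  orient (P ((finRotate n).symm i)) (P i) (P (finRotate n i)) < 0

/-- A vertex of a clockwise polygon is (strictly) reflex if a left turn is made there. -/
def IsReflexVertex {n : ℕ} (P : Polygon Plane n) (i : Fin n) : Prop :=
  0 < orient (P ((finRotate n).symm i)) (P i) (P (finRotate n i))

/-- Funnel polygons: simple polygons with vertices `v₁, …, vₙ` in clockwise order (here with
indices `0, …, n - 1`), composed of the convex edge `vₙv₁` and of two reflex chains `v₁, …, v_t`
and `v_t, …, vₙ`. So `v₁`, `v_t`, `vₙ` are the convex vertices and every other vertex is strictly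
reflex. -/
structure IsFunnel {n : ℕ} (P : Polygon Plane n) : Prop where
  simple : P.IsSimple
  clockwise : P.IsClockwise
  chains : ∃ t : ℕ, 0 < t ∧ t + 1 < n ∧ ∀ i : Fin n,
    ((i.val = 0 ∨ i.val = t ∨ i.val + 1 = n) → P.IsConvexVertex i) ∧
    (¬ (i.val = 0 ∨ i.val = t ∨ i.val + 1 = n) → P.IsReflexVertex i)

end Polygon

/-! ## Hidden sets and convex covers -/

/-- `p` sees `q` in the region `R` if the line segment `pq` lies in `R`. -/
def Sees (R : Set Plane) (p q : Plane) : Prop :=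
  segment ℝ p q ⊆ R

/-- A hidden set in `R`: a set of points of `R` no two of which see each other. -/
def IsHiddenSet (R H : Set Plane) : Prop :=
  H ⊆ R ∧ ∀ p ∈ H, ∀ q ∈ H, p ≠ q → ¬ Sees R p q

/-- Convex polygons, as closed regions of the plane. -/
def IsConvexPolygon (K : Set Plane) : Prop :=
  (interior K).Nonempty ∧ ∃ S : Set Plane, S.Finite ∧ K = convexHull ℝ S

/-- A convex cover of `R`: a set of convex polygons whose union is `R`. -/
def IsConvexCover (R : Set Plane) (C : Set (Set Plane)) : Prop :=
  (∀ K ∈ C, IsConvexPolygon K) ∧ ⋃₀ C = R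

/-- A convex decomposition of `R` (Steiner points are allowed): a convex cover whose pieces do
not overlap, that is, they have pairwise disjoint interiors. -/
def IsConvexDecomposition (R : Set Plane) (C : Set (Set Plane)) : Prop :=
  IsConvexCover R C ∧ ∀ K ∈ C, ∀ L ∈ C, K ≠ L → Disjoint (interior K) (interior L)

/-- The hidden set number. -/
noncomputable def hiddenSetNumber (R : Set Plane) : ℕ∞ :=
  ⨆ H ∈ {H : Set Plane | IsHiddenSet R H}, H.encard

/-- The convex cover number. -/
noncomputable def convexCoverNumber (R : Set Plane) : ℕ∞ :=
  ⨅ C ∈ {C : Set (Set Plane) | IsConvexCover R C}, C.encard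

/-! ## The real RAM

A real random access machine with finitely many integer and real registers and finitely many
integer and real arrays in its program, every elementary operation on which has unit cost.
Integers can be added, subtracted (truncated at zero) and compared, and are used as indices;
reals can be added, subtracted, multiplied, divided and compared. -/

namespace RealRAM

/-- The memory of the machine. -/
structure State where
  natVar : ℕ → ℕ
  realVar : ℕ → ℝ
  natArr : ℕ → ℕ → ℕ
  realArr : ℕ → ℕ → ℝ

/-- Integer expressions; `get a i` is the entry with index `i` of the integer array `a`. -/
inductive NatExpr where
  | const (c : ℕ)
  | var (x : ℕ)
  | get (a : ℕ) (i : NatExpr)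
  | add (e f : NatExpr)
  | sub (e f : NatExpr)

namespace NatExpr

def eval (s : State) : NatExpr → ℕ
  | const c => c
  | var x => s.natVar x
  | get a i => s.natArr a (i.eval s)
  | add e f => e.eval s + f.eval s
  | sub e f => e.eval s - f.eval s

/-- The number of elementary steps of an evaluation. -/
def cost : NatExpr → ℕ
  | const _ => 1
  | var _ => 1
  | get _ i => i.cost + 1
  | add e f => e.cost + f.cost + 1
  | sub e f => e.cost + f.cost + 1

end NatExpr

/-- Real expressions; `get a i` is the entry with index `i` of the real array `a`. -/
inductive RealExpr where
  | const (c : ℤ)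
  | var (x : ℕ)
  | get (a : ℕ) (i : NatExpr)
  | add (e f : RealExpr)
  | sub (e f : RealExpr)
  | mul (e f : RealExpr)
  | div (e f : RealExpr)

namespace RealExpr

noncomputable def eval (s : State) : RealExpr → ℝ
  | const c => (c : ℝ)
  | var x => s.realVar x
  | get a i => s.realArr a (i.eval s)
  | add e f => e.eval s + f.eval s
  | sub e f => e.eval s - f.eval s
  | mul e f => e.eval s * f.eval s
  | div e f => e.eval s / f.eval s

/-- The number of elementary steps of an evaluation. -/
def cost : RealExpr → ℕ
  | const _ => 1
  | var _ => 1
  | get _ i => i.cost + 1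
  | add e f => e.cost + f.cost + 1
  | sub e f => e.cost + f.cost + 1
  | mul e f => e.cost + f.cost + 1
  | div e f => e.cost + f.cost + 1

end RealExpr

/-- Tests: comparisons of integers or of reals, and their Boolean combinations. -/
inductive Test where
  | natLe (e f : NatExpr)
  | realLe (e f : RealExpr)
  | neg (b : Test)
  | conj (b c : Test)

namespace Test

def Holds (s : State) : Test → Prop
  | natLe e f => e.eval s ≤ f.eval s
  | realLe e f => e.eval s ≤ f.eval s
  | neg b => ¬ b.Holds s
  | conj b c => b.Holds s ∧ c.Holds s

/-- The number of elementary steps of an evaluation. -/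
def cost : Test → ℕ
  | natLe e f => e.cost + f.cost + 1
  | realLe e f => e.cost + f.cost + 1
  | neg b => b.cost + 1
  | conj b c => b.cost + c.cost + 1

end Test

/-- Programs. -/
inductive Program where
  | skip
  | setNat (x : ℕ) (e : NatExpr)
  | setReal (x : ℕ) (e : RealExpr)
  | putNat (a : ℕ) (i e : NatExpr)
  | putReal (a : ℕ) (i : NatExpr) (e : RealExpr)
  | seq (p q : Program)
  | branch (b : Test) (p q : Program)
  | loop (b : Test) (p : Program)

/-- `Exec p s s' k`: started in the state `s`, the program `p` halts in the state `s'` after `k`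
elementary steps. -/
inductive Exec : Program → State → State → ℕ → Prop where
  | skip (s : State) : Exec .skip s s 1
  | setNat (s : State) (x : ℕ) (e : NatExpr) :
      Exec (.setNat x e) s
        { s with natVar := Function.update s.natVar x (e.eval s) } (e.cost + 1)
  | setReal (s : State) (x : ℕ) (e : RealExpr) :
      Exec (.setReal x e) s
        { s with realVar := Function.update s.realVar x (e.eval s) } (e.cost + 1)
  | putNat (s : State) (a : ℕ) (i e : NatExpr) :
      Exec (.putNat a i e) s
        { s with
          natArr := Function.update s.natArr a
            (Function.update (s.natArr a) (i.eval s) (e.eval s)) }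
        (i.cost + e.cost + 1)
  | putReal (s : State) (a : ℕ) (i : NatExpr) (e : RealExpr) :
      Exec (.putReal a i e) s
        { s with
          realArr := Function.update s.realArr a
            (Function.update (s.realArr a) (i.eval s) (e.eval s)) }
        (i.cost + e.cost + 1)
  | seq {p q : Program} {s s' s'' : State} {k l : ℕ} :
      Exec p s s' k → Exec q s' s'' l → Exec (.seq p q) s s'' (k + l)
  | branch_true {b : Test} {p q : Program} {s s' : State} {k : ℕ} :
      b.Holds s → Exec p s s' k → Exec (.branch b p q) s s' (b.cost + k + 1)
  | branch_false {b : Test} {p q : Program} {s s' : State} {k : ℕ} :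
      ¬ b.Holds s → Exec q s s' k → Exec (.branch b p q) s s' (b.cost + k + 1)
  | loop_true {b : Test} {p : Program} {s s' s'' : State} {k l : ℕ} :
      b.Holds s → Exec p s s' k → Exec (.loop b p) s' s'' l →
      Exec (.loop b p) s s'' (b.cost + k + l + 1)
  | loop_false {b : Test} {p : Program} {s : State} :
      ¬ b.Holds s → Exec (.loop b p) s s (b.cost + 1)

/-- The initial state for the input `P`: integer register `0` holds the number of vertices, real
arrays `0` and `1` hold the coordinates of the vertices in order, everything else is zero. -/
noncomputable def inputState {n : ℕ} (P : Polygon Plane n) : State where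
  natVar := fun x => if x = 0 then n else 0
  realVar := fun _ => 0
  natArr := fun _ _ => 0
  realArr := fun a i =>
    if h : i < n then
      if a = 0 then (P ⟨i, h⟩).1 else if a = 1 then (P ⟨i, h⟩).2 else 0
    else 0

/-- The `j`-th point in the output list of points (real arrays `2` and `3`). -/
def outPoint (s : State) (j : ℕ) : Plane :=
  (s.realArr 2 j, s.realArr 3 j)

/-- The `m`-th point in the output list of vertices of pieces (real arrays `4` and `5`). -/
def outVertex (s : State) (m : ℕ) : Plane :=
  (s.realArr 4 m, s.realArr 5 m)

/-- The `j`-th output piece. The entries `j` and `j + 1` of the integer array `0` delimit the part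
of the list of vertices of pieces that belongs to it. -/
def outPiece (s : State) (j : ℕ) : Set Plane :=
  convexHull ℝ (outVertex s '' Set.Ico (s.natArr 0 j) (s.natArr 0 (j + 1)))

/-- In the state `s` the output is the set of points `H` and the set of convex polygons `C`, both
listed without repetition; their numbers are in the integer registers `1` and `2`. Each polygon is
given by a list of its vertices in clockwise order (in which points may be repeated, and points
on the sides of the polygon may occur). -/
structure Outputs (s : State) (H : Finset Plane) (C : Finset (Set Plane)) : Prop where
  card_points : s.natVar 1 = H.card
  points : (H : Set Plane) = outPoint s '' Set.Iio (s.natVar 1)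
  card_pieces : s.natVar 2 = C.card
  pieces : (C : Set (Set Plane)) = outPiece s '' Set.Iio (s.natVar 2)
  clockwise : ∀ j < s.natVar 2, ∀ a b c : ℕ,
    s.natArr 0 j ≤ a → a < b → b < c → c < s.natArr 0 (j + 1) →
      orient (outVertex s a) (outVertex s b) (outVertex s c) ≤ 0

end RealRAM

/-!
The vertices of a funnel are numbered from the base up to the apex, as `u 0, …, u a` on the left
chain and `w 0, …, w b` on the right chain, with `u a = w b`. In the direction across the base, all
edges of both chains go upwards (`SimpleCycle.edges_monotone`): the interior angles of a simple
`n`-gon add up to at most `(n - 2)π`, a consequence of the existence of triangulations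
(`SimpleCycle.exists_filling`), and the reflex angles leave less than `π` for the turns of the edges.
This turns a funnel polygon into a `Funnel`, described by the signs of a few determinants; the rest
of the geometry is a study of these signs. The region of the polygon is the set `Funnel.body` of
the points above the base that are on the inner side of some edge of each chain
(`Funnel.region_eq_body`), because the rest of the plane consists of three unbounded convex sets.

The decomposition comes from a greedy peeling from the apex down to the base (`Funnel.next`). Below a
chord from `u i` to `w j` there are a left and a right edge. If the upper end of one of them is on
the outer side of the other, then that edge hides above the other, and it is cut off together with
the opposite end of the chord, as a triangle. This cannot happen both ways (`Funnel.exclusive`). If it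
does not happen, the two edges see each other, and they are cut off together as a quadrilateral. The
pieces cover the funnel (`Funnel.Peeling.iUnion_piece`) and the chords separate them.

The hidden set has one point on the boundary of each piece. A point in the relative interior of an
edge does not see any point on the outer side of that edge (`Funnel.not_sees`), so that points on
different edges of the same chain never see each other. A quadrilateral takes its point from the same
chain as the piece below it, hence wherever the points change from the left chain to the right chain
on the way down, the lowest left edge was cut off as a triangle, hiding above the right edge. Each
point is placed so close to the upper end of its edge that it hides above the first lower edge with a
point on the other chain, and then it hides above all of them
(`Funnel.Selection.lam_point_pos`). A convex set contains at most one point of a hidden set, so both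
sets are optimal.

The program finds the apex as the first right turn, performs the peeling, and selects the points on
the way back up from the base, remembering the last edge used on each chain. Its correctness is
proved with weakest preconditions for the parts without loops and invariants for the three loops
(`RealRAM.halts_funnelProgram`).
-/

section

open Set Filter Topology

/-! ### Determinants, orientation and segments -/

/-- The cross product (determinant) of two plane vectors. -/
def cr (x y : Plane) : ℝ := x.1 * y.2 - x.2 * y.1

/-- The standard inner product with a vector, as a linear functional on the plane. -/
def lin (ν x : Plane) : ℝ := ν.1 * x.1 + ν.2 * x.2

theorem orient_rotate (p q r : Plane) : orient q r p = orient p q r := by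
  simp only [orient]; ring

theorem orient_swap (p q r : Plane) : orient q p r = -orient p q r := by
  simp only [orient]; ring

theorem orient_self_left (p q : Plane) : orient p q p = 0 := by
  simp only [orient]; ring

theorem orient_self_right (p q : Plane) : orient p q q = 0 := by
  simp only [orient]; ring

theorem orient_add_smul (p q x y : Plane) (t : ℝ) :
    orient p q (x + t • (y - x)) = orient p q x + t * (orient p q y - orient p q x) := by
  simp only [orient, Prod.fst_add, Prod.snd_add, Prod.smul_fst, Prod.smul_snd, Prod.fst_sub,
    Prod.snd_sub, smul_eq_mul]
  ring

theorem continuous_orient (p q : Plane) : Continuous (orient p q) := by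
  unfold orient; fun_prop

theorem mem_segment_iff_add {p q x : Plane} :
    x ∈ segment ℝ p q ↔ ∃ t : ℝ, 0 ≤ t ∧ t ≤ 1 ∧ x = p + t • (q - p) := by
  rw [segment_eq_image']
  constructor
  · rintro ⟨t, ⟨h0, h1⟩, rfl⟩; exact ⟨t, h0, h1, rfl⟩
  · rintro ⟨t, h0, h1, rfl⟩; exact ⟨t, ⟨h0, h1⟩, rfl⟩

theorem mem_openSegment_iff_add {p q x : Plane} :
    x ∈ openSegment ℝ p q ↔ ∃ t : ℝ, 0 < t ∧ t < 1 ∧ x = p + t • (q - p) := by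
  rw [openSegment_eq_image']
  constructor
  · rintro ⟨t, ⟨h0, h1⟩, rfl⟩; exact ⟨t, h0, h1, rfl⟩
  · rintro ⟨t, h0, h1, rfl⟩; exact ⟨t, ⟨h0, h1⟩, rfl⟩

theorem orient_eq_zero_of_mem_segment {p q x : Plane} (h : x ∈ segment ℝ p q) :
    orient p q x = 0 := by
  obtain ⟨t, -, -, rfl⟩ := mem_segment_iff_add.1 h
  rw [orient_add_smul, orient_self_left, orient_self_right]; ring

/-- Barycentric coordinates are given by the orientation test. -/
theorem barycentric_smul (u v w x : Plane) :
    orient u v w • x = orient v w x • u + orient w u x • v + orient u v x • w := by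
  ext <;> simp only [orient, Prod.fst_add, Prod.snd_add, Prod.smul_fst, Prod.smul_snd,
    smul_eq_mul] <;> ring

theorem orient_add_orient_add_orient (u v w x : Plane) :
    orient v w x + orient w u x + orient u v x = orient u v w := by
  simp only [orient]; ring

/-- A point on the inner side of the three sides of a triangle lies in the triangle. -/
theorem mem_of_convex_of_orient {S : Set Plane} (hS : Convex ℝ S) {u v w x : Plane} {s : ℝ}
    (hu : u ∈ S) (hv : v ∈ S) (hw : w ∈ S) (hD : 0 < s * orient u v w)
    (ha : 0 ≤ s * orient v w x) (hb : 0 ≤ s * orient w u x) (hc : 0 ≤ s * orient u v x) :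
    x ∈ S := by
  set D := s * orient u v w with hDdef
  have hsum : s * orient v w x / D + s * orient w u x / D + s * orient u v x / D = 1 := by
    rw [← add_div, ← add_div, ← mul_add, ← mul_add, orient_add_orient_add_orient]
    exact div_self hD.ne'
  have key := hS.sum_mem (t := Finset.univ) (w := ![s * orient v w x / D, s * orient w u x / D,
    s * orient u v x / D]) (z := ![u, v, w])
    (by intro i _; fin_cases i <;> simp <;> positivity)
    (by simpa [Fin.sum_univ_three] using hsum)
    (by intro i _; fin_cases i <;> simp [hu, hv, hw])
  have hx : x = (s * orient v w x / D) • u + (s * orient w u x / D) • v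
      + (s * orient u v x / D) • w := by
    have h := congrArg (fun p : Plane => (s / D) • p) (barycentric_smul u v w x)
    simp only [smul_add, smul_smul] at h
    have e : s / D * orient u v w = 1 := by
      rw [div_mul_eq_mul_div]; exact div_self hD.ne'
    rw [e, one_smul] at h
    simpa only [div_mul_eq_mul_div] using h
  rw [hx]
  simpa [Fin.sum_univ_three] using key

theorem mem_segment_of_orient {u v w x : Plane} {s : ℝ} (hD : 0 < s * orient u v w)
    (ha : 0 ≤ s * orient v w x) (hb : 0 ≤ s * orient w u x) (hc : orient u v x = 0) :
    x ∈ segment ℝ u v := by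
  have hsum := orient_add_orient_add_orient u v w x
  set D := s * orient u v w with hDdef
  refine ⟨s * orient v w x / D, s * orient w u x / D, by positivity, by positivity, ?_, ?_⟩
  · rw [← add_div, ← mul_add]
    rw [hc, add_zero] at hsum
    rw [hsum]; exact div_self hD.ne'
  · have h := congrArg (fun p : Plane => (s / D) • p) (barycentric_smul u v w x)
    simp only [smul_add, smul_smul, hc, zero_smul, add_zero] at h
    have e : s / D * orient u v w = 1 := by
      rw [div_mul_eq_mul_div]; exact div_self hD.ne'
    rw [e, one_smul] at h
    simpa only [div_mul_eq_mul_div] using h.symm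

/-- Transitivity of the turning sense around a vertex, for directions in an open half plane. -/
theorem turn_trans {ν v a b c : Plane} {s : ℝ} (ha : lin ν v < lin ν a) (hb : lin ν v < lin ν b)
    (hc : lin ν v < lin ν c) (hab : 0 < s * orient a v b) (hbc : 0 < s * orient b v c) :
    0 < s * orient a v c := by
  have key : (s * orient a v c) * (lin ν b - lin ν v) =
      (s * orient b v c) * (lin ν a - lin ν v) + (s * orient a v b) * (lin ν c - lin ν v) := by
    simp only [orient, lin]; ring
  have h2 : 0 < (s * orient a v c) * (lin ν b - lin ν v) := by
    rw [key]
    have := mul_pos hbc (sub_pos.2 ha)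
    have := mul_pos hab (sub_pos.2 hc)
    linarith
  exact pos_of_mul_pos_left h2 (sub_pos.2 hb).le

/-! ### Angles -/

/-- The direction of a plane vector, as the argument of a complex number. -/
noncomputable def dirArg (p : Plane) : ℝ := Complex.arg ⟨p.1, p.2⟩

/-- The angle at `v` from the ray `vb` to the ray `va`, in `(0, 2π]`, measured counterclockwise if
`s = 1` and clockwise if `s = -1`: the interior angle of a polygon of orientation `s` with
consecutive vertices `a, v, b`. -/
noncomputable def ang (s : ℝ) (a v b : Plane) : ℝ :=
  toIocMod Real.two_pi_pos 0 (s * (dirArg (a - v) - dirArg (b - v)))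

theorem ang_pos (s : ℝ) (a v b : Plane) : 0 < ang s a v b :=
  left_lt_toIocMod Real.two_pi_pos _ _

theorem ang_le_two_pi (s : ℝ) (a v b : Plane) : ang s a v b ≤ 2 * Real.pi := by
  have h := toIocMod_le_right Real.two_pi_pos 0 (s * (dirArg (a - v) - dirArg (b - v)))
  rwa [zero_add] at h

theorem ang_eq (s : ℝ) (a v b : Plane) :
    ∃ z : ℤ, ang s a v b = s * (dirArg (a - v) - dirArg (b - v)) + z * (2 * Real.pi) := by
  refine ⟨-toIocDiv Real.two_pi_pos 0 (s * (dirArg (a - v) - dirArg (b - v))), ?_⟩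
  have h := toIocMod_add_toIocDiv_zsmul Real.two_pi_pos 0 (s * (dirArg (a - v) - dirArg (b - v)))
  rw [zsmul_eq_mul] at h
  unfold ang
  push_cast
  linarith

theorem ang_le_of_eq {s : ℝ} {a v b : Plane} {y : ℝ} (hy : 0 < y) (z : ℤ)
    (h : y = s * (dirArg (a - v) - dirArg (b - v)) + z * (2 * Real.pi)) : ang s a v b ≤ y := by
  obtain ⟨z', hz'⟩ := ang_eq s a v b
  by_contra! hlt
  have h1 : ang s a v b - y = ((z' - z : ℤ) : ℝ) * (2 * Real.pi) := by
    rw [hz', h]; push_cast; ring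
  have hpi := Real.pi_pos
  have h2 : 0 < ((z' - z : ℤ) : ℝ) := by
    by_contra! h3
    nlinarith
  have h3 : (1 : ℝ) ≤ ((z' - z : ℤ) : ℝ) := by
    have : 0 < z' - z := by exact_mod_cast h2
    exact_mod_cast this
  have h4 := ang_le_two_pi s a v b
  nlinarith

theorem ang_le_add (s : ℝ) (a b c v : Plane) : ang s a v c ≤ ang s a v b + ang s b v c := by
  obtain ⟨z, hz⟩ := ang_eq s a v b
  obtain ⟨z', hz'⟩ := ang_eq s b v c
  refine ang_le_of_eq (add_pos (ang_pos _ _ _ _) (ang_pos _ _ _ _)) (z + z') ?_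
  rw [hz, hz']; push_cast; ring

theorem sin_dirArg_sub {x y : Plane} (hx : x ≠ 0) (hy : y ≠ 0) :
    ∃ r > 0, Real.sin (dirArg x - dirArg y) = r * cr y x := by
  set X : ℂ := ⟨x.1, x.2⟩ with hX
  set Y : ℂ := ⟨y.1, y.2⟩ with hY
  have hX0 : X ≠ 0 := by
    intro h; apply hx
    have h1 := congrArg Complex.re h
    have h2 := congrArg Complex.im h
    exact Prod.ext h1 h2
  have hY0 : Y ≠ 0 := by
    intro h; apply hy
    have h1 := congrArg Complex.re h
    have h2 := congrArg Complex.im h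
    exact Prod.ext h1 h2
  refine ⟨(‖X‖ * ‖Y‖)⁻¹, by positivity, ?_⟩
  rw [dirArg, dirArg, Real.sin_sub, Complex.sin_arg, Complex.cos_arg hX0, Complex.sin_arg,
    Complex.cos_arg hY0]
  have := norm_pos_iff.2 hX0
  have := norm_pos_iff.2 hY0
  simp only [cr]
  change X.im / ‖X‖ * (Y.re / ‖Y‖) - X.re / ‖X‖ * (Y.im / ‖Y‖) =
    (‖X‖ * ‖Y‖)⁻¹ * (Y.re * X.im - Y.im * X.re)
  field_simp

theorem dirArg_neg {x : Plane} (hx : x ≠ 0) :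
    ∃ z : ℤ, dirArg (-x) = dirArg x + Real.pi + z * (2 * Real.pi) := by
  have hX0 : (⟨x.1, x.2⟩ : ℂ) ≠ 0 := by
    intro h; apply hx
    have h1 := congrArg Complex.re h
    have h2 := congrArg Complex.im h
    exact Prod.ext h1 h2
  have h := Complex.arg_neg_coe_angle hX0
  rw [← Real.Angle.coe_add, Real.Angle.angle_eq_iff_two_pi_dvd_sub] at h
  obtain ⟨z, hz⟩ := h
  refine ⟨z, ?_⟩
  have e : dirArg (-x) = Complex.arg (-(⟨x.1, x.2⟩ : ℂ)) := by
    unfold dirArg; congr 1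
  rw [e]; unfold dirArg
  linarith

theorem sin_ang {s : ℝ} (hs : s = 1 ∨ s = -1) {a v b : Plane} (ha : a ≠ v) (hb : b ≠ v) :
    ∃ r > 0, Real.sin (ang s a v b) = r * (s * orient a v b) := by
  obtain ⟨z, hz⟩ := ang_eq s a v b
  obtain ⟨r, hr, h⟩ := sin_dirArg_sub (sub_ne_zero.2 ha) (sub_ne_zero.2 hb)
  refine ⟨r, hr, ?_⟩
  have e : cr (b - v) (a - v) = orient a v b := by
    simp only [cr, orient, Prod.fst_sub, Prod.snd_sub]; ring
  rw [e] at h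
  rw [hz, Real.sin_add_int_mul_two_pi]
  rcases hs with rfl | rfl
  · simpa using h
  · rw [neg_one_mul, Real.sin_neg, h]; ring

theorem ang_lt_pi {s : ℝ} (hs : s = 1 ∨ s = -1) {a v b : Plane} (h : 0 < s * orient a v b) :
    ang s a v b < Real.pi := by
  have ha : a ≠ v := by rintro rfl; simp [orient] at h
  have hb : b ≠ v := by rintro rfl; simp [orient_self_right] at h
  obtain ⟨r, hr, hsin⟩ := sin_ang hs ha hb
  by_contra! hge
  have h1 : 0 < Real.sin (ang s a v b) := by rw [hsin]; positivity
  have h2 : 0 ≤ Real.sin (ang s a v b - Real.pi) :=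
    Real.sin_nonneg_of_nonneg_of_le_pi (by linarith) (by linarith [ang_le_two_pi s a v b])
  rw [Real.sin_sub_pi] at h2
  linarith

theorem pi_lt_ang {s : ℝ} (hs : s = 1 ∨ s = -1) {a v b : Plane} (h : s * orient a v b < 0) :
    Real.pi < ang s a v b := by
  have ha : a ≠ v := by rintro rfl; simp [orient] at h
  have hb : b ≠ v := by rintro rfl; simp [orient_self_right] at h
  obtain ⟨r, hr, hsin⟩ := sin_ang hs ha hb
  by_contra! hge
  have h1 : Real.sin (ang s a v b) < 0 := by rw [hsin]; exact mul_neg_of_pos_of_neg hr h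
  have h2 : 0 ≤ Real.sin (ang s a v b) :=
    Real.sin_nonneg_of_nonneg_of_le_pi (ang_pos _ _ _ _).le hge
  linarith

/-- The angles of a triangle add up to at most `π`. -/
theorem ang_triangle {s : ℝ} (hs : s = 1 ∨ s = -1) {p q r : Plane} (h : 0 < s * orient p q r) :
    ang s p q r + ang s q r p + ang s r p q ≤ Real.pi := by
  have h1 : 0 < s * orient q r p := by rwa [orient_rotate]
  have h2 : 0 < s * orient r p q := by rwa [orient_rotate, orient_rotate]
  have l0 := ang_lt_pi hs h
  have l1 := ang_lt_pi hs h1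
  have l2 := ang_lt_pi hs h2
  have hqp : p - q ≠ 0 := by rw [sub_ne_zero]; rintro rfl; simp [orient] at h
  have hrq : q - r ≠ 0 := by rw [sub_ne_zero]; rintro rfl; simp [orient] at h1
  have hpr : r - p ≠ 0 := by rw [sub_ne_zero]; rintro rfl; simp [orient] at h2
  obtain ⟨a, ha⟩ := ang_eq s p q r
  obtain ⟨b, hb⟩ := ang_eq s q r p
  obtain ⟨c, hc⟩ := ang_eq s r p q
  obtain ⟨d, hd⟩ := dirArg_neg hqp
  obtain ⟨e, he⟩ := dirArg_neg hrq
  obtain ⟨f, hf⟩ := dirArg_neg hpr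
  rw [neg_sub] at hd he hf
  have hpi := Real.pi_pos
  -- the sum is congruent to `π` modulo `2π` and less than `3π`
  obtain ⟨z, hz⟩ : ∃ z : ℤ, ang s p q r + ang s q r p + ang s r p q =
      Real.pi + z * (2 * Real.pi) := by
    rw [ha, hb, hc, hd, he, hf]
    rcases hs with rfl | rfl
    · refine ⟨a + b + c - d - e - f - 2, ?_⟩; push_cast; ring
    · refine ⟨a + b + c + d + e + f + 1, ?_⟩; push_cast; ring
  have hz1 : (z : ℝ) < 1 := by
    by_contra! hge
    nlinarith [hz, l0, l1, l2]
  have hz0 : z ≤ 0 := by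
    have : z < 1 := by exact_mod_cast hz1
    omega
  have : (z : ℝ) ≤ 0 := by exact_mod_cast hz0
  nlinarith

/-! ### Closed polygonal curves -/

/-- A closed polygonal curve is encoded by a periodic sequence of vertices. -/
def Cyclic (f : ℕ → Plane) (n : ℕ) : Prop := 0 < n ∧ ∀ i, f (i + n) = f i

theorem Cyclic.exists_lt {f : ℕ → Plane} {n : ℕ} (h : Cyclic f n) (i : ℕ) :
    ∃ r < n, ∃ q, i = r + q * n ∧ ∀ k, f (i + k) = f (r + k) := by
  refine ⟨i % n, Nat.mod_lt _ h.1, i / n, (Nat.mod_add_div' i n).symm, fun k => ?_⟩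
  have hp : Function.Periodic f n := h.2
  conv_lhs => rw [← Nat.mod_add_div' i n]
  rw [add_right_comm]
  simpa using hp.nsmul (i / n) (i % n + k)

theorem Cyclic.exists_lt_eq {f : ℕ → Plane} {n : ℕ} (h : Cyclic f n) (i : ℕ) :
    ∃ r < n, f i = f r := by
  obtain ⟨r, hr, -, -, hf⟩ := h.exists_lt i
  exact ⟨r, hr, hf 0⟩

theorem Cyclic.sum_shift {f : ℕ → Plane} {n : ℕ} (h : Cyclic f n)
    (F : Plane → Plane → Plane → ℝ) (c : ℕ) :
    ∑ i ∈ Finset.range n, F (f (i + c)) (f (i + c + 1)) (f (i + c + 2)) =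
      ∑ i ∈ Finset.range n, F (f i) (f (i + 1)) (f (i + 2)) := by
  induction c with
  | zero => rfl
  | succ c ih =>
    rw [← ih]
    have h1 := Finset.sum_range_succ (fun i => F (f (i + c)) (f (i + c + 1)) (f (i + c + 2))) n
    have h2 := Finset.sum_range_succ' (fun i => F (f (i + c)) (f (i + c + 1)) (f (i + c + 2))) n
    have e0 : f (n + c) = f (0 + c) := by rw [zero_add, add_comm]; exact h.2 c
    have e1 : f (n + c + 1) = f (0 + c + 1) := by
      rw [zero_add, show n + c + 1 = c + 1 + n by ring]; exact h.2 _
    have e2 : f (n + c + 2) = f (0 + c + 2) := by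
      rw [zero_add, show n + c + 2 = c + 2 + n by ring]; exact h.2 _
    rw [h1, e0, e1, e2] at h2
    have h3 := add_right_cancel h2
    rw [h3]
    refine Finset.sum_congr rfl fun i _ => ?_
    simp only [show i + (c + 1) = i + 1 + c by ring]

/-- The vertices `f c, …, f (c + m)`, closed up by the chord from the last to the first one. -/
def subCycle (f : ℕ → Plane) (c m : ℕ) : ℕ → Plane := fun i => f (c + i % (m + 1))

theorem subCycle_of_le (f : ℕ → Plane) (c : ℕ) {m i : ℕ} (h : i ≤ m) :
    subCycle f c m i = f (c + i) := by
  rw [subCycle, Nat.mod_eq_of_lt (Nat.lt_succ_of_le h)]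

theorem cyclic_subCycle (f : ℕ → Plane) (c m : ℕ) : Cyclic (subCycle f c m) (m + 1) :=
  ⟨Nat.succ_pos m, fun i => by simp [subCycle]⟩

theorem subCycle_succ (f : ℕ → Plane) (c m : ℕ) : subCycle f c m (m + 1) = f c := by
  simp [subCycle]

theorem subCycle_succ_succ (f : ℕ → Plane) (c : ℕ) {m : ℕ} (h : 1 ≤ m) :
    subCycle f c m (m + 2) = f (c + 1) := by
  rw [show m + 2 = 1 + (m + 1) by ring, (cyclic_subCycle f c m).2, subCycle_of_le f c h]

theorem sum_subCycle (f : ℕ → Plane) (c m : ℕ) (F : Plane → Plane → ℝ) :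
    ∑ i ∈ Finset.range (m + 1), F (subCycle f c m i) (subCycle f c m (i + 1)) =
      ∑ i ∈ Finset.range m, F (f (c + i)) (f (c + i + 1)) + F (f (c + m)) (f c) := by
  rw [Finset.sum_range_succ, subCycle_succ, subCycle_of_le f c le_rfl]
  congr 1
  refine Finset.sum_congr rfl fun i hi => ?_
  have := Finset.mem_range.1 hi
  rw [subCycle_of_le f c (by omega), subCycle_of_le f c (by omega), add_assoc]

theorem sum_corners_subCycle (f : ℕ → Plane) (c m : ℕ) (F : Plane → Plane → Plane → ℝ) :
    ∑ i ∈ Finset.range (m + 2), F (subCycle f c (m + 1) i) (subCycle f c (m + 1) (i + 1))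
        (subCycle f c (m + 1) (i + 2)) =
      ∑ i ∈ Finset.range m, F (f (c + i)) (f (c + i + 1)) (f (c + i + 2)) +
        F (f (c + m)) (f (c + m + 1)) (f c) + F (f (c + m + 1)) (f c) (f (c + 1)) := by
  rw [Finset.sum_range_succ, Finset.sum_range_succ]
  have e1 := subCycle_succ f c (m + 1)
  have e2 := subCycle_succ_succ f c (m := m + 1) (by omega)
  rw [e1, e2, subCycle_of_le f c (m := m + 1) (i := m) (by omega),
    subCycle_of_le f c (m := m + 1) (i := m + 1) (by omega), ← add_assoc c m 1]
  congr 2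
  refine Finset.sum_congr rfl fun i hi => ?_
  have := Finset.mem_range.1 hi
  rw [subCycle_of_le f c (by omega), subCycle_of_le f c (by omega),
    subCycle_of_le f c (by omega), add_assoc, add_assoc]

/-! ### Fillings of closed polygonal curves -/

/-- The vertex `v` of the curve is exposed: a linear functional takes its minimum over the
vertices only there. -/
def Exposed (f : ℕ → Plane) (v : Plane) : Prop :=
  ∃ ν : Plane, ∀ j, f j ≠ v → lin ν v < lin ν (f j)

/-- What a triangulation of the closed polygon `f` into triangles of orientation `s` (`1` for
counterclockwise, `-1` for clockwise) provides, where `K` is the union of the triangles: the sign of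
the area, the bound on the sum of the interior angles, the turns at exposed vertices, and the local
structure of `K` away from the vertices. -/
structure Filling (f : ℕ → Plane) (n : ℕ) (s : ℝ) (K : Set Plane) : Prop where
  cyclic : Cyclic f n
  area : 0 < s * ∑ i ∈ Finset.range n, cr (f i) (f (i + 1))
  angle : ∑ i ∈ Finset.range n, ang s (f i) (f (i + 1)) (f (i + 2)) ≤ (n - 2) * Real.pi
  turn : ∀ i, Exposed f (f (i + 1)) → 0 < s * orient (f i) (f (i + 1)) (f (i + 2))
  closed : IsClosed K
  subset_hull : K ⊆ convexHull ℝ (range f)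
  mem_nhds : ∀ x ∈ K, (∀ i, x ∉ segment ℝ (f i) (f (i + 1))) → K ∈ 𝓝 x
  side : ∀ i, ∀ x ∈ openSegment ℝ (f i) (f (i + 1)),
    ∀ᶠ y in 𝓝 x, 0 ≤ s * orient (f i) (f (i + 1)) y → y ∈ K

/-- A filling does not depend on the vertex at which the list of vertices starts. -/
theorem Filling.of_shift {f : ℕ → Plane} {n : ℕ} {s : ℝ} {K : Set Plane} (hf : Cyclic f n)
    {c : ℕ} (h : Filling (fun i => f (i + c)) n s K) : Filling f n s K := by
  -- every index is congruent modulo `n` to one of the form `j + c`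
  have key : ∀ i, ∃ j, ∀ k, f (i + k) = f (j + k + c) := by
    intro i
    refine ⟨i + c * n - c, fun k => ?_⟩
    have hp : Function.Periodic f n := hf.2
    have h1 := hp.nsmul c (i + k)
    have h2 : c ≤ c * n := Nat.le_mul_of_pos_right _ hf.1
    rw [← h1]
    congr 1
    simp only [smul_eq_mul]
    omega
  have hr : range (fun i => f (i + c)) = range f := by
    apply Subset.antisymm
    · rintro _ ⟨i, rfl⟩; exact ⟨_, rfl⟩
    · rintro _ ⟨i, rfl⟩
      obtain ⟨j, hj⟩ := key i
      exact ⟨j, (hj 0).symm⟩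
  have hexp : ∀ v, Exposed f v → Exposed (fun i => f (i + c)) v := by
    rintro v ⟨ν, hν⟩
    exact ⟨ν, fun j hj => hν _ hj⟩
  refine ⟨hf, ?_, ?_, ?_, h.closed, hr ▸ h.subset_hull, ?_, ?_⟩
  · have h1 := hf.sum_shift (fun a b _ => cr a b) c
    have h2 := h.area
    simp only [add_right_comm _ 1 c] at h2
    rwa [h1] at h2
  · have h1 := hf.sum_shift (ang s) c
    have h2 := h.angle
    simp only [add_right_comm _ 1 c] at h2
    rwa [h1] at h2
  · intro i hi
    obtain ⟨j, hj⟩ := key i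
    have e0 := hj 0
    rw [hj 1] at hi
    simp only [add_zero] at e0
    rw [e0, hj 1, hj 2]
    exact h.turn j (hexp _ hi)
  · intro x hx hxi
    exact h.mem_nhds x hx fun i => by
      have := hxi (i + c)
      rwa [add_right_comm] at this
  · intro i
    obtain ⟨j, hj⟩ := key i
    have e0 := hj 0
    simp only [add_zero] at e0
    rw [e0, hj 1]
    exact h.side j

theorem Filling.triangle {f : ℕ → Plane} {s : ℝ} (hs : s = 1 ∨ s = -1) (hf : Cyclic f 3)
    (h : 0 < s * orient (f 0) (f 1) (f 2)) : ∃ K, Filling f 3 s K := by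
  have hall : ∀ i, 0 < s * orient (f i) (f (i + 1)) (f (i + 2)) := by
    intro i
    induction i with
    | zero => exact h
    | succ i ih =>
      rw [show i + 1 + 2 = i + 3 by ring, hf.2, orient_rotate]; exact ih
  set K : Set Plane := {x | ∀ i, 0 ≤ s * orient (f i) (f (i + 1)) x} with hK
  have hcont : ∀ i, Continuous fun x => s * orient (f i) (f (i + 1)) x := fun i =>
    continuous_const.mul (continuous_orient _ _)
  have hmem : ∀ i x, 0 ≤ s * orient (f i) (f (i + 1)) x →
      0 ≤ s * orient (f (i + 1)) (f (i + 2)) x → 0 ≤ s * orient (f (i + 2)) (f i) x → x ∈ K := by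
    intro i x h0 h1 h2 j
    have h2' : 0 ≤ s * orient (f (i + 2)) (f (i + 3)) x := by rw [hf.2]; exact h2
    obtain ⟨r, hr, q, -, hrf⟩ := hf.exists_lt j
    obtain ⟨t, ht, p, hi, htf⟩ := hf.exists_lt i
    have er := hrf 0
    have et0 := htf 0
    have et1 := htf 1
    have et2 := htf 2
    have et3 := htf 3
    simp only [add_zero] at er et0
    rw [er, hrf 1]
    rw [et0, et1] at h0
    rw [et1, et2] at h1
    rw [et2, et3] at h2'
    have e3 : f 3 = f 0 := hf.2 0
    have e4 : f 4 = f 1 := hf.2 1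
    have e5 : f 5 = f 2 := hf.2 2
    interval_cases t <;> interval_cases r <;> simp_all
  have hbd : ∀ i, ∀ x ∈ K, s * orient (f i) (f (i + 1)) x = 0 →
      x ∈ segment ℝ (f i) (f (i + 1)) := by
    intro i x hx h0
    refine mem_segment_of_orient (hall i) (hx (i + 1)) ?_ ?_
    · have := hx (i + 2)
      rwa [show i + 2 + 1 = i + 3 by ring, hf.2] at this
    · rcases hs with rfl | rfl <;> linarith
  refine ⟨K, hf, ?_, ?_, fun i _ => hall i, ?_, ?_, ?_, ?_⟩
  · have e3 : f 3 = f 0 := hf.2 0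
    simp only [Finset.sum_range_succ, Finset.sum_range_zero, zero_add, Nat.reduceAdd, e3]
    rw [show cr (f 0) (f 1) + cr (f 1) (f 2) + cr (f 2) (f 0) = orient (f 0) (f 1) (f 2) by
      simp only [cr, orient]; ring]
    exact h
  · have e3 : f 3 = f 0 := hf.2 0
    have e4 : f 4 = f 1 := hf.2 1
    simp only [Finset.sum_range_succ, Finset.sum_range_zero, zero_add, Nat.reduceAdd, e3, e4]
    have := ang_triangle hs h
    push_cast
    linarith
  · simp only [hK, Set.ofPred_forall]
    exact isClosed_iInter fun i => isClosed_le continuous_const (hcont i)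
  · intro x hx
    refine mem_of_convex_of_orient (convex_convexHull ℝ _) (u := f 0) (v := f 1) (w := f 2)
      (subset_convexHull ℝ _ ⟨0, rfl⟩) (subset_convexHull ℝ _ ⟨1, rfl⟩)
      (subset_convexHull ℝ _ ⟨2, rfl⟩) h (hx 1) ?_ (hx 0)
    have := hx 2
    rwa [show 2 + 1 = 0 + 3 by ring, hf.2] at this
  · intro x hx hxi
    have hpos : ∀ i, 0 < s * orient (f i) (f (i + 1)) x := fun i =>
      lt_of_le_of_ne (hx i) fun h0 => hxi i (hbd i x hx h0.symm)
    have e : ∀ i, ∀ᶠ y in 𝓝 x, 0 < s * orient (f i) (f (i + 1)) y := fun i =>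
      (hcont i).continuousAt.eventually (lt_mem_nhds (hpos i))
    filter_upwards [e 0, e 1, e 2] with y h0 h1 h2
    refine hmem 0 y h0.le h1.le ?_
    rw [show 2 + 1 = 0 + 3 by ring, hf.2] at h2
    exact h2.le
  · intro i x hx
    obtain ⟨t, t0, t1, rfl⟩ := mem_openSegment_iff_add.1 hx
    have h1 : 0 < s * orient (f (i + 1)) (f (i + 2)) (f i + t • (f (i + 1) - f i)) := by
      rw [orient_add_smul, orient_self_left, orient_rotate]
      have := mul_pos (sub_pos.2 t1) (hall i)
      linarith
    have h2 : 0 < s * orient (f (i + 2)) (f i) (f i + t • (f (i + 1) - f i)) := by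
      rw [orient_add_smul, orient_self_right, orient_rotate (f (i + 1)), orient_rotate (f i)]
      have := mul_pos t0 (hall i)
      linarith
    have c1 : Continuous fun y => s * orient (f (i + 1)) (f (i + 2)) y :=
      continuous_const.mul (continuous_orient _ _)
    have c2 : Continuous fun y => s * orient (f (i + 2)) (f i) y :=
      continuous_const.mul (continuous_orient _ _)
    filter_upwards [c1.continuousAt.eventually (lt_mem_nhds h1),
      c2.continuousAt.eventually (lt_mem_nhds h2)] with y hy1 hy2 hy
    exact hmem i y hy hy1.le hy2.le

/-- Two fillings of the same orientation, on both sides of a chord, give a filling. -/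
theorem Filling.join {f : ℕ → Plane} {k l : ℕ} {s : ℝ} {K₁ K₂ : Set Plane}
    (hf : Cyclic f (k + l + 2))
    (hne : ∀ i j, i < j → j < k + l + 2 → f i ≠ f j)
    (hk : 1 ≤ k) (hl : 1 ≤ l)
    (h₁ : Filling (subCycle f 0 (k + 1)) (k + 2) s K₁)
    (h₂ : Filling (subCycle f (k + 1) (l + 1)) (l + 2) s K₂) :
    Filling f (k + l + 2) s (K₁ ∪ K₂) := by
  set g₁ := subCycle f 0 (k + 1) with hg₁
  set g₂ := subCycle f (k + 1) (l + 1) with hg₂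
  have efn : f (k + l + 2) = f 0 := by simpa using hf.2 0
  have efn1 : f (k + l + 3) = f 1 := by
    have := hf.2 1
    rwa [show 1 + (k + l + 2) = k + l + 3 by ring] at this
  have e1 : ∀ i, i ≤ k + 1 → g₁ i = f i := fun i hi => by
    rw [hg₁, subCycle_of_le f 0 hi, zero_add]
  have e2 : ∀ i, i ≤ l + 1 → g₂ i = f (k + 1 + i) := fun i hi => by
    rw [hg₂, subCycle_of_le f _ hi]
  have e1' : g₁ (k + 2) = f 0 := subCycle_succ f 0 (k + 1)
  have e1'' : g₁ (k + 3) = f 1 := by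
    have := subCycle_succ_succ f 0 (m := k + 1) (by omega); simpa using this
  have e2' : g₂ (l + 2) = f (k + 1) := subCycle_succ f (k + 1) (l + 1)
  have e2'' : g₂ (l + 3) = f (k + 2) := subCycle_succ_succ f (k + 1) (m := l + 1) (by omega)
  have e20 : g₂ (l + 1) = f 0 := by
    rw [e2 _ le_rfl, show k + 1 + (l + 1) = k + l + 2 by ring, efn]
  have r1 : range g₁ ⊆ range f := by rintro _ ⟨i, rfl⟩; exact ⟨_, rfl⟩
  have r2 : range g₂ ⊆ range f := by rintro _ ⟨i, rfl⟩; exact ⟨_, rfl⟩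
  have x1 : ∀ v, Exposed f v → Exposed g₁ v := by
    rintro v ⟨ν, hν⟩; exact ⟨ν, fun j hj => hν _ hj⟩
  have x2 : ∀ v, Exposed f v → Exposed g₂ v := by
    rintro v ⟨ν, hν⟩; exact ⟨ν, fun j hj => hν _ hj⟩
  refine ⟨hf, ?_, ?_, ?_, h₁.closed.union h₂.closed,
    union_subset (h₁.subset_hull.trans (convexHull_mono r1))
      (h₂.subset_hull.trans (convexHull_mono r2)), ?_, ?_⟩
  · have a1 := h₁.area
    have a2 := h₂.area
    rw [hg₁, sum_subCycle] at a1
    rw [hg₂, sum_subCycle] at a2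
    have e : ∑ i ∈ Finset.range (k + l + 2), cr (f i) (f (i + 1)) =
        ∑ i ∈ Finset.range (k + 1), cr (f (0 + i)) (f (0 + i + 1)) +
        ∑ i ∈ Finset.range (l + 1), cr (f (k + 1 + i)) (f (k + 1 + i + 1)) := by
      rw [show k + l + 2 = (k + 1) + (l + 1) by ring, Finset.sum_range_add]
      simp only [zero_add]
    rw [e]
    rw [show k + 1 + (l + 1) = k + l + 2 by ring, efn] at a2
    simp only [zero_add] at a1 ⊢
    have ec : cr (f 0) (f (k + 1)) = -cr (f (k + 1)) (f 0) := by simp only [cr]; ring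
    rw [ec] at a2
    rw [mul_add] at a1 a2 ⊢
    linarith
  · have a1 := h₁.angle
    have a2 := h₂.angle
    rw [hg₁, sum_corners_subCycle] at a1
    rw [hg₂, sum_corners_subCycle] at a2
    have e : ∑ i ∈ Finset.range (k + l + 2), ang s (f i) (f (i + 1)) (f (i + 2)) =
        ∑ i ∈ Finset.range k, ang s (f (0 + i)) (f (0 + i + 1)) (f (0 + i + 2)) +
        ang s (f k) (f (k + 1)) (f (k + 2)) +
        ∑ i ∈ Finset.range l, ang s (f (k + 1 + i)) (f (k + 1 + i + 1)) (f (k + 1 + i + 2)) +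
        ang s (f (k + l + 1)) (f 0) (f 1) := by
      rw [Finset.sum_range_succ, show k + l + 1 = (k + 1) + l by ring, Finset.sum_range_add,
        Finset.sum_range_succ, show k + 1 + l + 1 = k + l + 2 by ring,
        show k + 1 + l + 2 = k + l + 3 by ring, efn, efn1]
      simp only [zero_add]
    rw [e]
    have s1 := ang_le_add s (f k) (f 0) (f (k + 2)) (f (k + 1))
    have s2 := ang_le_add s (f (k + l + 1)) (f (k + 1)) (f 1) (f 0)
    rw [show k + 1 + l + 1 = k + l + 2 by ring, efn, show k + 1 + l = k + l + 1 by ring,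
      show k + 1 + 1 = k + 2 by ring] at a2
    simp only [zero_add] at a1 ⊢
    push_cast at a1 a2 ⊢
    linarith
  · intro i hi
    obtain ⟨r, hr, -, -, hrf⟩ := hf.exists_lt i
    have er := hrf 0
    simp only [add_zero] at er
    rw [hrf 1] at hi
    rw [er, hrf 1, hrf 2]
    rcases lt_trichotomy r k with h | rfl | h
    · have := h₁.turn r
      rw [e1 r (by omega), e1 (r + 1) (by omega), e1 (r + 2) (by omega)] at this
      exact this (x1 _ hi)
    · have t1 := h₁.turn r
      rw [e1 r (by omega), e1 (r + 1) (by omega), e1'] at t1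
      have t2 := h₂.turn (l + 1)
      rw [e20, e2', e2''] at t2
      obtain ⟨ν, hν⟩ := hi
      refine turn_trans (ν := ν) (hν _ ?_) (hν _ ?_) (hν _ ?_) (t1 (x1 _ ⟨ν, hν⟩))
        (t2 (x2 _ ⟨ν, hν⟩))
      · exact hne _ _ (by omega) (by omega)
      · exact hne _ _ (by omega) (by omega)
      · exact (hne _ _ (by omega) (by omega)).symm
    · rcases Nat.lt_or_ge r (k + l + 1) with h' | h'
      · obtain ⟨p, rfl⟩ := Nat.exists_eq_add_of_le (show k + 1 ≤ r by omega)
        have := h₂.turn p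
        rw [e2 p (by omega), e2 (p + 1) (by omega), e2 (p + 2) (by omega)] at this
        exact this (x2 _ hi)
      · obtain rfl : r = k + l + 1 := by omega
        have t2 := h₂.turn l
        rw [e2 l (by omega), e20, e2'] at t2
        have t1 := h₁.turn (k + 1)
        rw [e1 (k + 1) (by omega), e1', e1''] at t1
        rw [show k + l + 1 + 1 = k + l + 2 by ring, efn] at hi ⊢
        rw [show k + l + 1 + 2 = k + l + 3 by ring, efn1]
        obtain ⟨ν, hν⟩ := hi
        rw [show k + 1 + l = k + l + 1 by ring] at t2
        refine turn_trans (ν := ν) (hν _ ?_) (hν _ ?_) (hν _ ?_) (t2 (x2 _ ⟨ν, hν⟩))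
          (t1 (x1 _ ⟨ν, hν⟩))
        · exact (hne _ _ (by omega) (by omega)).symm
        · exact (hne _ _ (by omega) (by omega)).symm
        · exact (hne _ _ (by omega) (by omega)).symm
  · intro x hx hxi
    -- a point on an edge of one of the parts but on no edge of `f` lies inside the chord
    have hchord : x ∈ segment ℝ (f (k + 1)) (f 0) → K₁ ∪ K₂ ∈ 𝓝 x := by
      intro hxc
      have n1 : f (k + 1) ≠ x := fun h => hxi (k + 1) (h ▸ left_mem_segment ℝ _ _)
      have n0 : f 0 ≠ x := fun h => hxi 0 (h ▸ left_mem_segment ℝ _ _)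
      have ho := mem_openSegment_of_ne_left_right n1 n0 hxc
      have s1 := h₁.side (k + 1)
      rw [e1 (k + 1) (by omega), e1'] at s1
      have s2 := h₂.side (l + 1)
      rw [e20, e2'] at s2
      have ho' := ho
      rw [openSegment_symm] at ho'
      filter_upwards [s1 x ho, s2 x ho'] with y y1 y2
      rcases le_total 0 (s * orient (f (k + 1)) (f 0) y) with h | h
      · exact Or.inl (y1 h)
      · refine Or.inr (y2 ?_)
        rw [orient_swap]; linarith
    rcases hx with hx | hx
    · by_cases hb : ∀ i, x ∉ segment ℝ (g₁ i) (g₁ (i + 1))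
      · exact mem_of_superset (h₁.mem_nhds x hx hb) subset_union_left
      · push Not at hb
        obtain ⟨i, hi⟩ := hb
        obtain ⟨r, hr, -, -, hrf⟩ := h₁.cyclic.exists_lt i
        have er := hrf 0
        simp only [add_zero] at er
        rw [er, hrf 1] at hi
        rcases Nat.lt_or_ge r (k + 1) with h | h
        · rw [e1 r (by omega), e1 (r + 1) (by omega)] at hi
          exact absurd hi (hxi r)
        · obtain rfl : r = k + 1 := by omega
          rw [e1 _ le_rfl, e1'] at hi
          exact hchord hi
    · by_cases hb : ∀ i, x ∉ segment ℝ (g₂ i) (g₂ (i + 1))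
      · exact mem_of_superset (h₂.mem_nhds x hx hb) subset_union_right
      · push Not at hb
        obtain ⟨i, hi⟩ := hb
        obtain ⟨r, hr, -, -, hrf⟩ := h₂.cyclic.exists_lt i
        have er := hrf 0
        simp only [add_zero] at er
        rw [er, hrf 1] at hi
        rcases Nat.lt_or_ge r (l + 1) with h | h
        · rw [e2 r (by omega), e2 (r + 1) (by omega)] at hi
          exact absurd hi (hxi (k + 1 + r))
        · obtain rfl : r = l + 1 := by omega
          rw [e20, e2', segment_symm] at hi
          exact hchord hi
  · intro i
    obtain ⟨r, hr, -, -, hrf⟩ := hf.exists_lt i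
    have er := hrf 0
    simp only [add_zero] at er
    rw [er, hrf 1]
    intro x hx
    rcases Nat.lt_or_ge r (k + 1) with h | h
    · have := h₁.side r
      rw [e1 r (by omega), e1 (r + 1) (by omega)] at this
      filter_upwards [this x hx] with y hy h0 using Or.inl (hy h0)
    · obtain ⟨p, rfl⟩ := Nat.exists_eq_add_of_le h
      have := h₂.side p
      rw [e2 p (by omega), e2 (p + 1) (by omega)] at this
      filter_upwards [this x hx] with y hy h0 using Or.inr (hy h0)

/-! ### Simple polygons have fillings -/

/-- A simple closed polygonal curve: two edges meet at most in a common endpoint of two consecutive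
edges. -/
structure SimpleCycle (f : ℕ → Plane) (n : ℕ) : Prop where
  cyclic : Cyclic f n
  three_le : 3 ≤ n
  ne : ∀ i, f i ≠ f (i + 1)
  inter : ∀ i j, i < j → j < i + n → ∀ x ∈ segment ℝ (f i) (f (i + 1)),
    x ∈ segment ℝ (f j) (f (j + 1)) → (j = i + 1 ∧ x = f j) ∨ (j + 1 = i + n ∧ x = f i)

theorem SimpleCycle.of_lt {f : ℕ → Plane} {n : ℕ} (hf : Cyclic f n) (hn : 3 ≤ n)
    (hne : ∀ i < n, f i ≠ f (i + 1))
    (h : ∀ i j, i < j → j < n → ∀ x ∈ segment ℝ (f i) (f (i + 1)),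
      x ∈ segment ℝ (f j) (f (j + 1)) → (j = i + 1 ∧ x = f j) ∨ (i = 0 ∧ j + 1 = n ∧ x = f 0)) :
    SimpleCycle f n := by
  refine ⟨hf, hn, fun i => ?_, fun i j hij hj x hxi hxj => ?_⟩
  · obtain ⟨r, hr, q, hq, hrf⟩ := hf.exists_lt i
    have e0 := hrf 0
    simp only [add_zero] at e0
    rw [e0, hrf 1]
    exact hne r hr
  · obtain ⟨r, hr, q, hq, hrf⟩ := hf.exists_lt i
    have e0 := hrf 0
    simp only [add_zero] at e0
    obtain ⟨d, rfl⟩ := Nat.exists_eq_add_of_lt hij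
    have ej := hrf (d + 1)
    have ej1 := hrf (d + 2)
    rw [e0, hrf 1] at hxi
    rw [show i + d + 1 + 1 = i + (d + 2) by ring, ej1, show i + d + 1 = i + (d + 1) by ring,
      ej] at hxj
    rw [show i + d + 1 = i + (d + 1) by ring, ej, e0]
    rcases Nat.lt_or_ge (r + (d + 1)) n with h1 | h1
    · rcases h r (r + (d + 1)) (by omega) h1 x hxi hxj with ⟨h2, h3⟩ | ⟨h2, h3, h4⟩
      · exact Or.inl ⟨by omega, h3⟩
      · subst h2
        exact Or.inr ⟨by omega, h4⟩
    · obtain ⟨t, ht⟩ := Nat.exists_eq_add_of_le h1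
      have et : f (r + (d + 1)) = f t := by rw [ht, add_comm]; exact hf.2 t
      have et1 : f (r + (d + 2)) = f (t + 1) := by
        rw [show r + (d + 2) = t + 1 + n by omega]; exact hf.2 _
      rw [et, et1] at hxj
      rw [et]
      rcases h t r (by omega) hr x hxj hxi with ⟨h2, h3⟩ | ⟨h2, h3, h4⟩
      · exact Or.inr ⟨by omega, h3⟩
      · subst h2
        exact Or.inl ⟨by omega, h4⟩

namespace SimpleCycle

variable {f : ℕ → Plane} {n : ℕ}

theorem shift (h : SimpleCycle f n) (c : ℕ) : SimpleCycle (fun i => f (i + c)) n := by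
  refine ⟨⟨h.cyclic.1, fun i => ?_⟩, h.three_le, fun i => ?_, fun i j hij hj x hxi hxj => ?_⟩
  · simp only [add_right_comm i n c]; exact h.cyclic.2 _
  · have := h.ne (i + c); rwa [add_right_comm] at this
  · rw [add_right_comm] at hxi hxj
    rcases h.inter (i + c) (j + c) (by omega) (by omega) x hxi hxj with ⟨h1, h2⟩ | ⟨h1, h2⟩
    · exact Or.inl ⟨by omega, h2⟩
    · exact Or.inr ⟨by omega, h2⟩

theorem ne_of_lt (h : SimpleCycle f n) {i j : ℕ} (hij : i < j) (hj : j < i + n) :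
    f i ≠ f j := by
  intro e
  rcases h.inter i j hij hj (f i) (left_mem_segment ℝ _ _) (e ▸ left_mem_segment ℝ _ _) with
    ⟨h1, -⟩ | ⟨h1, -⟩
  · subst h1; exact h.ne i e
  · apply h.ne j
    rw [h1, h.cyclic.2, e]

theorem vertex_mem (h : SimpleCycle f n) {i k : ℕ} (hi : i < n) (hk : k < n)
    (hm : f k ∈ segment ℝ (f i) (f (i + 1))) : k = i ∨ k = i + 1 ∨ (k = 0 ∧ i + 1 = n) := by
  rcases lt_trichotomy k i with hlt | heq | hgt
  · rcases h.inter k i hlt (by omega) (f k) (left_mem_segment ℝ _ _) hm with ⟨-, h2⟩ | ⟨h1, -⟩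
    · exact absurd h2 (h.ne_of_lt hlt (by omega))
    · right; right; omega
  · exact Or.inl heq
  · rcases h.inter i k hgt (by omega) (f k) hm (left_mem_segment ℝ _ _) with ⟨h1, -⟩ | ⟨-, h2⟩
    · exact Or.inr (Or.inl h1)
    · exact absurd h2.symm (h.ne_of_lt hgt (by omega))

/-- The chord from the vertex `f 0` to the vertex `f k` meets the curve only in its endpoints. -/
def IsDiagonal (f : ℕ → Plane) (n k : ℕ) : Prop :=
  ∀ i < n, ∀ x ∈ segment ℝ (f 0) (f k), x ∈ segment ℝ (f i) (f (i + 1)) →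
    (x = f 0 ∧ (i = 0 ∨ i + 1 = n)) ∨ (x = f k ∧ (i + 1 = k ∨ i = k))

theorem subCycle_left (h : SimpleCycle f n) {k : ℕ} (hk : 2 ≤ k) (hkn : k < n)
    (hd : IsDiagonal f n k) : SimpleCycle (subCycle f 0 k) (k + 1) := by
  have e : ∀ i, i ≤ k → subCycle f 0 k i = f i := fun i hi => by
    rw [subCycle_of_le f 0 hi, zero_add]
  have e' : subCycle f 0 k (k + 1) = f 0 := subCycle_succ f 0 k
  refine SimpleCycle.of_lt (cyclic_subCycle f 0 k) (by omega) (fun i hi => ?_)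
    (fun i j hij hj x hxi hxj => ?_)
  · rcases Nat.lt_or_ge i k with h1 | h1
    · rw [e i (by omega), e (i + 1) (by omega)]; exact h.ne i
    · obtain rfl : i = k := by omega
      rw [e i le_rfl, e']; exact (h.ne_of_lt (by omega) (by omega)).symm
  · rw [e i (by omega), e (i + 1) (by omega)] at hxi
    rcases Nat.lt_or_ge j k with h1 | h1
    · rw [e j (by omega), e (j + 1) (by omega)] at hxj
      rw [e j (by omega)]
      rcases h.inter i j hij (by omega) x hxi hxj with h2 | ⟨h2, -⟩
      · exact Or.inl h2
      · omega
    · obtain rfl : j = k := by omega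
      rw [e j le_rfl, e', segment_symm] at hxj
      rw [e j le_rfl, e 0 (by omega)]
      rcases hd i (by omega) x hxj hxi with ⟨h2, h3⟩ | ⟨h2, h3⟩
      · right; refine ⟨by omega, rfl, h2⟩
      · left; exact ⟨by omega, h2⟩

theorem subCycle_right (h : SimpleCycle f n) {k l : ℕ} (hk : 1 ≤ k) (hl : 2 ≤ l) (hkn : k + l = n)
    (hd : IsDiagonal f n k) : SimpleCycle (subCycle f k l) (l + 1) := by
  have e : ∀ i, i ≤ l → subCycle f k l i = f (k + i) := fun i hi => subCycle_of_le f k hi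
  have e' : subCycle f k l (l + 1) = f k := subCycle_succ f k l
  have en : f n = f 0 := by simpa using h.cyclic.2 0
  have el : subCycle f k l l = f 0 := by rw [e l le_rfl, hkn, en]
  refine SimpleCycle.of_lt (cyclic_subCycle f k l) (by omega) (fun i hi => ?_)
    (fun i j hij hj x hxi hxj => ?_)
  · rcases Nat.lt_or_ge i l with h1 | h1
    · rw [e i (by omega), e (i + 1) (by omega)]; exact h.ne _
    · obtain rfl : i = l := by omega
      rw [el, e']; exact h.ne_of_lt (by omega) (by omega)
  · rw [e i (by omega), e (i + 1) (by omega)] at hxi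
    rcases Nat.lt_or_ge j l with h1 | h1
    · rw [e j (by omega), e (j + 1) (by omega)] at hxj
      rw [e j (by omega)]
      rcases h.inter (k + i) (k + j) (by omega) (by omega) x hxi hxj with h2 | ⟨h2, -⟩
      · exact Or.inl ⟨by omega, h2.2⟩
      · omega
    · obtain rfl : j = l := by omega
      rw [el, e'] at hxj
      rw [el, e 0 (by omega)]
      rcases hd (k + i) (by omega) x hxj hxi with ⟨h2, h3⟩ | ⟨h2, h3⟩
      · left; refine ⟨by omega, h2⟩
      · right; exact ⟨by omega, rfl, h2⟩

end SimpleCycle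

/-- A segment that leaves the cone of a triangle at its vertex `v`, without coming closer to the
side `wu`, crosses one of the sides `uv` and `vw`. -/
theorem exists_mem_side {u v w p y : Plane} {s : ℝ} (hD : 0 < s * orient u v w)
    (hA : 0 < s * orient v w p) (hC : 0 < s * orient u v p) (hB : 0 ≤ s * orient w u p)
    (hBy : s * orient w u p ≤ s * orient w u y)
    (hy : ¬ (0 ≤ s * orient v w y ∧ 0 ≤ s * orient u v y)) :
    ∃ x ∈ segment ℝ p y, s * orient w u p ≤ s * orient w u x ∧
      (x ∈ segment ℝ v w ∨ x ∈ segment ℝ u v) := by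
  set Ap := s * orient v w p with hAp
  set Cp := s * orient u v p with hCp
  set Bp := s * orient w u p with hBp
  set Ay := s * orient v w y with hAy
  set Cy := s * orient u v y with hCy
  set By := s * orient w u y with hBy'
  have eA : ∀ t : ℝ, s * orient v w (p + t • (y - p)) = Ap + t * (Ay - Ap) := fun t => by
    rw [orient_add_smul]; ring
  have eB : ∀ t : ℝ, s * orient w u (p + t • (y - p)) = Bp + t * (By - Bp) := fun t => by
    rw [orient_add_smul]; ring
  have eC : ∀ t : ℝ, s * orient u v (p + t • (y - p)) = Cp + t * (Cy - Cp) := fun t => by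
    rw [orient_add_smul]; ring
  have hs : s ≠ 0 := by rintro rfl; simp at hD
  by_cases h : Ay < 0 ∧ Ap * (Cp - Cy) ≤ Cp * (Ap - Ay)
  · obtain ⟨h1, h2⟩ := h
    have hpos : 0 < Ap - Ay := by linarith
    set t := Ap / (Ap - Ay) with ht
    have t0 : 0 ≤ t := by positivity
    have t1 : t ≤ 1 := by rw [ht, div_le_one hpos]; linarith
    have htm : t * (Ap - Ay) = Ap := div_mul_cancel₀ _ hpos.ne'
    refine ⟨p + t • (y - p), mem_segment_iff_add.2 ⟨t, t0, t1, rfl⟩, ?_, Or.inl ?_⟩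
    · rw [eB]; nlinarith
    · refine mem_segment_of_orient (s := s) (w := u) (by rwa [orient_rotate]) ?_ ?_ ?_
      · rw [eB]; nlinarith
      · rw [eC]
        have : t * (Cp - Cy) ≤ Cp := by
          rw [ht, div_mul_eq_mul_div, div_le_iff₀ hpos]; exact h2
        linarith
      · have := eA t
        have h3 : s * orient v w (p + t • (y - p)) = 0 := by rw [this]; linarith
        exact (mul_eq_zero.1 h3).resolve_left hs
  · have h1 : Cy < 0 := by
      by_contra! hc
      apply hy
      refine ⟨?_, hc⟩
      by_contra! ha
      exact h ⟨ha, by nlinarith⟩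
    have h2 : Cp * (Ap - Ay) ≤ Ap * (Cp - Cy) := by
      by_contra! hc
      exact h ⟨by nlinarith, hc.le⟩
    have hpos : 0 < Cp - Cy := by linarith
    set t := Cp / (Cp - Cy) with ht
    have t0 : 0 ≤ t := by positivity
    have t1 : t ≤ 1 := by rw [ht, div_le_one hpos]; linarith
    have htm : t * (Cp - Cy) = Cp := div_mul_cancel₀ _ hpos.ne'
    refine ⟨p + t • (y - p), mem_segment_iff_add.2 ⟨t, t0, t1, rfl⟩, ?_, Or.inr ?_⟩
    · rw [eB]; nlinarith
    · refine mem_segment_of_orient (s := s) hD ?_ ?_ ?_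
      · rw [eA]
        have : t * (Ap - Ay) ≤ Ap := by
          rw [ht, div_mul_eq_mul_div, div_le_iff₀ hpos]; exact h2
        linarith
      · rw [eB]; nlinarith
      · have := eC t
        have h3 : s * orient u v (p + t • (y - p)) = 0 := by rw [this]; linarith
        exact (mul_eq_zero.1 h3).resolve_left hs

namespace SimpleCycle

variable {f : ℕ → Plane} {n : ℕ} {s : ℝ}

/-- If no vertex lies in the part of the corner at `f 1` that is farther than `β` from the line
through `f 0` and `f 2`, then no edge does, besides the two edges at `f 1`. -/
theorem edge_le (h : SimpleCycle f n) (hn : 4 ≤ n) (hD : 0 < s * orient (f 0) (f 1) (f 2))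
    {β : ℝ} (hβ : 0 ≤ β)
    (hmax : ∀ m, 3 ≤ m → m < n → 0 ≤ s * orient (f 1) (f 2) (f m) →
      0 ≤ s * orient (f 0) (f 1) (f m) → s * orient (f 2) (f 0) (f m) ≤ β)
    {i : ℕ} (hi : 2 ≤ i) (hin : i < n) {p : Plane} (hp : p ∈ segment ℝ (f i) (f (i + 1)))
    (hA : 0 < s * orient (f 1) (f 2) p) (hC : 0 < s * orient (f 0) (f 1) p) :
    s * orient (f 2) (f 0) p ≤ β := by
  by_contra! hB
  have en : f n = f 0 := by simpa using h.cyclic.2 0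
  have key : ∀ m, i ≤ m → m ≤ i + 1 → s * orient (f 2) (f 0) p ≤ s * orient (f 2) (f 0) (f m) →
      False := by
    intro m h1 h2 h3
    have hnot : ¬ (0 ≤ s * orient (f 1) (f 2) (f m) ∧ 0 ≤ s * orient (f 0) (f 1) (f m)) := by
      rintro ⟨h4, h5⟩
      rcases (show m = 2 ∨ m = n ∨ (3 ≤ m ∧ m < n) by omega) with rfl | rfl | ⟨h6, h7⟩
      · rw [orient_self_left] at h3; linarith
      · rw [en, orient_self_right] at h3; linarith
      · linarith [hmax m h6 h7 h4 h5]
    obtain ⟨x, hx, hBx, hx'⟩ := exists_mem_side hD hA hC (hβ.trans hB.le) h3 hnot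
    have hxe : x ∈ segment ℝ (f i) (f (i + 1)) := by
      refine (convex_segment _ _).segment_subset hp ?_ hx
      rcases (show m = i ∨ m = i + 1 by omega) with rfl | rfl
      · exact left_mem_segment ℝ _ _
      · exact right_mem_segment ℝ _ _
    rcases hx' with hx' | hx'
    · rcases (Nat.lt_or_ge 1 i) with h4 | h4
      · rcases h.inter 1 i h4 (by omega) x hx' hxe with ⟨h5, h6⟩ | ⟨h5, -⟩
        · subst h5
          rw [h6, orient_self_left] at hBx; linarith
        · omega
      · omega
    · rcases h.inter 0 i (by omega) (by omega) x hx' hxe with ⟨h5, -⟩ | ⟨-, h6⟩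
      · omega
      · rw [h6, orient_self_right] at hBx; linarith
  obtain ⟨t, t0, t1, ht⟩ := mem_segment_iff_add.1 hp
  rcases le_total (s * orient (f 2) (f 0) (f i)) (s * orient (f 2) (f 0) (f (i + 1))) with hle | hle
  · refine key (i + 1) (by omega) le_rfl ?_
    rw [ht, orient_add_smul]; nlinarith
  · refine key i le_rfl (by omega) ?_
    rw [ht, orient_add_smul]; nlinarith

/-- If the triangle at the exposed vertex `f 1` contains other vertices, then the one closest to
`f 1` is joined to it by a diagonal. -/
theorem exists_diagonal (h : SimpleCycle f n) (hn : 4 ≤ n)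
    (hD : 0 < s * orient (f 0) (f 1) (f 2))
    (hex : ∃ m, 3 ≤ m ∧ m < n ∧ 0 ≤ s * orient (f 1) (f 2) (f m) ∧
      0 ≤ s * orient (f 0) (f 1) (f m) ∧ 0 ≤ s * orient (f 2) (f 0) (f m)) :
    ∃ m, 3 ≤ m ∧ m < n ∧ 0 < s * orient (f 1) (f 2) (f m) ∧
      0 < s * orient (f 0) (f 1) (f m) ∧ IsDiagonal (fun i => f (i + 1)) n (m - 1) := by
  classical
  have hs : s ≠ 0 := by rintro rfl; simp at hD
  have en : f n = f 0 := by simpa using h.cyclic.2 0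
  set T := (Finset.range n).filter fun m => 3 ≤ m ∧ 0 ≤ s * orient (f 1) (f 2) (f m) ∧
      0 ≤ s * orient (f 0) (f 1) (f m) with hT
  obtain ⟨m₀, h3, hmn, hA₀, hC₀, hB₀⟩ := hex
  have hm₀ : m₀ ∈ T := by simp [hT, h3, hmn, hA₀, hC₀]
  obtain ⟨m, hm, hmax⟩ := T.exists_max_image (fun m => s * orient (f 2) (f 0) (f m)) ⟨m₀, hm₀⟩
  have hB : 0 ≤ s * orient (f 2) (f 0) (f m) := hB₀.trans (hmax _ hm₀)
  obtain ⟨hmn, h3, hA, hC⟩ : m < n ∧ 3 ≤ m ∧ 0 ≤ s * orient (f 1) (f 2) (f m) ∧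
      0 ≤ s * orient (f 0) (f 1) (f m) := by simpa [hT] using hm
  have hA' : 0 < s * orient (f 1) (f 2) (f m) := by
    refine lt_of_le_of_ne hA fun h0 => ?_
    have h0' := (mul_eq_zero.1 h0.symm).resolve_left hs
    have := mem_segment_of_orient (w := f 0) (s := s) (by rwa [orient_rotate]) hB hC h0'
    rcases h.vertex_mem (i := 1) (by omega) hmn this with h1 | h1 | h1 <;> omega
  have hC' : 0 < s * orient (f 0) (f 1) (f m) := by
    refine lt_of_le_of_ne hC fun h0 => ?_
    have h0' := (mul_eq_zero.1 h0.symm).resolve_left hs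
    have := mem_segment_of_orient (s := s) hD hA hB h0'
    rcases h.vertex_mem (i := 0) (by omega) hmn this with h1 | h1 | h1 <;> omega
  refine ⟨m, h3, hmn, hA', hC', ?_⟩
  have hle := fun {i} hi hin {p} => h.edge_le hn hD hB (i := i) (p := p) (fun m' h1 h2 h3 h4 =>
    hmax m' (by simp [hT, h1, h2, h3, h4])) hi hin
  intro i hi x hx hxi
  beta_reduce at hxi
  simp only [zero_add] at hx ⊢
  rw [Nat.sub_add_cancel (by omega)] at hx ⊢
  obtain ⟨t, t0, t1, rfl⟩ := mem_segment_iff_add.1 hx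
  have eA : orient (f 1) (f 2) (f 1 + t • (f m - f 1)) = t * orient (f 1) (f 2) (f m) := by
    rw [orient_add_smul, orient_self_left]; ring
  have eC : orient (f 0) (f 1) (f 1 + t • (f m - f 1)) = t * orient (f 0) (f 1) (f m) := by
    rw [orient_add_smul, orient_self_right]; ring
  have hA0 : orient (f 1) (f 2) (f m) ≠ 0 := by intro h0; rw [h0, mul_zero] at hA'; exact hA'.false
  have hC0 : orient (f 0) (f 1) (f m) ≠ 0 := by intro h0; rw [h0, mul_zero] at hC'; exact hC'.false
  rcases (show i = 0 ∨ i + 1 = n ∨ (2 ≤ i + 1 ∧ i + 1 < n) by omega) with h0 | h1 | ⟨h1, h2⟩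
  · subst h0
    have := orient_eq_zero_of_mem_segment hxi
    simp only [zero_add, Nat.reduceAdd] at this
    rw [eA] at this
    have := (mul_eq_zero.1 this).resolve_right hA0
    left; simp [this]
  · rw [h1, add_comm n 1, h.cyclic.2, en] at hxi
    have := orient_eq_zero_of_mem_segment hxi
    rw [eC] at this
    have := (mul_eq_zero.1 this).resolve_right hC0
    left; exact ⟨by simp [this], Or.inr h1⟩
  · rcases t0.eq_or_lt with h4 | h4
    · rw [← h4, zero_smul, add_zero] at hxi
      rcases h.vertex_mem h2 (by omega) hxi with h1 | h1 | h1 <;> omega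
    · have hBx := hle h1 h2 hxi (by rw [eA]; nlinarith) (by rw [eC]; nlinarith)
      have hsum := orient_add_orient_add_orient (f 0) (f 1) (f 2) (f m)
      rw [orient_add_smul, orient_rotate (f 1), orient_rotate (f 0)] at hBx
      have hlt : s * orient (f 2) (f 0) (f m) < s * orient (f 0) (f 1) (f 2) := by
        rw [← hsum]; linarith
      have ht : t = 1 := by
        by_contra hne
        have : t < 1 := lt_of_le_of_ne t1 hne
        nlinarith
      subst ht
      have ex : f 1 + (1 : ℝ) • (f m - f 1) = f m := by rw [one_smul]; abel
      rw [ex] at hxi ⊢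
      rcases h.vertex_mem h2 hmn hxi with h1 | h1 | h1
      · right; exact ⟨rfl, by omega⟩
      · right; exact ⟨rfl, by omega⟩
      · omega

/-- If the triangle at the vertex `f 1` contains no other vertices, then `f 0` and `f 2` are joined
by a diagonal. -/
theorem isDiagonal_of_empty (h : SimpleCycle f n) (hn : 4 ≤ n)
    (hD : 0 < s * orient (f 0) (f 1) (f 2))
    (hemp : ∀ m, 3 ≤ m → m < n → 0 ≤ s * orient (f 1) (f 2) (f m) →
      0 ≤ s * orient (f 0) (f 1) (f m) → s * orient (f 2) (f 0) (f m) < 0) :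
    IsDiagonal f n 2 := by
  have en : f n = f 0 := by simpa using h.cyclic.2 0
  have hs : s ≠ 0 := by rintro rfl; simp at hD
  have hD0 : orient (f 0) (f 1) (f 2) ≠ 0 := by intro h0; rw [h0, mul_zero] at hD; exact hD.false
  intro i hi x hx hxi
  obtain ⟨t, t0, t1, ht⟩ := mem_segment_iff_add.1 hx
  have eA : orient (f 1) (f 2) x = (1 - t) * orient (f 0) (f 1) (f 2) := by
    rw [ht, orient_add_smul, orient_self_right, orient_rotate]; ring
  have eC : orient (f 0) (f 1) x = t * orient (f 0) (f 1) (f 2) := by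
    rw [ht, orient_add_smul, orient_self_left]; ring
  have eB : orient (f 2) (f 0) x = 0 := by
    rw [ht, orient_add_smul, orient_self_right, orient_self_left]; ring
  have x0 : t = 0 → x = f 0 := fun h0 => by rw [ht, h0]; simp
  have x2 : t = 1 → x = f 2 := fun h0 => by rw [ht, h0, one_smul]; abel
  have hx0 : x = f 0 → (i = 0 ∨ i + 1 = n) := by
    intro e
    rw [e] at hxi
    rcases h.vertex_mem hi (by omega) hxi with h1 | h1 | h1 <;> omega
  have hx2 : x = f 2 → (i + 1 = 2 ∨ i = 2) := by
    intro e
    rw [e] at hxi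
    rcases h.vertex_mem hi (by omega) hxi with h1 | h1 | h1 <;> omega
  by_cases c0 : t = 0
  · exact Or.inl ⟨x0 c0, hx0 (x0 c0)⟩
  by_cases c1 : t = 1
  · exact Or.inr ⟨x2 c1, hx2 (x2 c1)⟩
  exfalso
  have t0' : 0 < t := lt_of_le_of_ne t0 (Ne.symm c0)
  have t1' : t < 1 := lt_of_le_of_ne t1 c1
  have hA : 0 < s * orient (f 1) (f 2) x := by rw [eA]; nlinarith
  have hC : 0 < s * orient (f 0) (f 1) x := by rw [eC]; nlinarith
  have n0 : x ≠ f 0 := by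
    intro e; rw [e, orient_self_left, mul_zero] at hC; exact hC.false
  have n2 : x ≠ f 2 := by
    intro e; rw [e, orient_self_right, mul_zero] at hA; exact hA.false
  have i0 : i ≠ 0 := by
    rintro rfl
    rw [orient_eq_zero_of_mem_segment hxi, mul_zero] at hC; exact hC.false
  have i1 : i ≠ 1 := by
    rintro rfl
    rw [orient_eq_zero_of_mem_segment hxi, mul_zero] at hA; exact hA.false
  obtain ⟨r, r0, r1, hr⟩ := mem_segment_iff_add.1 hxi
  have eBr := eB
  rw [hr, orient_add_smul] at eBr
  -- an endpoint of the edge other than `f 0` and `f 2`, not below the line through these two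
  obtain ⟨m, hm3, hmn, hmi, hBm⟩ : ∃ m, 3 ≤ m ∧ m < n ∧ (m = i ∨ m = i + 1) ∧
      0 ≤ s * orient (f 2) (f 0) (f m) := by
    by_cases i2 : i = 2
    · subst i2
      rw [orient_self_left] at eBr
      have hr0 : r ≠ 0 := by rintro rfl; apply n2; rw [hr]; simp
      refine ⟨3, le_rfl, by omega, Or.inr rfl, ?_⟩
      have : orient (f 2) (f 0) (f (2 + 1)) = 0 := by
        have : r * orient (f 2) (f 0) (f (2 + 1)) = 0 := by linarith
        exact (mul_eq_zero.1 this).resolve_left hr0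
      simp only [Nat.reduceAdd] at this
      rw [this, mul_zero]
    · by_cases il : i + 1 = n
      · rw [il, en, orient_self_right] at eBr
        rw [il, en] at hr
        have hr0 : 1 - r ≠ 0 := by
          intro h0
          have : r = 1 := by linarith
          apply n0; rw [hr, this, one_smul]; abel
        refine ⟨i, by omega, by omega, Or.inl rfl, ?_⟩
        have : orient (f 2) (f 0) (f i) = 0 := by
          have : (1 - r) * orient (f 2) (f 0) (f i) = 0 := by linarith
          exact (mul_eq_zero.1 this).resolve_left hr0
        rw [this, mul_zero]
      · rcases le_total 0 (s * orient (f 2) (f 0) (f i)) with h1 | h1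
        · exact ⟨i, by omega, by omega, Or.inl rfl, h1⟩
        · refine ⟨i + 1, by omega, by omega, Or.inr rfl, ?_⟩
          by_contra! h2
          have h3 : s * orient (f 2) (f 0) (f i) * (1 - r)
              + s * orient (f 2) (f 0) (f (i + 1)) * r = 0 := by
            linear_combination s * eBr
          rcases r0.eq_or_lt with h4 | h4
          · rw [← h4] at hr
            simp only [zero_smul, add_zero] at hr
            have := hemp i (by omega) (by omega) (hr ▸ hA.le) (hr ▸ hC.le)
            rw [← h4] at h3
            linarith
          · nlinarith
  have hnot : ¬ (0 ≤ s * orient (f 1) (f 2) (f m) ∧ 0 ≤ s * orient (f 0) (f 1) (f m)) := by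
    rintro ⟨h4, h5⟩
    linarith [hemp m hm3 hmn h4 h5]
  obtain ⟨y, hy, hBy, hy'⟩ := exists_mem_side hD hA hC (by rw [eB, mul_zero])
    (by rw [eB, mul_zero]; exact hBm) hnot
  have hye : y ∈ segment ℝ (f i) (f (i + 1)) := by
    refine (convex_segment _ _).segment_subset hxi ?_ hy
    rcases hmi with rfl | rfl
    · exact left_mem_segment ℝ _ _
    · exact right_mem_segment ℝ _ _
  rcases hy' with hy' | hy'
  · rcases h.inter 1 i (by omega) (by omega) y hy' hye with ⟨h5, h6⟩ | ⟨h5, -⟩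
    · subst h5
      obtain rfl : m = 3 := by omega
      apply n2
      rw [h6] at hy
      exact (wbtw_swap_left_iff ℝ (f 3)).1
        ⟨(mem_segment_iff_wbtw.1 hy), (mem_segment_iff_wbtw.1 hxi)⟩
    · omega
  · rcases h.inter 0 i (by omega) (by omega) y hy' hye with ⟨h5, -⟩ | ⟨h5, h6⟩
    · omega
    · obtain rfl : m = i := by omega
      apply n0
      rw [h6] at hy
      rw [show m + 1 = n by omega, en] at hxi
      exact (wbtw_swap_left_iff ℝ (f m)).1
        ⟨(mem_segment_iff_wbtw.1 hy), (mem_segment_iff_wbtw.1 hxi).symm⟩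

theorem orient_ne_zero_of_exposed (h : SimpleCycle f n) (hx : Exposed f (f 1)) :
    orient (f 0) (f 1) (f 2) ≠ 0 := by
  obtain ⟨ν, hν⟩ := hx
  have hn := h.three_le
  have h0 := hν 0 (h.ne 0)
  have h2 := hν 2 (h.ne 1).symm
  intro hz
  have e : (lin ν (f 2) - lin ν (f 1)) • (f 0 - f 1) = (lin ν (f 0) - lin ν (f 1)) • (f 2 - f 1) := by
    simp only [orient] at hz
    ext <;> simp only [lin, Prod.smul_fst, Prod.smul_snd, Prod.fst_sub, Prod.snd_sub, smul_eq_mul]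
    · linear_combination (-ν.2) * hz
    · linear_combination ν.1 * hz
  rcases le_total (lin ν (f 0)) (lin ν (f 2)) with hle | hle
  · have : f 0 ∈ segment ℝ (f 1) (f (1 + 1)) := by
      refine mem_segment_iff_add.2
        ⟨(lin ν (f 0) - lin ν (f 1)) / (lin ν (f 2) - lin ν (f 1)), ?_, ?_, ?_⟩
      · exact div_nonneg (by linarith) (by linarith)
      · rw [div_le_one (by linarith)]; linarith
      · rw [div_eq_inv_mul, mul_smul, ← e, smul_smul, inv_mul_cancel₀ (by linarith), one_smul]
        abel
    rcases h.vertex_mem (i := 1) (by omega) (by omega) this with h1 | h1 | h1 <;> omega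
  · have : f 2 ∈ segment ℝ (f 0) (f (0 + 1)) := by
      rw [segment_symm]
      refine mem_segment_iff_add.2
        ⟨(lin ν (f 2) - lin ν (f 1)) / (lin ν (f 0) - lin ν (f 1)), ?_, ?_, ?_⟩
      · exact div_nonneg (by linarith) (by linarith)
      · rw [div_le_one (by linarith)]; linarith
      · rw [zero_add, div_eq_inv_mul, mul_smul, e, smul_smul, inv_mul_cancel₀ (by linarith),
          one_smul]
        abel
    rcases h.vertex_mem (i := 0) (by omega) (by omega) this with h1 | h1 | h1 <;> omega

/-- A vertex farthest from the origin is exposed. -/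
theorem exists_exposed (h : SimpleCycle f n) : ∃ c, Exposed f (f (c + 1)) := by
  obtain ⟨r, hr, hmax⟩ := (Finset.range n).exists_max_image (fun i => lin (f i) (f i))
    ⟨0, Finset.mem_range.2 h.cyclic.1⟩
  refine ⟨r + n - 1, -f r, fun j hj => ?_⟩
  have hn := h.cyclic.1
  rw [show r + n - 1 + 1 = r + n by omega, h.cyclic.2] at hj ⊢
  obtain ⟨q, hq, e⟩ := h.cyclic.exists_lt_eq j
  rw [e] at hj ⊢
  have h1 := hmax q (Finset.mem_range.2 hq)
  have h2 : 0 < ((f q).1 - (f r).1) ^ 2 + ((f q).2 - (f r).2) ^ 2 := by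
    by_contra! hle
    apply hj
    have a1 : ((f q).1 - (f r).1) ^ 2 = 0 := by nlinarith [sq_nonneg ((f q).2 - (f r).2)]
    have a2 : ((f q).2 - (f r).2) ^ 2 = 0 := by nlinarith [sq_nonneg ((f q).1 - (f r).1)]
    exact Prod.ext (by linarith [pow_eq_zero_iff (two_ne_zero) |>.1 a1])
      (by linarith [pow_eq_zero_iff (two_ne_zero) |>.1 a2])
  simp only [lin, Prod.fst_neg, Prod.snd_neg] at h1 ⊢
  nlinarith

/-- Cutting off an empty exposed corner does not change the orientation: otherwise the filling of
the rest would lie on the side of the corner near the chord, and would extend up to the exposed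
vertex. -/
theorem orientation_eq_of_empty {l : ℕ} (h : SimpleCycle f (l + 3)) (hl : 1 ≤ l)
    (hx : Exposed f (f 1)) (hs : s = 1 ∨ s = -1) (hD : 0 < s * orient (f 0) (f 1) (f 2))
    (hemp : ∀ m, 3 ≤ m → m < l + 3 → 0 ≤ s * orient (f 1) (f 2) (f m) →
      0 ≤ s * orient (f 0) (f 1) (f m) → s * orient (f 2) (f 0) (f m) < 0)
    {s' : ℝ} (hs' : s' = 1 ∨ s' = -1) {K : Set Plane}
    (hK : Filling (subCycle f 2 (l + 1)) (l + 2) s' K) : s' = s := by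
  by_contra hne
  obtain rfl : s' = -s := by
    rcases hs with rfl | rfl <;> rcases hs' with rfl | rfl <;> simp_all
  set g := subCycle f 2 (l + 1) with hg
  have en : f (l + 3) = f 0 := by simpa using h.cyclic.2 0
  have e : ∀ i, i ≤ l + 1 → g i = f (2 + i) := fun i hi => subCycle_of_le f 2 hi
  have e0 : g (l + 1) = f 0 := by rw [e _ le_rfl, show 2 + (l + 1) = l + 3 by ring, en]
  have e2 : g (l + 2) = f 2 := subCycle_succ f 2 (l + 1)
  set m : Plane := f 0 + (1 / 2 : ℝ) • (f 2 - f 0) with hm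
  set γ : ℝ → Plane := fun t => m + t • (f 1 - m) with hγ
  have hγc : Continuous γ := by fun_prop
  have hBm : orient (f 2) (f 0) m = 0 := by
    rw [hm, orient_add_smul, orient_self_right, orient_self_left]; ring
  have hAm : orient (f 1) (f 2) m = orient (f 0) (f 1) (f 2) / 2 := by
    rw [hm, orient_add_smul, orient_self_right, orient_rotate]; ring
  have hCm : orient (f 0) (f 1) m = orient (f 0) (f 1) (f 2) / 2 := by
    rw [hm, orient_add_smul, orient_self_left]; ring
  have hB : ∀ t, s * orient (f 2) (f 0) (γ t) = t * (s * orient (f 0) (f 1) (f 2)) := fun t => by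
    rw [hγ]; simp only; rw [orient_add_smul, hBm, orient_rotate (f 1), orient_rotate (f 0)]; ring
  have hA : ∀ t, s * orient (f 1) (f 2) (γ t) =
      (1 - t) / 2 * (s * orient (f 0) (f 1) (f 2)) := fun t => by
    rw [hγ]; simp only; rw [orient_add_smul, hAm, orient_self_left]; ring
  have hC : ∀ t, s * orient (f 0) (f 1) (γ t) =
      (1 - t) / 2 * (s * orient (f 0) (f 1) (f 2)) := fun t => by
    rw [hγ]; simp only; rw [orient_add_smul, hCm, orient_self_right]; ring
  have hside := hK.side (l + 1) m
  rw [e0, e2] at hside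
  have hside' := hside (mem_openSegment_iff_add.2 ⟨1 / 2, by norm_num, by norm_num, rfl⟩)
  have hγ0 : γ 0 = m := by simp [hγ]
  have hev : ∀ᶠ t in 𝓝 (0 : ℝ), 0 ≤ -s * orient (f 0) (f 2) (γ t) → γ t ∈ K := by
    have := hγc.continuousAt (x := (0 : ℝ))
    rw [ContinuousAt, hγ0] at this
    exact this.eventually hside'
  have hconv : ∀ t, -s * orient (f 0) (f 2) (γ t) = t * (s * orient (f 0) (f 1) (f 2)) := fun t => by
    rw [← hB t, orient_swap (f 0)]; ring
  have hsub : Icc (0 : ℝ) 1 ⊆ γ ⁻¹' K := by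
    refine IsClosed.Icc_subset_of_forall_mem_nhdsWithin
      ((hK.closed.preimage hγc).inter isClosed_Icc) ?_ ?_
    · exact hev.self_of_nhds (by rw [hconv]; simp)
    · rintro t ⟨htK, ht0, ht1⟩
      rcases ht0.eq_or_lt with rfl | ht0
      · have h1 := hev.filter_mono (nhdsWithin_le_nhds (s := Ioi (0 : ℝ)))
        filter_upwards [h1, self_mem_nhdsWithin] with r hr hr0
        refine hr ?_
        rw [hconv]
        exact mul_nonneg (le_of_lt hr0) hD.le
      · apply mem_nhdsWithin_of_mem_nhds
        apply hγc.continuousAt.preimage_mem_nhds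
        apply hK.mem_nhds _ htK
        intro i hi
        have hA' : 0 < s * orient (f 1) (f 2) (γ t) := by
          rw [hA]; exact mul_pos (by linarith) hD
        have hC' : 0 < s * orient (f 0) (f 1) (γ t) := by
          rw [hC]; exact mul_pos (by linarith) hD
        have hB' : 0 < s * orient (f 2) (f 0) (γ t) := by rw [hB]; positivity
        obtain ⟨r, hr, -, -, hrf⟩ := hK.cyclic.exists_lt i
        have er := hrf 0
        simp only [add_zero] at er
        rw [er, hrf 1] at hi
        rcases Nat.lt_or_ge r (l + 1) with hr1 | hr1
        · rw [e r (by omega), e (r + 1) (by omega)] at hi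
          have := h.edge_le (by omega) hD le_rfl (fun m h1 h2 h3 h4 => (hemp m h1 h2 h3 h4).le)
            (i := 2 + r) (by omega) (by omega) hi hA' hC'
          linarith
        · obtain rfl : r = l + 1 := by omega
          rw [e0, e2] at hi
          have := orient_eq_zero_of_mem_segment hi
          rw [orient_swap, this] at hB'
          simp at hB'
  have h1K : f 1 ∈ K := by
    have := hsub (show (1 : ℝ) ∈ Icc (0 : ℝ) 1 by simp)
    simpa [hγ] using this
  obtain ⟨ν, hν⟩ := hx
  have hcv : Convex ℝ {x : Plane | lin ν (f 1) < lin ν x} := by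
    refine convex_halfSpace_gt ⟨fun x y => ?_, fun c x => ?_⟩ _
    · simp only [lin, Prod.fst_add, Prod.snd_add]; ring
    · simp only [lin, Prod.smul_fst, Prod.smul_snd, smul_eq_mul]; ring
  have hr : range g ⊆ {x : Plane | lin ν (f 1) < lin ν x} := by
    rintro _ ⟨i, rfl⟩
    obtain ⟨r, hr, er⟩ := hK.cyclic.exists_lt_eq i
    rw [er, e r (by omega)]
    exact hν _ (h.ne_of_lt (by omega) (by omega)).symm
  have := convexHull_min hr hcv (hK.subset_hull h1K)
  simp at this

/-- Every simple polygon has a filling (it can be triangulated by diagonals into triangles of the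
same orientation). -/
theorem exists_filling (n : ℕ) : ∀ f : ℕ → Plane, SimpleCycle f n →
    ∃ (s : ℝ) (K : Set Plane), (s = 1 ∨ s = -1) ∧ Filling f n s K := by
  induction n using Nat.strong_induction_on with
  | _ n ih =>
  intro f hf
  obtain ⟨c, hc⟩ := hf.exists_exposed
  suffices H : ∀ f : ℕ → Plane, SimpleCycle f n → Exposed f (f 1) →
      ∃ (s : ℝ) (K : Set Plane), (s = 1 ∨ s = -1) ∧ Filling f n s K by
    obtain ⟨s, K, hs, hK⟩ := H (fun i => f (i + c)) (hf.shift c) (by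
      obtain ⟨ν, hν⟩ := hc
      refine ⟨ν, fun j hj => ?_⟩
      simp only [add_comm 1 c] at hj ⊢
      exact hν _ hj)
    exact ⟨s, K, hs, hK.of_shift hf.cyclic⟩
  clear hc hf f c
  intro f hf hx
  have h0 := hf.orient_ne_zero_of_exposed hx
  obtain ⟨s, hs, hD⟩ : ∃ s : ℝ, (s = 1 ∨ s = -1) ∧ 0 < s * orient (f 0) (f 1) (f 2) := by
    rcases lt_or_gt_of_ne h0 with h | h
    · exact ⟨-1, Or.inr rfl, by linarith⟩
    · exact ⟨1, Or.inl rfl, by linarith⟩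
  have h3 := hf.three_le
  rcases h3.eq_or_lt with rfl | h4
  · obtain ⟨K, hK⟩ := Filling.triangle hs hf.cyclic hD
    exact ⟨s, K, hs, hK⟩
  by_cases hex : ∃ m, 3 ≤ m ∧ m < n ∧ 0 ≤ s * orient (f 1) (f 2) (f m) ∧
      0 ≤ s * orient (f 0) (f 1) (f m) ∧ 0 ≤ s * orient (f 2) (f 0) (f m)
  · obtain ⟨m, hm3, hmn, hA, hC, hd⟩ := hf.exists_diagonal h4 hD hex
    obtain ⟨k, rfl⟩ : ∃ k, m = k + 2 := ⟨m - 2, by omega⟩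
    obtain ⟨l, rfl⟩ : ∃ l, n = k + l + 2 := ⟨n - k - 2, by omega⟩
    have hf' := hf.shift 1
    set f' : ℕ → Plane := fun i => f (i + 1) with hf'def
    have hd' : IsDiagonal f' (k + l + 2) (k + 1) := hd
    obtain ⟨s₁, K₁, hs₁, hK₁⟩ := ih (k + 2) (by omega) _
      (hf'.subCycle_left (by omega) (by omega) hd')
    obtain ⟨s₂, K₂, hs₂, hK₂⟩ := ih (l + 2) (by omega) _
      (hf'.subCycle_right (l := l + 1) (by omega) (by omega) (by omega) hd')
    have en : f' (k + l + 2) = f' 0 := by simpa using hf'.cyclic.2 0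
    obtain ⟨ν, hν⟩ := hx
    have t1 := hK₁.turn (k + 1)
    rw [subCycle_of_le f' 0 (le_refl (k + 1)), zero_add, subCycle_succ,
      subCycle_succ_succ f' 0 (by omega)] at t1
    have t1' := t1 ⟨ν, fun j hj => hν _ hj⟩
    have t2 := hK₂.turn l
    rw [subCycle_of_le f' _ (show l ≤ l + 1 by omega), subCycle_of_le f' _ (le_refl (l + 1)),
      subCycle_succ, show k + 1 + (l + 1) = k + l + 2 by ring, en] at t2
    have t2' := t2 ⟨ν, fun j hj => hν _ hj⟩
    have hu : f' (k + 1 + l) = f 0 := by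
      simp only [hf'def]
      rw [show k + 1 + l + 1 = 0 + (k + l + 2) by ring, hf.cyclic.2]
    rw [hu] at t2'
    simp only [hf'def, zero_add] at t1' t2'
    have same : ∀ a b x : ℝ, (a = 1 ∨ a = -1) → (b = 1 ∨ b = -1) → 0 < a * x → 0 < b * x →
        a = b := by
      rintro a b x (rfl | rfl) (rfl | rfl) h1 h2 <;> first | rfl | (exfalso; linarith)
    have r : orient (f (k + 1 + 1)) (f 1) (f (1 + 1)) = orient (f 1) (f 2) (f (k + 2)) :=
      (orient_rotate _ _ _).symm
    rw [r] at t1'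
    obtain rfl := same _ _ _ hs₁ hs t1' hA
    obtain rfl := same _ _ _ hs₂ hs t2' hC
    have hj := Filling.join hf'.cyclic (fun i j h1 h2 => hf'.ne_of_lt h1 (by omega)) (by omega)
      (by omega) hK₁ hK₂
    exact ⟨s₂, K₁ ∪ K₂, hs, hj.of_shift hf.cyclic⟩
  · push Not at hex
    obtain ⟨l, rfl⟩ : ∃ l, n = l + 3 := ⟨n - 3, by omega⟩
    have hd := hf.isDiagonal_of_empty h4 hD hex
    obtain ⟨s', K', hs', hK'⟩ := ih (l + 2) (by omega) _
      (hf.subCycle_right (k := 2) (l := l + 1) (by omega) (by omega) (by omega) hd)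
    obtain rfl := hf.orientation_eq_of_empty (by omega) hx hs hD hex hs' hK'
    obtain ⟨K, hK⟩ := Filling.triangle hs (cyclic_subCycle f 0 2) (by
      rw [subCycle_of_le f 0 (by omega), subCycle_of_le f 0 (by omega),
        subCycle_of_le f 0 (by omega)]
      exact hD)
    have e : l + 3 = 1 + l + 2 := by ring
    rw [e] at hf ⊢
    exact ⟨s', K ∪ K', hs, Filling.join hf.cyclic (fun i j h1 h2 => hf.ne_of_lt h1 (by omega))
      le_rfl (by omega) hK hK'⟩

end SimpleCycle

/-! ### The shape of a funnel polygon -/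

theorem orient_eq_cr_consecutive (p q r : Plane) : orient p q r = cr (q - p) (r - q) := by
  simp only [orient, cr, Prod.fst_sub, Prod.snd_sub]; ring

/-- The directions of consecutive edges of a clockwise polygon differ by the interior angle. -/
theorem dirArg_step {a v b : Plane} (hav : a ≠ v) :
    ∃ z : ℤ, dirArg (b - v) = dirArg (v - a) + (ang (-1) a v b - Real.pi) + z * (2 * Real.pi) := by
  obtain ⟨z, hz⟩ := ang_eq (-1) a v b
  obtain ⟨y, hy⟩ := dirArg_neg (sub_ne_zero.2 hav)
  rw [neg_sub] at hy
  refine ⟨-z - y, ?_⟩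
  rw [hz, hy]; push_cast; ring

/-- In a clockwise simple polygon all of whose vertices but `f 0`, `f t` and `f (n - 1)` are reflex, all
edges go upwards from `f 0` to `f t`, and downwards from `f t` to `f (n - 1)`, if the edge from
`f 0` to `f (n - 1)` is drawn horizontally: the sum of the interior angles leaves less than `π` for
the total turn of the two reflex chains. -/
theorem SimpleCycle.edges_monotone {f : ℕ → Plane} {n t : ℕ} (hf : SimpleCycle f n)
    (harea : ∑ i ∈ Finset.range n, cr (f i) (f (i + 1)) < 0) (ht : 0 < t) (htn : t + 1 < n)
    (hrefl : ∀ i < n, ¬ (i = 0 ∨ i = t ∨ i + 1 = n) →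
      0 < orient (f (i + n - 1)) (f i) (f (i + 1))) :
    (∀ i < t, 0 < cr (f (n - 1) - f 0) (f (i + 1) - f i)) ∧
      ∀ i, t ≤ i → i + 1 < n → cr (f (n - 1) - f 0) (f (i + 1) - f i) < 0 := by
  obtain ⟨s, K, hs, hK⟩ := SimpleCycle.exists_filling n f hf
  obtain rfl : s = -1 := by
    rcases hs with rfl | rfl
    · have := hK.area; linarith
    · rfl
  have hn := hf.three_le
  have hpi := Real.pi_pos
  set g : ℕ → Plane := fun i => f (i + (n - 1)) with hg
  have hg1 : ∀ i, g (i + 1) = f i := fun i => by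
    simp only [hg]; rw [show i + 1 + (n - 1) = i + n by omega, hf.cyclic.2]
  have hgper : ∀ i, g (i + n) = g i := fun i => by
    simp only [hg]; rw [add_right_comm, hf.cyclic.2]
  set B : ℕ → ℝ := fun k => ang (-1) (g k) (g (k + 1)) (g (k + 2)) - Real.pi with hB
  have hsum : ∑ k ∈ Finset.range n, B k ≤ -2 * Real.pi := by
    have h1 := hf.cyclic.sum_shift (ang (-1)) (n - 1)
    have h2 := hK.angle
    rw [← h1] at h2
    have h3 : ∑ k ∈ Finset.range n, B k = ∑ k ∈ Finset.range n,
        ang (-1) (f (k + (n - 1))) (f (k + (n - 1) + 1)) (f (k + (n - 1) + 2)) - n * Real.pi := by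
      simp only [hB, Finset.sum_sub_distrib, Finset.sum_const, Finset.card_range, nsmul_eq_mul, hg]
      congr 1
      refine Finset.sum_congr rfl fun k _ => ?_
      simp only [add_right_comm]
    rw [h3]; linarith
  set L : ℕ → ℝ := fun k => (if k = 0 then -Real.pi else 0) + (if k = t then -Real.pi else 0) +
    (if k = n - 1 then -Real.pi else 0) with hL
  have hBL : ∀ k < n, L k < B k := by
    intro k hk
    have e0 : g k = f (k + n - 1) := by simp only [hg]; congr 1; omega
    simp only [hB, hL]
    rw [e0, hg1, show k + 2 = k + 1 + 1 by ring, hg1]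
    by_cases hsp : k = 0 ∨ k = t ∨ k + 1 = n
    · have h1 := ang_pos (-1) (f (k + n - 1)) (f k) (f (k + 1))
      rcases hsp with h | h | h
      · rw [if_pos h, if_neg (by omega), if_neg (by omega)]; linarith
      · rw [if_neg (by omega), if_pos h, if_neg (by omega)]; linarith
      · rw [if_neg (by omega), if_neg (by omega), if_pos (by omega)]; linarith
    · have h1 := hrefl k hk hsp
      have h2 := pi_lt_ang (s := -1) (Or.inr rfl) (a := f (k + n - 1)) (v := f k) (b := f (k + 1))
        (by linarith)
      rw [if_neg (by omega), if_neg (by omega), if_neg (by omega)]; linarith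
  have hdir : ∀ i m : ℕ, i ≤ m → ∃ z : ℤ, dirArg (g (m + 1) - g m) =
      dirArg (g (i + 1) - g i) + ∑ k ∈ Finset.Ico i m, B k + z * (2 * Real.pi) := by
    intro i m him
    induction m, him using Nat.le_induction with
    | base => exact ⟨0, by simp⟩
    | succ m him ih =>
      obtain ⟨z, hz⟩ := ih
      obtain ⟨y, hy⟩ := dirArg_step (a := g m) (v := g (m + 1)) (b := g (m + 2)) (by
        have := hf.ne (m + (n - 1))
        simp only [hg]; rwa [add_right_comm])
      refine ⟨z + y, ?_⟩
      rw [show m + 1 + 1 = m + 2 by ring, hy, hz, Finset.sum_Ico_succ_top him]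
      push_cast
      simp only [hB]
      ring
  have hlow : ∀ i m : ℕ, i < m → m ≤ n → ∑ k ∈ Finset.Ico i m, L k < ∑ k ∈ Finset.Ico i m, B k := by
    intro i m him hmn
    refine Finset.sum_lt_sum_of_nonempty (by simpa using him) fun k hk => hBL k ?_
    have := Finset.mem_Ico.1 hk
    omega
  have hLsum : ∀ i m : ℕ, ∑ k ∈ Finset.Ico i m, L k = (if i ≤ 0 ∧ 0 < m then -Real.pi else 0) +
      (if i ≤ t ∧ t < m then -Real.pi else 0) + (if i ≤ n - 1 ∧ n - 1 < m then -Real.pi else 0) := by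
    intro i m
    simp only [hL, Finset.sum_add_distrib, Finset.sum_ite_eq', Finset.mem_Ico]
  have hsplit : ∀ i, i ≤ n → ∑ k ∈ Finset.Ico 0 i, B k + ∑ k ∈ Finset.Ico i n, B k ≤
      -2 * Real.pi := by
    intro i hi
    rw [Finset.sum_Ico_consecutive _ (Nat.zero_le _) hi, ← Finset.range_eq_Ico]
    exact hsum
  have hgne : ∀ i, g (i + 1) - g i ≠ 0 := fun i => by
    have := (hf.ne (i + (n - 1))).symm
    simp only [hg]; rw [add_right_comm]; exact sub_ne_zero.2 this
  have hg0 : g (0 + 1) - g 0 = f 0 - f (n - 1) := by rw [hg1]; simp [hg]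
  have hcr : ∀ y : Plane, cr (f (n - 1) - f 0) y = -cr (f 0 - f (n - 1)) y := fun y => by
    simp only [cr, Prod.fst_sub, Prod.snd_sub]; ring
  refine ⟨fun i hi => ?_, fun i hi hin => ?_⟩
  · obtain ⟨z, hz⟩ := hdir 0 (i + 1) (Nat.zero_le _)
    have l1 := hlow 0 (i + 1) (by omega) (by omega)
    have l2 := hlow (i + 1) n (by omega) le_rfl
    have l3 := hsplit (i + 1) (by omega)
    rw [hLsum, if_pos (by omega), if_neg (by omega), if_neg (by omega)] at l1
    rw [hLsum, if_neg (by omega), if_pos (by omega), if_pos (by omega)] at l2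
    obtain ⟨r, hr, hsin⟩ := sin_dirArg_sub (hgne (i + 1)) (hgne 0)
    have e : dirArg (g (i + 1 + 1) - g (i + 1)) - dirArg (g (0 + 1) - g 0) =
        ∑ k ∈ Finset.Ico 0 (i + 1), B k + z * (2 * Real.pi) := by rw [hz]; ring
    rw [e, Real.sin_add_int_mul_two_pi, hg0, hg1, hg1] at hsin
    have hneg : Real.sin (∑ k ∈ Finset.Ico 0 (i + 1), B k) < 0 :=
      Real.sin_neg_of_neg_of_neg_pi_lt (by linarith) (by linarith)
    rw [hcr]
    by_contra! hle
    nlinarith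
  · obtain ⟨z, hz⟩ := hdir (i + 1) n (by omega)
    have l1 := hlow 0 (i + 1) (by omega) (by omega)
    have l2 := hlow (i + 1) n (by omega) le_rfl
    have l3 := hsplit (i + 1) (by omega)
    rw [hLsum, if_pos (by omega), if_pos (by omega), if_neg (by omega)] at l1
    rw [hLsum, if_neg (by omega), if_neg (by omega), if_pos (by omega)] at l2
    obtain ⟨r, hr, hsin⟩ := sin_dirArg_sub (hgne 0) (hgne (i + 1))
    have en : g (n + 1) - g n = g (0 + 1) - g 0 := by
      rw [show n + 1 = 0 + 1 + n by ring, hgper, show g n = g (0 + n) by rw [zero_add], hgper]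
    have e : dirArg (g (0 + 1) - g 0) - dirArg (g (i + 1 + 1) - g (i + 1)) =
        ∑ k ∈ Finset.Ico (i + 1) n, B k + z * (2 * Real.pi) := by rw [← en, hz]; ring
    rw [e, Real.sin_add_int_mul_two_pi, hg0, hg1, hg1] at hsin
    have hneg : Real.sin (∑ k ∈ Finset.Ico (i + 1) n, B k) < 0 :=
      Real.sin_neg_of_neg_of_neg_pi_lt (by linarith) (by linarith)
    have hanti : cr (f (i + 1) - f i) (f 0 - f (n - 1)) =
        -cr (f 0 - f (n - 1)) (f (i + 1) - f i) := by
      simp only [cr, Prod.fst_sub, Prod.snd_sub]; ring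
    rw [hcr]
    rw [hanti] at hsin
    by_contra! hle
    nlinarith

/-- A funnel with chains `u 0, …, u a` and `w 0, …, w b` going upwards from the base `u 0, w 0` to
the apex `u a = w b`. If `σ = 1`, then `u` is the left chain and `w` the right chain, and both bend
towards the inside; `σ = -1` is the mirror image, so that exchanging the two chains and the sign
`σ` gives a funnel again. -/
structure Funnel (σ : ℝ) (u w : ℕ → Plane) (a b : ℕ) : Prop where
  left_pos : 0 < a
  right_pos : 0 < b
  apex_eq : u a = w b
  left_up : ∀ i < a, 0 < σ * cr (w 0 - u 0) (u (i + 1) - u i)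
  right_up : ∀ j < b, 0 < σ * cr (w 0 - u 0) (w (j + 1) - w j)
  left_turn : ∀ i, i + 1 < a → 0 < σ * cr (u (i + 1) - u i) (u (i + 2) - u (i + 1))
  right_turn : ∀ j, j + 1 < b → 0 < σ * cr (w (j + 2) - w (j + 1)) (w (j + 1) - w j)
  apex_turn : ∀ i j, i + 1 = a → j + 1 = b → 0 < σ * cr (u (i + 1) - u i) (w (j + 1) - w j)

/-- The vertices of a polygon as a periodic sequence. -/
def cyc {n : ℕ} (hn : 0 < n) (P : Polygon Plane n) : ℕ → Plane :=
  fun i => P ⟨i % n, Nat.mod_lt _ hn⟩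

theorem finRotate_val {n : ℕ} (i : Fin n) : (finRotate n i).val = (i.val + 1) % n := by
  cases n with
  | zero => exact i.elim0
  | succ m => rw [finRotate_apply, Fin.val_add, Fin.val_one', Nat.add_mod_mod]

theorem finRotate_symm_val {n : ℕ} (i : Fin n) :
    ((finRotate n).symm i).val = (i.val + n - 1) % n := by
  obtain ⟨j, rfl⟩ := (finRotate n).surjective i
  rw [Equiv.symm_apply_apply, finRotate_val]
  have hj := j.2
  rcases Nat.lt_or_ge (j.val + 1) n with h | h
  · rw [Nat.mod_eq_of_lt h, show j.val + 1 + n - 1 = j.val + n by omega, Nat.add_mod_right,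
      Nat.mod_eq_of_lt hj]
  · have e : j.val + 1 = n := by omega
    rw [e, Nat.mod_self, zero_add, Nat.mod_eq_of_lt (by omega)]; omega

section
variable {n : ℕ} (hn : 0 < n) (P : Polygon Plane n)

theorem cyclic_cyc : Cyclic (cyc hn P) n := ⟨hn, fun i => by simp [cyc]⟩

theorem cyc_val (i : Fin n) : cyc hn P i.val = P i := by
  unfold cyc; congr 1; exact Fin.ext (Nat.mod_eq_of_lt i.2)

theorem cyc_val_succ (i : Fin n) : cyc hn P (i.val + 1) = P (finRotate n i) := by
  unfold cyc; congr 1; exact Fin.ext (finRotate_val i).symm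

theorem cyc_val_pred (i : Fin n) : cyc hn P (i.val + n - 1) = P ((finRotate n).symm i) := by
  unfold cyc; congr 1; exact Fin.ext (finRotate_symm_val i).symm

theorem edgeSet_eq (i : Fin n) :
    P.edgeSet ℝ i = segment ℝ (cyc hn P i.val) (cyc hn P (i.val + 1)) := by
  rw [cyc_val, cyc_val_succ, Polygon.edgeSet, affineSegment_eq_segment]

theorem boundary_eq :
    P.boundary ℝ = ⋃ i < n, segment ℝ (cyc hn P i) (cyc hn P (i + 1)) := by
  ext x
  simp only [Polygon.boundary, mem_iUnion, edgeSet_eq hn]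
  constructor
  · rintro ⟨i, hi⟩; exact ⟨i.val, i.2, hi⟩
  · rintro ⟨i, h, hi⟩; exact ⟨⟨i, h⟩, hi⟩

theorem Polygon.IsSimple.simpleCycle (h : P.IsSimple) : SimpleCycle (cyc hn P) n := by
  refine SimpleCycle.of_lt (cyclic_cyc hn P) h.three_le (fun i hi => ?_)
    fun i j hij hj x hxi hxj => ?_
  · have := h.nondegenerate ⟨i, hi⟩
    rwa [← cyc_val hn P, ← cyc_val_succ hn P] at this
  · have := h.inter ⟨i, hij.trans hj⟩ ⟨j, hj⟩ (by simp [Fin.ext_iff]; omega) x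
      ⟨by rw [edgeSet_eq hn]; exact hxi, by rw [edgeSet_eq hn]; exact hxj⟩
    rw [Fin.ext_iff, Fin.ext_iff, finRotate_val, finRotate_val, ← cyc_val hn P,
      ← cyc_val hn P] at this
    simp only at this
    rw [Nat.mod_eq_of_lt (show i + 1 < n by omega)] at this
    rcases this with h1 | ⟨h1, h2⟩
    · exact Or.inl h1
    · rcases Nat.lt_or_ge (j + 1) n with h3 | h3
      · rw [Nat.mod_eq_of_lt h3] at h1; omega
      · have e : j + 1 = n := by omega
        rw [e, Nat.mod_self] at h1
        right; exact ⟨h1, e, by rw [h2, h1]⟩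

theorem doubleSignedArea_eq :
    P.doubleSignedArea = ∑ i ∈ Finset.range n, cr (cyc hn P i) (cyc hn P (i + 1)) := by
  rw [Finset.sum_range]
  unfold Polygon.doubleSignedArea
  refine Finset.sum_congr rfl fun i _ => ?_
  rw [cyc_val, cyc_val_succ]
  simp only [cr]; ring

/-- A funnel polygon is a funnel in the sense of `Funnel`. The apex is the first convex vertex after
the vertex `0`. -/
theorem Polygon.IsFunnel.exists_funnel (h : P.IsFunnel) :
    ∃ t, 0 < t ∧ t + 1 < n ∧
      (∀ i, 0 < i → i < t → 0 < orient (cyc hn P (i - 1)) (cyc hn P i) (cyc hn P (i + 1))) ∧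
      orient (cyc hn P (t - 1)) (cyc hn P t) (cyc hn P (t + 1)) < 0 ∧
      Funnel 1 (cyc hn P) (fun j => cyc hn P (n - 1 - j)) t (n - 1 - t) := by
  obtain ⟨t, ht, htn, hch⟩ := h.chains
  have hs := h.simple.simpleCycle hn P
  set f := cyc hn P with hf
  have hconv : ∀ i < n, (i = 0 ∨ i = t ∨ i + 1 = n) → orient (f (i + n - 1)) (f i) (f (i + 1)) < 0 := by
    intro i hi hc
    have := (hch ⟨i, hi⟩).1 hc
    rwa [Polygon.IsConvexVertex, ← cyc_val_pred hn, ← cyc_val_succ hn, ← cyc_val hn] at this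
  have hrefl : ∀ i < n, ¬ (i = 0 ∨ i = t ∨ i + 1 = n) →
      0 < orient (f (i + n - 1)) (f i) (f (i + 1)) := by
    intro i hi hc
    have := (hch ⟨i, hi⟩).2 hc
    rwa [Polygon.IsReflexVertex, ← cyc_val_pred hn, ← cyc_val_succ hn, ← cyc_val hn] at this
  have hpred : ∀ i, 0 < i → f (i + n - 1) = f (i - 1) := by
    intro i hi
    rw [show i + n - 1 = i - 1 + n by omega, hs.cyclic.2]
  have harea : ∑ i ∈ Finset.range n, cr (f i) (f (i + 1)) < 0 := by
    rw [hf, ← doubleSignedArea_eq]; exact h.clockwise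
  obtain ⟨hl, hr⟩ := hs.edges_monotone harea ht htn hrefl
  refine ⟨t, ht, htn, ?_, ?_, ?_⟩
  · intro i h0 hi
    rw [← hpred i h0]
    exact hrefl i (by omega) (by omega)
  · rw [← hpred t ht]
    exact hconv t (by omega) (by simp)
  have hw : ∀ j, j < n - 1 - t → ∃ k, t ≤ k ∧ k + 1 < n ∧ n - 1 - j = k + 1 ∧
      n - 1 - (j + 1) = k := fun j hj => ⟨n - 2 - j, by omega, by omega, by omega, by omega⟩
  refine ⟨ht, by omega, by congr 1; omega, fun i hi => ?_, fun j hj => ?_, fun i hi => ?_,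
    fun j hj => ?_, fun i j hi hj => ?_⟩
  · rw [one_mul]; exact hl i hi
  · obtain ⟨k, hk, hkn, e1, e2⟩ := hw j hj
    have := hr k hk hkn
    simp only [Nat.sub_zero] at *
    rw [e1, e2, one_mul]
    simp only [cr, Prod.fst_sub, Prod.snd_sub] at this ⊢
    linarith
  · have := hrefl (i + 1) (by omega) (by omega)
    rw [hpred _ (by omega), Nat.add_sub_cancel, orient_eq_cr_consecutive] at this
    rw [one_mul]; exact this
  · have e1 : n - 1 - j = n - 3 - j + 2 := by omega
    have e2 : n - 1 - (j + 1) = n - 3 - j + 1 := by omega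
    have e3 : n - 1 - (j + 2) = n - 3 - j := by omega
    simp only [e1, e2, e3]
    have := hrefl (n - 3 - j + 1) (by omega) (by omega)
    rw [hpred _ (by omega), Nat.add_sub_cancel, orient_eq_cr_consecutive] at this
    simp only [cr, Prod.fst_sub, Prod.snd_sub] at this ⊢
    linarith
  · have := hconv t (by omega) (by simp)
    rw [hpred _ ht, orient_eq_cr_consecutive] at this
    have e1 : n - 1 - j = t + 1 := by omega
    have e2 : n - 1 - (j + 1) = t := by omega
    simp only [e1, e2, hi]
    rw [show t - 1 = i by omega] at this
    simp only [cr, Prod.fst_sub, Prod.snd_sub] at this ⊢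
    linarith

end

/-! ### Visibility between the chains of a funnel -/

/-- The position of `x` with respect to the `i`-th edge of the chain `u` of a funnel: positive on
the outer side, negative on the inner side. For the other chain `w` this is `lam (-σ) w`. -/
def lam (σ : ℝ) (u : ℕ → Plane) (i : ℕ) (x : Plane) : ℝ := σ * orient (u i) (u (i + 1)) x

/-- The position of `x` with respect to the chord from `p` to `q` across a funnel: positive
above. -/
def lid (σ : ℝ) (p q x : Plane) : ℝ := σ * orient p q x

theorem lid_symm (σ : ℝ) (p q x : Plane) : lid (-σ) q p x = lid σ p q x := by
  simp only [lid, orient]; ring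

theorem lam_eq (σ : ℝ) (u : ℕ → Plane) (i : ℕ) (x : Plane) :
    lam σ u i x = σ * cr (u (i + 1) - u i) (x - u (i + 1)) := by
  simp only [lam, orient, cr, Prod.fst_sub, Prod.snd_sub]; ring

theorem lam_sub (σ : ℝ) (u : ℕ → Plane) (i : ℕ) (x y : Plane) :
    lam σ u i x - lam σ u i y = σ * cr (u (i + 1) - u i) (x - y) := by
  simp only [lam, orient, cr, Prod.fst_sub, Prod.snd_sub]; ring

theorem lam_left (σ : ℝ) (u : ℕ → Plane) (i : ℕ) : lam σ u i (u i) = 0 := by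
  simp only [lam, orient]; ring

theorem lam_right (σ : ℝ) (u : ℕ → Plane) (i : ℕ) : lam σ u i (u (i + 1)) = 0 := by
  simp only [lam, orient]; ring

theorem lid_sub (σ : ℝ) (p q x y : Plane) : lid σ p q x - lid σ p q y = σ * cr (q - p) (x - y) := by
  simp only [lid, orient, cr, Prod.fst_sub, Prod.snd_sub]; ring

theorem lid_left (σ : ℝ) (p q : Plane) : lid σ p q p = 0 := by
  simp only [lid, orient]; ring

theorem lid_right (σ : ℝ) (p q : Plane) : lid σ p q q = 0 := by
  simp only [lid, orient]; ring

theorem lid_add_smul (σ : ℝ) (p q x y : Plane) (t : ℝ) :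
    lid σ p q (x + t • (y - x)) = lid σ p q x + t * (lid σ p q y - lid σ p q x) := by
  simp only [lid]; rw [orient_add_smul]; ring

theorem lam_add_smul (σ : ℝ) (u : ℕ → Plane) (i : ℕ) (x y : Plane) (t : ℝ) :
    lam σ u i (x + t • (y - x)) = lam σ u i x + t * (lam σ u i y - lam σ u i x) :=
  lid_add_smul σ _ _ x y t

theorem cr_swap (x y : Plane) : cr x y = -cr y x := by simp only [cr]; ring

theorem cr_sum_nonneg {σ : ℝ} {u : ℕ → Plane} {x : Plane} {i k : ℕ} (hik : i ≤ k)
    (h : ∀ m, i ≤ m → m < k → 0 ≤ σ * cr x (u (m + 1) - u m)) : 0 ≤ σ * cr x (u k - u i) := by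
  induction k, hik using Nat.le_induction with
  | base => simp [cr]
  | succ k hik ih =>
    have h1 := ih fun m h1 h2 => h m h1 (by omega)
    have h2 := h k hik (by omega)
    have e : σ * cr x (u (k + 1) - u i) = σ * cr x (u (k + 1) - u k) + σ * cr x (u k - u i) := by
      simp only [cr, Prod.fst_sub, Prod.snd_sub]; ring
    rw [e]; exact add_nonneg h2 h1

theorem cr_sum_pos {σ : ℝ} {u : ℕ → Plane} {x : Plane} {i k : ℕ} (hik : i < k)
    (h : ∀ m, i ≤ m → m < k → 0 < σ * cr x (u (m + 1) - u m)) : 0 < σ * cr x (u k - u i) := by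
  have h1 : 0 ≤ σ * cr x (u k - u (i + 1)) := cr_sum_nonneg hik fun m h1 h2 =>
    (h m (by omega) h2).le
  have h2 := h i le_rfl hik
  have e : σ * cr x (u k - u i) = σ * cr x (u k - u (i + 1)) + σ * cr x (u (i + 1) - u i) := by
    simp only [cr, Prod.fst_sub, Prod.snd_sub]; ring
  rw [e]; exact add_pos_of_nonneg_of_pos h1 h2

/-- Transitivity of the order by direction, for vectors that point to the same side of a line. -/
theorem cr_trans {σ : ℝ} {b x y z : Plane} (hx : 0 < σ * cr b x) (hy : 0 < σ * cr b y)
    (hz : 0 < σ * cr b z) (hxy : 0 < σ * cr x y) (hyz : 0 < σ * cr y z) : 0 < σ * cr x z := by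
  have key : (σ * cr x z) * (σ * cr b y) =
      (σ * cr x y) * (σ * cr b z) + (σ * cr y z) * (σ * cr b x) := by
    simp only [cr]; ring
  have h2 : 0 < (σ * cr x z) * (σ * cr b y) := by
    rw [key]; exact add_pos (mul_pos hxy hz) (mul_pos hyz hx)
  exact pos_of_mul_pos_left h2 hy.le

namespace Funnel

variable {σ : ℝ} {u w : ℕ → Plane} {a b : ℕ}

theorem symm (h : Funnel σ u w a b) : Funnel (-σ) w u b a := by
  refine ⟨h.right_pos, h.left_pos, h.apex_eq.symm, fun i hi => ?_, fun j hj => ?_, fun i hi => ?_,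
    fun j hj => ?_, fun i j hi hj => ?_⟩
  · have := h.right_up i hi
    simp only [cr, Prod.fst_sub, Prod.snd_sub] at this ⊢; linarith
  · have := h.left_up j hj
    simp only [cr, Prod.fst_sub, Prod.snd_sub] at this ⊢; linarith
  · have := h.right_turn i hi
    rw [cr_swap] at this; linarith
  · have := h.left_turn j hj
    rw [cr_swap] at this; linarith
  · have := h.apex_turn j i hj hi
    rw [cr_swap] at this; linarith

theorem cross_left (h : Funnel σ u w a b) {i m : ℕ} (him : i < m) (hm : m < a) :
    0 < σ * cr (u (i + 1) - u i) (u (m + 1) - u m) := by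
  induction m, him using Nat.le_induction with
  | base => exact h.left_turn i hm
  | succ m him ih =>
    exact cr_trans (h.left_up i (by omega)) (h.left_up m (by omega)) (h.left_up _ hm)
      (ih (by omega)) (h.left_turn m hm)

theorem cross (h : Funnel σ u w a b) {i j : ℕ} (hi : i < a) (hj : j < b) :
    0 < σ * cr (u (i + 1) - u i) (w (j + 1) - w j) := by
  obtain ⟨p, rfl⟩ : ∃ p, a = p + 1 := ⟨a - 1, by omega⟩
  obtain ⟨q, rfl⟩ : ∃ q, b = q + 1 := ⟨b - 1, by omega⟩
  have h0 : 0 < σ * cr (u (i + 1) - u i) (w (q + 1) - w q) := by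
    rcases Nat.lt_or_ge i p with hip | hip
    · exact cr_trans (h.left_up i hi) (h.left_up p (by omega)) (h.right_up q (by omega))
        (h.cross_left hip (by omega)) (h.apex_turn p q rfl rfl)
    · obtain rfl : i = p := by omega
      exact h.apex_turn i q rfl rfl
  rcases Nat.lt_or_ge j q with hjq | hjq
  · refine cr_trans (h.left_up i hi) (h.right_up q (by omega)) (h.right_up j hj) h0 ?_
    have := h.symm.cross_left hjq (by omega)
    rw [cr_swap] at this; linarith
  · obtain rfl : j = q := by omega
    exact h0

theorem lam_vertex_pos (h : Funnel σ u w a b) {i k : ℕ} (hi : i < a) (hk : k ≤ a) (hne : k ≠ i)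
    (hne' : k ≠ i + 1) : 0 < lam σ u i (u k) := by
  rcases Nat.lt_or_ge k i with hki | hki
  · have h1 : 0 < σ * cr (-(u (i + 1) - u i)) (u i - u k) := by
      refine cr_sum_pos hki fun m h1 h2 => ?_
      have := h.cross_left h2 hi
      simp only [cr, Prod.fst_sub, Prod.snd_sub, Prod.fst_neg, Prod.snd_neg] at this ⊢
      linarith
    simp only [lam, orient, cr, Prod.fst_sub, Prod.snd_sub, Prod.fst_neg, Prod.snd_neg] at h1 ⊢
    linarith
  · rw [lam_eq]
    exact cr_sum_pos (by omega) fun m h1 h2 => h.cross_left (by omega) (by omega)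

theorem lam_vertex_nonneg (h : Funnel σ u w a b) {i k : ℕ} (hi : i < a) (hk : k ≤ a) :
    0 ≤ lam σ u i (u k) := by
  by_cases h1 : k = i
  · rw [h1, lam_left]
  by_cases h2 : k = i + 1
  · rw [h2, lam_right]
  exact (h.lam_vertex_pos hi hk h1 h2).le

/-- Farther up on the opposite chain, the vertices move to the outer side of an edge. -/
theorem lam_lt_lam (h : Funnel σ u w a b) {i j j' : ℕ} (hi : i < a) (hj : j < j') (hj' : j' ≤ b) :
    lam σ u i (w j) < lam σ u i (w j') := by
  have h1 : 0 < lam σ u i (w j') - lam σ u i (w j) := by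
    rw [lam_sub]
    exact cr_sum_pos hj fun m h1 h2 => h.cross hi (by omega)
  linarith

theorem lam_le_lam (h : Funnel σ u w a b) {i j j' : ℕ} (hi : i < a) (hj : j ≤ j') (hj' : j' ≤ b) :
    lam σ u i (w j) ≤ lam σ u i (w j') := by
  rcases hj.eq_or_lt with rfl | hlt
  · exact le_rfl
  · exact (h.lam_lt_lam hi hlt hj').le

theorem lam_top_nonpos (h : Funnel σ u w a b) {i j : ℕ} (hi : i + 1 = a) (hj : j ≤ b) :
    lam σ u i (w j) ≤ 0 := by
  have h1 := h.lam_le_lam (i := i) (by omega) hj le_rfl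
  rwa [← h.apex_eq, ← hi, lam_right] at h1

theorem lid_vertex_lt (h : Funnel σ u w a b) {i k : ℕ} (hik : i < k) (hk : k ≤ a) :
    lid σ (u 0) (w 0) (u i) < lid σ (u 0) (w 0) (u k) := by
  have h1 : 0 < lid σ (u 0) (w 0) (u k) - lid σ (u 0) (w 0) (u i) := by
    rw [lid_sub]
    exact cr_sum_pos hik fun m h1 h2 => h.left_up m (by omega)
  linarith

theorem lid_vertex_nonneg (h : Funnel σ u w a b) {k : ℕ} (hk : k ≤ a) :
    0 ≤ lid σ (u 0) (w 0) (u k) := by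
  rcases Nat.eq_zero_or_pos k with rfl | h0
  · rw [lid_left]
  · have := h.lid_vertex_lt h0 hk
    rw [lid_left] at this
    exact this.le

/-- The relation between the positions of a point with respect to two consecutive edges. -/
theorem lam_step (σ : ℝ) (u w : ℕ → Plane) (i : ℕ) (x : Plane) :
    lam σ u i x * (σ * cr (w 0 - u 0) (u (i + 2) - u (i + 1))) =
      lam σ u (i + 1) x * (σ * cr (w 0 - u 0) (u (i + 1) - u i)) +
      (lid σ (u 0) (w 0) x - lid σ (u 0) (w 0) (u (i + 1))) *
        (σ * cr (u (i + 1) - u i) (u (i + 2) - u (i + 1))) := by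
  simp only [lam, lid, orient, cr, Prod.fst_sub, Prod.snd_sub]; ring

theorem lam_nonpos_of_low (h : Funnel σ u w a b) {x : Plane} {p : ℕ} (hp : p + 1 = a)
    (htop : lam σ u p x ≤ 0) {i : ℕ} (hi : i < a)
    (hlow : lid σ (u 0) (w 0) x ≤ lid σ (u 0) (w 0) (u (i + 1))) : lam σ u i x ≤ 0 := by
  obtain ⟨d, hd⟩ : ∃ d, i + d + 1 = a := ⟨a - 1 - i, by omega⟩
  induction d generalizing i with
  | zero => obtain rfl : i = p := by omega
            exact htop
  | succ d ih =>
    have h1 := ih (i := i + 1) (by omega)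
      (hlow.trans (h.lid_vertex_lt (by omega) (by omega)).le) (by omega)
    have h2 := lam_step σ u w i x
    have h3 := h.left_up (i + 1) (by omega)
    have h4 := h.left_up i (by omega)
    have h5 := h.left_turn i (by omega)
    by_contra! hc
    have : 0 < lam σ u i x * (σ * cr (w 0 - u 0) (u (i + 2) - u (i + 1))) := mul_pos hc h3
    nlinarith

/-- The base vertex of the opposite chain is on the inner side of every edge. -/
theorem lam_base_neg (h : Funnel σ u w a b) {i : ℕ} (hi : i < a) : lam σ u i (w 0) < 0 := by
  obtain ⟨p, hp⟩ : ∃ p, p + 1 = a := ⟨a - 1, by omega⟩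
  obtain ⟨d, hd⟩ : ∃ d, i + d + 1 = a := ⟨a - 1 - i, by omega⟩
  induction d generalizing i with
  | zero =>
    have h1 := h.lam_lt_lam hi h.right_pos le_rfl
    rwa [← h.apex_eq, show a = i + 1 by omega, lam_right] at h1
  | succ d ih =>
    have h1 := ih (i := i + 1) (by omega) (by omega)
    have h2 := lam_step σ u w i (w 0)
    have h3 := h.left_up (i + 1) (by omega)
    have h4 := h.left_up i (by omega)
    have h5 := h.left_turn i (by omega)
    have h6 := h.lid_vertex_nonneg (k := i + 1) (by omega)
    rw [lid_right] at h2
    by_contra! hc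
    have : 0 ≤ lam σ u i (w 0) * (σ * cr (w 0 - u 0) (u (i + 2) - u (i + 1))) :=
      mul_nonneg hc h3.le
    nlinarith

/-- A point on the inner side of an edge and of the top edge of the same chain is on the inner side
of all edges in between. -/
theorem lam_nonpos_of_le (h : Funnel σ u w a b) {x : Plane} {p : ℕ} (hp : p + 1 = a)
    (htop : lam σ u p x ≤ 0) {i k : ℕ} (hik : i ≤ k) (hk : k < a) (hi : lam σ u i x ≤ 0) :
    lam σ u k x ≤ 0 := by
  induction k, hik using Nat.le_induction with
  | base => exact hi
  | succ k hik ih =>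
    have h1 := ih (by omega)
    rcases le_total (lid σ (u 0) (w 0) (u (k + 1))) (lid σ (u 0) (w 0) x) with hle | hle
    · have h2 := lam_step σ u w k x
      have h3 := h.left_up (k + 1) (by omega)
      have h4 := h.left_up k (by omega)
      have h5 := h.left_turn k (by omega)
      by_contra! hc
      have : 0 < lam σ u (k + 1) x * (σ * cr (w 0 - u 0) (u (k + 1) - u k)) := mul_pos hc h4
      nlinarith
    · exact h.lam_nonpos_of_low hp htop hk
        (hle.trans (h.lid_vertex_lt (by omega) (by omega)).le)

theorem cross_apex_nonneg (h : Funnel σ u w a b) {i j : ℕ} (hi : i ≤ a) (hj : j ≤ b) :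
    0 ≤ σ * cr (u a - u i) (w b - w j) := by
  refine cr_sum_nonneg hj fun m h1 h2 => ?_
  have h3 : 0 ≤ σ * cr (-(w (m + 1) - w m)) (u a - u i) := by
    refine cr_sum_nonneg hi fun l h3 h4 => ?_
    have := h.cross h4 h2
    simp only [cr, Prod.fst_sub, Prod.snd_sub, Prod.fst_neg, Prod.snd_neg] at this ⊢
    linarith
  simp only [cr, Prod.fst_sub, Prod.snd_sub, Prod.fst_neg, Prod.snd_neg] at h3 ⊢
  linarith

theorem cross_apex_pos (h : Funnel σ u w a b) {i j : ℕ} (hi : i < a) (hj : j < b) :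
    0 < σ * cr (u a - u i) (w b - w j) := by
  refine cr_sum_pos hj fun m h1 h2 => ?_
  have h3 : 0 < σ * cr (-(w (m + 1) - w m)) (u a - u i) := by
    refine cr_sum_pos hi fun l h3 h4 => ?_
    have := h.cross h4 h2
    simp only [cr, Prod.fst_sub, Prod.snd_sub, Prod.fst_neg, Prod.snd_neg] at this ⊢
    linarith
  simp only [cr, Prod.fst_sub, Prod.snd_sub, Prod.fst_neg, Prod.snd_neg] at h3 ⊢
  linarith

theorem left_ne_right (h : Funnel σ u w a b) {i j : ℕ} (hi : i < a) (hj : j < b) : u i ≠ w j := by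
  intro e
  have := h.cross_apex_pos hi hj
  rw [h.apex_eq, e] at this
  simp only [cr] at this
  linarith

/-- Of two edges on opposite chains at most one can hide above the other: if the top of the right
edge is on the outer side of the left edge, then the top of the left edge is on the inner side of
the right edge. The two parts of the chains above them meet in the apex and cannot cross before. -/
theorem exclusive (h : Funnel σ u w a b) {i j : ℕ} (hi : i < a) (hj : j < b)
    (hpos : 0 < lam σ u i (w (j + 1))) : lam (-σ) w j (u (i + 1)) < 0 := by
  by_contra! hc
  set D := u a - u (i + 1) with hD
  set R := w b - w (j + 1) with hR
  have eDR : w (j + 1) - u (i + 1) = D - R := by rw [hD, hR, h.apex_eq]; abel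
  have eRD : u (i + 1) - w (j + 1) = R - D := by rw [hD, hR, h.apex_eq]; abel
  rw [lam_eq, eDR] at hpos
  rw [lam_eq, eRD] at hc
  set x := u (i + 1) - u i with hx
  set z := w (j + 1) - w j with hz
  have xz : 0 < σ * cr x z := h.cross hi hj
  have xR : 0 ≤ σ * cr x R := cr_sum_nonneg hj fun m h1 h2 => (h.cross hi h2).le
  have DR : 0 ≤ σ * cr D R := h.cross_apex_nonneg hi hj
  have Rz : 0 ≤ -σ * cr z R := by
    refine cr_sum_nonneg hj fun m h1 h2 => ?_
    exact (h.symm.cross_left h1 h2).le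
  have hp : (σ * cr x z) * (σ * cr D R) =
      (-σ * cr z D) * (σ * cr x R) - (σ * cr x D) * (-σ * cr z R) := by
    simp only [cr]; ring
  have e1 : σ * cr x (D - R) = σ * cr x D - σ * cr x R := by
    simp only [cr, Prod.fst_sub, Prod.snd_sub]; ring
  have e2 : -σ * cr z (R - D) = -σ * cr z R - -σ * cr z D := by
    simp only [cr, Prod.fst_sub, Prod.snd_sub]; ring
  rw [e1] at hpos
  rw [e2] at hc
  rcases Nat.lt_or_ge (i + 1) a with h1 | h1
  · have Dz : 0 < -σ * cr z D := by
      refine cr_sum_pos h1 fun m h2 h3 => ?_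
      have := h.cross h3 hj
      rw [cr_swap] at this; linarith
    have h2 : 0 ≤ (σ * cr x z) * (σ * cr D R) := mul_nonneg xz.le DR
    have h3 : (-σ * cr z D) * (σ * cr x R) ≤ (-σ * cr z R) * (σ * cr x R) := by
      apply mul_le_mul_of_nonneg_right _ xR; linarith
    have h4 : (-σ * cr z R) * (σ * cr x R) < (-σ * cr z R) * (σ * cr x D) := by
      apply mul_lt_mul_of_pos_left <;> linarith
    linarith
  · have : D = 0 := by rw [hD, show i + 1 = a by omega]; simp
    have e0 : σ * cr x D = 0 := by rw [this]; simp [cr]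
    linarith

/-! ### Peeling a funnel from the apex -/

/-- The chord from `u i` to `w j` is seen from the edges just above it (or it is the apex). -/
def Valid (σ : ℝ) (u w : ℕ → Plane) (a b i j : ℕ) : Prop :=
  (i = a ∧ j = b) ∨ (i < a ∧ j < b ∧ lam σ u i (w j) ≤ 0 ∧ lam (-σ) w j (u i) ≤ 0)

/-- Peeling off the left edge below `u i` only: it hides above the right edge below `w j`. -/
def PeelLeft (σ : ℝ) (u w : ℕ → Plane) (i j i' j' : ℕ) : Prop :=
  i = i' + 1 ∧ j = j' ∧ lam σ u i' (w j) < 0 ∧ (j = 0 ∨ ∃ k, j = k + 1 ∧ 0 < lam (-σ) w k (u i))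

/-- Peeling off the edges below `u i` and `w j` together: none of them hides above the other. -/
def PeelBoth (σ : ℝ) (u w : ℕ → Plane) (i j i' j' : ℕ) : Prop :=
  i = i' + 1 ∧ j = j' + 1 ∧ lam σ u i' (w j) ≤ 0 ∧ lam (-σ) w j' (u i) ≤ 0

/-- Peeling off the maximal edges of the part of the funnel below the chord from `u i` to `w j`. -/
def Peel (σ : ℝ) (u w : ℕ → Plane) (i j i' j' : ℕ) : Prop :=
  PeelLeft σ u w i j i' j' ∨ PeelLeft (-σ) w u j i j' i' ∨ PeelBoth σ u w i j i' j'

theorem PeelBoth.symm {i j i' j' : ℕ} (h : PeelBoth σ u w i j i' j') :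
    PeelBoth (-σ) w u j i j' i' :=
  ⟨h.2.1, h.1, h.2.2.2, by rw [neg_neg]; exact h.2.2.1⟩

theorem Peel.symm {i j i' j' : ℕ} (h : Peel σ u w i j i' j') : Peel (-σ) w u j i j' i' := by
  rcases h with h | h | h
  · right; left; rwa [neg_neg]
  · left; exact h
  · right; right; exact PeelBoth.symm h

theorem Valid.symm {i j : ℕ} (h : Valid σ u w a b i j) : Valid (-σ) w u b a j i := by
  rcases h with ⟨h1, h2⟩ | ⟨h1, h2, h3, h4⟩
  · exact Or.inl ⟨h2, h1⟩
  · right; refine ⟨h2, h1, h4, ?_⟩; rwa [neg_neg]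

theorem PeelLeft.lt (hF : Funnel σ u w a b) {i j i' j' : ℕ} (hV : Valid σ u w a b i j)
    (h : PeelLeft σ u w i j i' j') :
    i < a ∧ j < b ∧ lam σ u i (w j) ≤ 0 ∧ lam (-σ) w j (u i) ≤ 0 := by
  rcases hV with ⟨rfl, rfl⟩ | hV
  · exfalso
    obtain ⟨-, -, -, h0 | ⟨k, hk, hpos⟩⟩ := h
    · have := hF.right_pos; omega
    · rw [hF.apex_eq, hk, lam_right] at hpos
      exact hpos.false
  · exact hV

theorem Peel.valid (hF : Funnel σ u w a b) {i j i' j' : ℕ} (hV : Valid σ u w a b i j)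
    (h : Peel σ u w i j i' j') :
    i' < a ∧ j' < b ∧ lam σ u i' (w j') ≤ 0 ∧ lam (-σ) w j' (u i') ≤ 0 := by
  have left : ∀ {σ : ℝ} {u w : ℕ → Plane} {a b i j i' j' : ℕ}, Funnel σ u w a b →
      Valid σ u w a b i j → PeelLeft σ u w i j i' j' →
      i' < a ∧ j' < b ∧ lam σ u i' (w j') ≤ 0 ∧ lam (-σ) w j' (u i') ≤ 0 := by
    intro σ u w a b i j i' j' hF hV h
    obtain ⟨h1, h2, h3, h4⟩ := h.lt hF hV
    obtain ⟨rfl, rfl, h5, h6⟩ := h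
    refine ⟨by omega, h2, h5.le, ?_⟩
    exact (hF.symm.lam_le_lam h2 (by omega) h1.le).trans h4
  rcases h with h | h | ⟨rfl, rfl, h3, h4⟩
  · exact left hF hV h
  · obtain ⟨h1, h2, h3, h4⟩ := left hF.symm hV.symm h
    rw [neg_neg] at h4
    exact ⟨h2, h1, h4, h3⟩
  · have hle : i' < a ∧ j' < b := by
      rcases hV with ⟨h1, h2⟩ | ⟨h1, h2, -⟩ <;> omega
    exact ⟨hle.1, hle.2, (hF.lam_le_lam hle.1 (Nat.le_succ _) hle.2).trans h3,
      (hF.symm.lam_le_lam hle.2 (Nat.le_succ _) hle.1).trans h4⟩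

/-- The next chord in the greedy peeling. At the end of a chain the truncated subtraction makes the
tested triple of points degenerate, so that the other chain is peeled off. -/
noncomputable def next (σ : ℝ) (u w : ℕ → Plane) (p : ℕ × ℕ) : ℕ × ℕ :=
  open Classical in
  if 0 < -σ * orient (w (p.2 - 1)) (w p.2) (u p.1) then (p.1 - 1, p.2)
  else if 0 < σ * orient (u (p.1 - 1)) (u p.1) (w p.2) then (p.1, p.2 - 1)
  else (p.1 - 1, p.2 - 1)

theorem peel_next (hF : Funnel σ u w a b) {p : ℕ × ℕ} (hV : Valid σ u w a b p.1 p.2)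
    (h0 : p ≠ (0, 0)) : Peel σ u w p.1 p.2 (next σ u w p).1 (next σ u w p).2 := by
  obtain ⟨i, j⟩ := p
  have hle : i ≤ a ∧ j ≤ b := by
    rcases hV with ⟨h1, h2⟩ | ⟨h1, h2, -⟩
    · exact ⟨h1.le, h2.le⟩
    · exact ⟨h1.le, h2.le⟩
  have hij : i ≠ 0 ∨ j ≠ 0 := by
    by_contra! hc
    exact h0 (by rw [hc.1, hc.2])
  simp only at hV ⊢
  unfold next
  simp only
  split_ifs with h1 h2
  · obtain ⟨k, rfl⟩ : ∃ k, j = k + 1 := by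
      rcases Nat.eq_zero_or_pos j with rfl | hj
      · simp [orient] at h1
      · exact ⟨j - 1, by omega⟩
    have h1' : 0 < lam (-σ) w k (u i) := h1
    obtain ⟨l, rfl⟩ : ∃ l, i = l + 1 := by
      rcases Nat.eq_zero_or_pos i with rfl | hi
      · exact absurd h1' (hF.symm.lam_base_neg (by omega)).le.not_gt
      · exact ⟨i - 1, by omega⟩
    left
    refine ⟨rfl, rfl, ?_, Or.inr ⟨k, rfl, h1'⟩⟩
    have := hF.symm.exclusive (by omega) (by omega) h1'
    rwa [neg_neg] at this
  · obtain ⟨l, rfl⟩ : ∃ l, i = l + 1 := by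
      rcases Nat.eq_zero_or_pos i with rfl | hi
      · simp [orient] at h2
      · exact ⟨i - 1, by omega⟩
    have h2' : 0 < lam σ u l (w j) := h2
    obtain ⟨k, rfl⟩ : ∃ k, j = k + 1 := by
      rcases Nat.eq_zero_or_pos j with rfl | hj
      · exact absurd h2' (hF.lam_base_neg (by omega)).le.not_gt
      · exact ⟨j - 1, by omega⟩
    right; left
    refine ⟨rfl, rfl, hF.exclusive (by omega) (by omega) h2', Or.inr ⟨l, rfl, ?_⟩⟩
    rwa [neg_neg]
  · rcases Nat.eq_zero_or_pos i with rfl | hi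
    · right; left
      refine ⟨by omega, rfl, hF.symm.lam_base_neg (by omega), Or.inl rfl⟩
    rcases Nat.eq_zero_or_pos j with rfl | hj
    · left
      exact ⟨by omega, rfl, hF.lam_base_neg (by omega), Or.inl rfl⟩
    right; right
    obtain ⟨k, rfl⟩ : ∃ k, j = k + 1 := ⟨j - 1, by omega⟩
    obtain ⟨l, rfl⟩ : ∃ l, i = l + 1 := ⟨i - 1, by omega⟩
    exact ⟨rfl, rfl, not_lt.1 h2, not_lt.1 h1⟩

/-! ### The pieces cover the funnel -/

/-- The points of a funnel: above the base, and on the inner side of some edge of each chain. -/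
def body (σ : ℝ) (u w : ℕ → Plane) (a b : ℕ) : Set Plane :=
  {x | 0 ≤ lid σ (u 0) (w 0) x ∧ (∃ i < a, lam σ u i x ≤ 0) ∧ ∃ j < b, lam (-σ) w j x ≤ 0}

/-- The points of a funnel above the chord from `u i` to `w j`. -/
def Above (σ : ℝ) (u w : ℕ → Plane) (a b i j : ℕ) (x : Plane) : Prop :=
  0 ≤ lid σ (u i) (w j) x ∧ (∃ k, i ≤ k ∧ k < a ∧ lam σ u k x ≤ 0) ∧
    ∃ k, j ≤ k ∧ k < b ∧ lam (-σ) w k x ≤ 0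

/-- The piece between the chord from `u i` to `w j` and the chord from `u i'` to `w j'`. -/
def piece (u w : ℕ → Plane) (i j i' j' : ℕ) : Set Plane :=
  convexHull ℝ {u i', u i, w j, w j'}

theorem piece_symm (u w : ℕ → Plane) (i j i' j' : ℕ) : piece w u j i j' i' = piece u w i j i' j' := by
  unfold piece
  congr 1
  ext x
  simp only [mem_insert_iff, mem_singleton_iff]
  tauto

theorem Above.symm {i j : ℕ} {x : Plane} (h : Above σ u w a b i j x) :
    Above (-σ) w u b a j i x := by
  refine ⟨?_, h.2.2, ?_⟩
  · rw [lid_symm]; exact h.1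
  · rw [neg_neg]; exact h.2.1

/-- The chord from `u i` to `w j` lies below the upper edges of the chain `u`. -/
theorem cr_chord_nonneg (hF : Funnel σ u w a b) {i j : ℕ} (hj : j < b)
    (hv : lam σ u i (w j) ≤ 0) {m : ℕ} (him : i ≤ m) (hm : m < a) :
    0 ≤ σ * cr (w j - u i) (u (m + 1) - u m) := by
  obtain ⟨p, hp⟩ : ∃ p, p + 1 = a := ⟨a - 1, by omega⟩
  have h1 := hF.lam_nonpos_of_le hp (hF.lam_top_nonpos hp hj.le) him hm hv
  have h2 := hF.lam_vertex_nonneg hm (k := i) (by omega)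
  have h3 := lam_sub σ u m (w j) (u i)
  rw [cr_swap]; linarith

/-- A point on the outer side of the edge `i` and on the inner side of a higher edge lies in
the cone spanned at `u (i + 1)` by the edge directions in between. -/
theorem cr_nonneg_of_outer (hF : Funnel σ u w a b) {i k : ℕ} {x c : Plane}
    (hc : ∀ m, i ≤ m → m < a → 0 ≤ σ * cr c (u (m + 1) - u m))
    (hi : 0 < lam σ u i x) (hik : i < k) (hk : k < a) (hkx : lam σ u k x ≤ 0) :
    0 ≤ σ * cr c (x - u (i + 1)) ∧
      ((∀ m, i ≤ m → m < a → 0 < σ * cr c (u (m + 1) - u m)) → 0 < σ * cr c (x - u (i + 1))) := by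
  classical
  have hex : ∃ m, i < m ∧ m < a ∧ lam σ u m x ≤ 0 := ⟨k, hik, hk, hkx⟩
  obtain ⟨him, hma, hmx⟩ := Nat.find_spec hex
  set m := Nat.find hex with hm
  obtain ⟨q, hq⟩ : ∃ q, m = q + 1 := ⟨m - 1, by omega⟩
  rw [hq] at him hma hmx
  have hqx : 0 < lam σ u q x := by
    rcases Nat.lt_or_ge i q with h1 | h1
    · have := Nat.find_min hex (m := q) (by omega)
      by_contra! h2
      exact this ⟨h1, by omega, h2⟩
    · obtain rfl : q = i := by omega
      exact hi
  have key : (σ * cr (u (q + 1) - u q) (u (q + 2) - u (q + 1))) * (σ * cr c (x - u (q + 1))) =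
      (-lam σ u (q + 1) x) * (σ * cr c (u (q + 1) - u q)) +
      lam σ u q x * (σ * cr c (u (q + 2) - u (q + 1))) := by
    simp only [lam, orient, cr, Prod.fst_sub, Prod.snd_sub]; ring
  have hturn := hF.left_turn q hma
  have hc1 := hc q (by omega) (by omega)
  have hc2 := hc (q + 1) (by omega) hma
  have hs1 : 0 ≤ σ * cr c (u (q + 1) - u (i + 1)) :=
    cr_sum_nonneg (by omega) fun m h1 h2 => hc m (by omega) (by omega)
  have e : σ * cr c (x - u (i + 1)) = σ * cr c (x - u (q + 1)) + σ * cr c (u (q + 1) - u (i + 1)) := by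
    simp only [cr, Prod.fst_sub, Prod.snd_sub]; ring
  rw [e]
  constructor
  · have h1 : 0 ≤ (σ * cr (u (q + 1) - u q) (u (q + 2) - u (q + 1))) *
        (σ * cr c (x - u (q + 1))) := by
      rw [key]
      exact add_nonneg (mul_nonneg (by linarith) hc1) (mul_nonneg hqx.le hc2)
    have := nonneg_of_mul_nonneg_right h1 hturn
    linarith
  · intro hpos
    have h1 : 0 < (σ * cr (u (q + 1) - u q) (u (q + 2) - u (q + 1))) *
        (σ * cr c (x - u (q + 1))) := by
      rw [key]
      exact add_pos_of_nonneg_of_pos (mul_nonneg (by linarith) hc1)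
        (mul_pos hqx (hpos (q + 1) (by omega) hma))
    have := pos_of_mul_pos_right h1 hturn.le
    linarith

section
variable {i j : ℕ} {x : Plane}

theorem chord_dir_nonneg (hF : Funnel σ u w a b) (hj : j < b) (hv : lam σ u (i + 1) (w j) ≤ 0)
    (hlow : lam σ u i (w j) ≤ 0) : ∀ m, i ≤ m → m < a →
      0 ≤ σ * cr (w j - u (i + 1)) (u (m + 1) - u m) := by
  intro m h1 h2
  rcases h1.eq_or_lt with rfl | h1
  · have h3 := lam_eq σ u i (w j)
    rw [cr_swap]; linarith
  · exact hF.cr_chord_nonneg hj hv h1 h2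

/-- A point of the funnel on the outer side of the edge below a chord is above the chord. -/
theorem lid_nonneg_of_outer (hF : Funnel σ u w a b) (hj : j < b)
    (hv : lam σ u (i + 1) (w j) ≤ 0) (hlow : lam σ u i (w j) ≤ 0) (hx : 0 < lam σ u i x)
    (hk : ∃ k, i + 1 ≤ k ∧ k < a ∧ lam σ u k x ≤ 0) : 0 ≤ lid σ (u (i + 1)) (w j) x := by
  obtain ⟨k, h1, h2, h3⟩ := hk
  have := (hF.cr_nonneg_of_outer (hF.chord_dir_nonneg hj hv hlow) hx h1 h2 h3).1
  have e := lid_sub σ (u (i + 1)) (w j) x (u (i + 1))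
  rw [lid_left] at e
  linarith

/-- A point on the inner side of the edge below a chord and on the outer side of the edge above it
is below the chord. If it is on the chord, then the chord extends the lower edge. -/
theorem lid_nonpos_of_inner (hF : Funnel σ u w a b) (hi : i + 1 < a) (hj : j < b)
    (hv : lam σ u (i + 1) (w j) ≤ 0) (hlow : lam σ u i (w j) ≤ 0) (hx : lam σ u i x ≤ 0)
    (hx' : 0 < lam σ u (i + 1) x) :
    lid σ (u (i + 1)) (w j) x ≤ 0 ∧ (lid σ (u (i + 1)) (w j) x = 0 → lam σ u i (w j) = 0) := by
  have key : (σ * cr (u (i + 1) - u i) (u (i + 2) - u (i + 1))) * lid σ (u (i + 1)) (w j) x =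
      lam σ u (i + 1) x * lam σ u i (w j) +
      lam σ u i x * (σ * cr (w j - u (i + 1)) (u (i + 2) - u (i + 1))) := by
    simp only [lam, lid, orient, cr, Prod.fst_sub, Prod.snd_sub]; ring
  have hturn := hF.left_turn i hi
  have hc := hF.cr_chord_nonneg hj hv le_rfl hi
  have p1 : lam σ u (i + 1) x * lam σ u i (w j) ≤ 0 :=
    mul_nonpos_of_nonneg_of_nonpos hx'.le hlow
  have p2 : lam σ u i x * (σ * cr (w j - u (i + 1)) (u (i + 2) - u (i + 1))) ≤ 0 :=
    mul_nonpos_of_nonpos_of_nonneg hx hc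
  constructor
  · by_contra! hpos
    have := mul_pos hturn hpos
    linarith
  · intro h0
    rw [h0, mul_zero] at key
    have : lam σ u (i + 1) x * lam σ u i (w j) = 0 := by linarith
    exact (mul_eq_zero.1 this).resolve_left hx'.ne'

theorem mem_triangle (hlow : lam σ u i (w j) < 0) (hx : lam σ u i x ≤ 0)
    (h1 : lid σ (u (i + 1)) (w j) x ≤ 0) (h2 : 0 ≤ lid σ (u i) (w j) x) :
    x ∈ convexHull ℝ {u i, u (i + 1), w j} := by
  refine mem_of_convex_of_orient (convex_convexHull ℝ _) (u := u i) (v := u (i + 1)) (w := w j)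
    (s := -σ) (subset_convexHull ℝ _ (by simp)) (subset_convexHull ℝ _ (by simp))
    (subset_convexHull ℝ _ (by simp)) ?_ ?_ ?_ ?_
  · simp only [lam] at hlow; linarith
  · simp only [lid] at h1; linarith
  · rw [orient_swap]; simp only [lid] at h2; linarith
  · simp only [lam] at hx; linarith

theorem mem_piece_left (hlow : lam σ u i (w j) < 0) (hx : lam σ u i x ≤ 0)
    (h1 : lid σ (u (i + 1)) (w j) x ≤ 0) (h2 : 0 ≤ lid σ (u i) (w j) x) :
    x ∈ piece u w (i + 1) j i j := by
  refine convexHull_mono ?_ (mem_triangle hlow hx h1 h2)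
  intro y hy
  simp only [mem_insert_iff, mem_singleton_iff] at hy ⊢
  tauto

theorem mem_piece_both (hF : Funnel σ u w a b) (hi : i < a) (hj : j < b)
    (hlow : lam σ u i (w (j + 1)) ≤ 0) (hlow' : lam (-σ) w j (u (i + 1)) ≤ 0)
    (hx : lam σ u i x ≤ 0) (hx' : lam (-σ) w j x ≤ 0)
    (h1 : lid σ (u (i + 1)) (w (j + 1)) x ≤ 0) (h2 : 0 ≤ lid σ (u i) (w j) x) :
    x ∈ piece u w (i + 1) (j + 1) i j := by
  have hneg : lam (-σ) w j (u i) < 0 :=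
    (hF.symm.lam_lt_lam hj (Nat.lt_succ_self i) hi).trans_le hlow'
  -- the diagonal from `u i` to `w (j + 1)` splits the piece into two triangles
  have hsum : lid σ (u i) (w (j + 1)) x ≤ 0 ∨ lam σ u i (w (j + 1)) < 0 := by
    rcases hlow.lt_or_eq with h3 | h3
    · exact Or.inr h3
    · left
      have := orient_add_orient_add_orient (u i) (u (i + 1)) (w (j + 1)) x
      rw [orient_swap (u i) (w (j + 1))] at this
      simp only [lam, lid] at *
      have e : σ * orient (u (i + 1)) (w (j + 1)) x - σ * orient (u i) (w (j + 1)) x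
          + σ * orient (u i) (u (i + 1)) x = 0 := by
        rw [← h3, ← this]; ring
      linarith
  by_cases hd : lid σ (u i) (w (j + 1)) x ≤ 0
  · have : x ∈ convexHull ℝ {w j, w (j + 1), u i} := by
      refine mem_triangle (σ := -σ) hneg hx' ?_ ?_
      · rw [lid_symm]; exact hd
      · rw [lid_symm]; exact h2
    refine convexHull_mono ?_ this
    intro y hy
    simp only [mem_insert_iff, mem_singleton_iff] at hy ⊢
    tauto
  · refine convexHull_mono ?_ (mem_triangle (hsum.resolve_left hd) hx h1 (not_le.1 hd).le)
    intro y hy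
    simp only [mem_insert_iff, mem_singleton_iff] at hy ⊢
    tauto

theorem above_of_peelLeft (hF : Funnel σ u w a b) {i' j' : ℕ} (hV : Valid σ u w a b i j)
    (hP : PeelLeft σ u w i j i' j') (hx : Above σ u w a b i' j' x) :
    x ∈ piece u w i j i' j' ∨ Above σ u w a b i j x := by
  obtain ⟨hia, hjb, hv, hv'⟩ := hP.lt hF hV
  obtain ⟨rfl, rfl, hlow, -⟩ := hP
  obtain ⟨h1, ⟨k, h2, h3, h4⟩, h5⟩ := hx
  by_cases hA : ∃ k, i' + 1 ≤ k ∧ k < a ∧ lam σ u k x ≤ 0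
  · by_cases hl : 0 ≤ lid σ (u (i' + 1)) (w j) x
    · exact Or.inr ⟨hl, hA, h5⟩
    · left
      refine mem_piece_left hlow ?_ (not_le.1 hl).le h1
      by_contra! hc
      exact hl (hF.lid_nonneg_of_outer hjb hv hlow.le hc hA)
  · left
    push Not at hA
    obtain rfl : k = i' := by
      by_contra hne
      exact absurd h4 (hA k (by omega) h3).not_ge
    exact mem_piece_left hlow h4
      (hF.lid_nonpos_of_inner hia hjb hv hlow.le h4 (hA _ le_rfl hia)).1 h1

/-- A point cannot lie on the outer side of the upper left edge and of the lower right edge at a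
chord. -/
theorem not_outer_of_not_above (hF : Funnel σ u w a b) (hi : i + 1 < a) (hj : j + 1 < b)
    (hv : lam σ u (i + 1) (w (j + 1)) ≤ 0) (hv' : lam (-σ) w (j + 1) (u (i + 1)) ≤ 0)
    (hlow : lam σ u i (w (j + 1)) ≤ 0) (hlow' : lam (-σ) w j (u (i + 1)) ≤ 0)
    (hx : lam σ u i x ≤ 0) (hx1 : 0 < lam σ u (i + 1) x)
    (hB : ∃ k, j ≤ k ∧ k < b ∧ lam (-σ) w k x ≤ 0) : lam (-σ) w j x ≤ 0 := by
  by_contra! hc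
  obtain ⟨k, h1, h2, h3⟩ := hB
  have hjk : j < k := by
    rcases h1.eq_or_lt with rfl | h1
    · linarith
    · exact h1
  have g1 := hF.symm.lid_nonneg_of_outer (by omega) hv' hlow' hc ⟨k, hjk, h2, h3⟩
  rw [lid_symm] at g1
  obtain ⟨g2, g3⟩ := hF.lid_nonpos_of_inner hi hj hv hlow hx hx1
  have g4 := g3 (le_antisymm g2 g1)
  have hpos : ∀ m, j ≤ m → m < b → 0 < -σ * cr (-(u (i + 1) - u i)) (w (m + 1) - w m) := by
    intro m _ hm
    have := hF.cross (i := i) (by omega) hm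
    simp only [cr, Prod.fst_neg, Prod.snd_neg] at this ⊢; linarith
  have g5 := (hF.symm.cr_nonneg_of_outer (fun m h1 h2 => (hpos m h1 h2).le) hc hjk h2 h3).2 hpos
  have g6 := lam_sub σ u i x (w (j + 1))
  rw [g4] at g6
  simp only [cr, Prod.fst_neg, Prod.snd_neg] at g5 g6
  linarith

theorem above_of_peelBoth (hF : Funnel σ u w a b) {i' j' : ℕ} (hV : Valid σ u w a b i j)
    (hP : PeelBoth σ u w i j i' j') (hx : Above σ u w a b i' j' x) :
    x ∈ piece u w i j i' j' ∨ Above σ u w a b i j x := by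
  obtain ⟨rfl, rfl, hlow, hlow'⟩ := hP
  obtain ⟨h1, hA', hB'⟩ := hx
  have hia : i' < a := by rcases hV with ⟨h, -⟩ | ⟨h, -⟩ <;> omega
  have hjb : j' < b := by rcases hV with ⟨-, h⟩ | ⟨-, h, -⟩ <;> omega
  have hA0 : (¬ ∃ k, i' + 1 ≤ k ∧ k < a ∧ lam σ u k x ≤ 0) → lam σ u i' x ≤ 0 := by
    intro hA
    obtain ⟨k, h2, h3, h4⟩ := hA'
    rcases h2.eq_or_lt with rfl | h2
    · exact h4
    · exact absurd ⟨k, h2, h3, h4⟩ hA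
  have hB0 : (¬ ∃ k, j' + 1 ≤ k ∧ k < b ∧ lam (-σ) w k x ≤ 0) → lam (-σ) w j' x ≤ 0 := by
    intro hB
    obtain ⟨k, h2, h3, h4⟩ := hB'
    rcases h2.eq_or_lt with rfl | h2
    · exact h4
    · exact absurd ⟨k, h2, h3, h4⟩ hB
  rcases hV with ⟨ha, hb⟩ | ⟨ha, hb, hv, hv'⟩
  · left
    refine mem_piece_both hF hia hjb hlow hlow' (hA0 ?_) (hB0 ?_) ?_ h1
    · rintro ⟨k, h2, h3, -⟩; omega
    · rintro ⟨k, h2, h3, -⟩; omega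
    · rw [ha, hb, hF.apex_eq]; simp [lid, orient]
  by_cases hA : ∃ k, i' + 1 ≤ k ∧ k < a ∧ lam σ u k x ≤ 0
  · by_cases hB : ∃ k, j' + 1 ≤ k ∧ k < b ∧ lam (-σ) w k x ≤ 0
    · by_cases hl : 0 ≤ lid σ (u (i' + 1)) (w (j' + 1)) x
      · exact Or.inr ⟨hl, hA, hB⟩
      · left
        refine mem_piece_both hF hia hjb hlow hlow' ?_ ?_ (not_le.1 hl).le h1
        · by_contra! hc
          exact hl (hF.lid_nonneg_of_outer hb hv hlow hc hA)
        · by_contra! hc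
          have := hF.symm.lid_nonneg_of_outer ha hv' hlow' hc hB
          rw [lid_symm] at this
          exact hl this
    · left
      have hx' := hB0 hB
      push Not at hB
      have hx1 := hB _ le_rfl hb
      have g := (hF.symm.lid_nonpos_of_inner hb ha hv' hlow' hx' hx1).1
      rw [lid_symm] at g
      refine mem_piece_both hF hia hjb hlow hlow' ?_ hx' g h1
      have g2 := hF.symm.not_outer_of_not_above hb ha hv' (by rwa [neg_neg]) hlow'
        (by rwa [neg_neg]) hx' hx1 (by rwa [neg_neg])
      rwa [neg_neg] at g2
  · left
    have hx' := hA0 hA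
    push Not at hA
    have hx1 := hA _ le_rfl ha
    have g := (hF.lid_nonpos_of_inner ha hb hv hlow hx' hx1).1
    exact mem_piece_both hF hia hjb hlow hlow' hx'
      (hF.not_outer_of_not_above ha hb hv hv' hlow hlow' hx' hx1 hB') g h1

theorem above_of_peel (hF : Funnel σ u w a b) {i' j' : ℕ} (hV : Valid σ u w a b i j)
    (hP : Peel σ u w i j i' j') (hx : Above σ u w a b i' j' x) :
    x ∈ piece u w i j i' j' ∨ Above σ u w a b i j x := by
  rcases hP with hP | hP | hP
  · exact hF.above_of_peelLeft hV hP hx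
  · rcases hF.symm.above_of_peelLeft hV.symm hP hx.symm with h | h
    · left; rwa [piece_symm] at h
    · right
      have := h.symm
      rwa [neg_neg] at this
  · exact hF.above_of_peelBoth hV hP hx

end

end Funnel

/-! ### The decomposition of a funnel into convex pieces -/

theorem continuous_lid (σ : ℝ) (p q : Plane) : Continuous (lid σ p q) :=
  continuous_const.mul (continuous_orient p q)

theorem continuous_lam (σ : ℝ) (u : ℕ → Plane) (i : ℕ) : Continuous (lam σ u i) :=
  continuous_lid σ _ _

theorem Convex.preimage_lid {S : Set ℝ} (hS : Convex ℝ S) (σ : ℝ) (p q : Plane) :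
    Convex ℝ (lid σ p q ⁻¹' S) := by
  intro x hx y hy c d hc hd hcd
  have e : lid σ p q (c • x + d • y) = c • lid σ p q x + d • lid σ p q y := by
    have h1 := lid_add_smul σ p q x y d
    have h2 : x + d • (y - x) = c • x + d • y := by
      rw [← sub_eq_iff_eq_add.2 hcd.symm, smul_sub, sub_smul, one_smul]; abel
    rw [h2] at h1
    rw [h1, ← sub_eq_iff_eq_add.2 hcd.symm, smul_eq_mul, smul_eq_mul]; ring
  rw [mem_preimage, e]
  exact hS hx hy hc hd hcd

theorem Convex.preimage_lam {S : Set ℝ} (hS : Convex ℝ S) (σ : ℝ) (u : ℕ → Plane) (i : ℕ) :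
    Convex ℝ (lam σ u i ⁻¹' S) :=
  hS.preimage_lid σ _ _

theorem interior_triangle_nonempty {p q r : Plane} (h : orient p q r ≠ 0) :
    (interior (convexHull ℝ {p, q, r})).Nonempty := by
  have hs : 0 < orient p q r * orient p q r := mul_self_pos.2 h
  set s := orient p q r with hsdef
  have hsub : {x | 0 < s * orient q r x} ∩ {x | 0 < s * orient r p x} ∩ {x | 0 < s * orient p q x}
      ⊆ convexHull ℝ {p, q, r} := fun x hx =>
    mem_of_convex_of_orient (convex_convexHull ℝ _) (subset_convexHull ℝ _ (by simp))
      (subset_convexHull ℝ _ (by simp)) (subset_convexHull ℝ _ (by simp)) hs hx.1.1.le hx.1.2.le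
      hx.2.le
  have hopen : ∀ a b : Plane, IsOpen {x | 0 < s * orient a b x} := fun a b =>
    isOpen_lt continuous_const (continuous_const.mul (continuous_orient a b))
  refine ⟨p + (1 / 3 : ℝ) • (q - p) + (1 / 3 : ℝ) • (r - p), interior_maximal hsub
    (((hopen _ _).inter (hopen _ _)).inter (hopen _ _)) ⟨⟨?_, ?_⟩, ?_⟩⟩ <;>
  · have e : ∀ y : ℝ, y = s / 3 → 0 < s * y := by
      rintro y rfl; linarith
    refine e _ ?_
    rw [hsdef]
    simp only [orient, Prod.fst_add, Prod.snd_add, Prod.smul_fst, Prod.smul_snd, Prod.fst_sub,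
      Prod.snd_sub, smul_eq_mul]
    ring

/-- Two sets on different sides of a line do not overlap. -/
theorem disjoint_interior_of_lid {σ : ℝ} {p q : Plane} {A B : Set Plane} (hσ : σ ≠ 0) (hpq : p ≠ q)
    (hA : ∀ x ∈ A, 0 ≤ lid σ p q x) (hB : ∀ x ∈ B, lid σ p q x ≤ 0) :
    Disjoint (interior A) (interior B) := by
  rw [Set.disjoint_left]
  intro x hxA hxB
  have hU : interior A ∩ interior B ∈ 𝓝 x :=
    (isOpen_interior.inter isOpen_interior).mem_nhds ⟨hxA, hxB⟩
  set d : Plane := (-(q - p).2, (q - p).1) with hd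
  have hc : Tendsto (fun t : ℝ => x + t • d) (𝓝[>] 0) (𝓝 x) := by
    have : Continuous fun t : ℝ => x + t • d := by fun_prop
    have h := this.tendsto 0
    rw [zero_smul, add_zero] at h
    exact h.mono_left nhdsWithin_le_nhds
  obtain ⟨t, ht, ht0⟩ := ((hc.eventually hU).and self_mem_nhdsWithin).exists
  have h0 : ∀ y, y ∈ interior A ∩ interior B → lid σ p q y = 0 := fun y hy =>
    le_antisymm (hB y (interior_subset hy.2)) (hA y (interior_subset hy.1))
  have h1 := h0 _ ht
  have h2 := h0 x ⟨hxA, hxB⟩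
  have h3 := lid_sub σ p q (x + t • d) x
  rw [h1, h2, add_sub_cancel_left] at h3
  have h4 : cr (q - p) (t • d) = t * ((q - p).1 ^ 2 + (q - p).2 ^ 2) := by
    simp only [cr, hd, Prod.smul_fst, Prod.smul_snd, smul_eq_mul]; ring
  rw [h4, sub_zero] at h3
  have h5 : (q - p).1 ^ 2 + (q - p).2 ^ 2 = 0 := by
    rcases mul_eq_zero.1 h3.symm with h | h
    · exact absurd h hσ
    · exact (mul_eq_zero.1 h).resolve_left (ne_of_gt ht0)
  refine hpq (sub_eq_zero.1 (?_ : q - p = 0)).symm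
  ext
  · simp only [Prod.fst_zero]; nlinarith [sq_nonneg (q - p).1, sq_nonneg (q - p).2]
  · simp only [Prod.snd_zero]; nlinarith [sq_nonneg (q - p).1, sq_nonneg (q - p).2]

namespace Funnel

variable {σ : ℝ} {u w : ℕ → Plane} {a b : ℕ}

theorem sign_ne_zero (hF : Funnel σ u w a b) : σ ≠ 0 := by
  rintro rfl
  have := hF.left_up 0 hF.left_pos
  simp at this

/-- A sequence of chords from `u (i s)` to `w (j s)`, from the apex down to the base, in which each
one arises from the one before by peeling. -/
structure Peeling (σ : ℝ) (u w : ℕ → Plane) (a b : ℕ) (i j : ℕ → ℕ) (m : ℕ) : Prop where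
  left_top : i 0 = a
  right_top : j 0 = b
  left_base : i m = 0
  right_base : j m = 0
  peel : ∀ s < m, Peel σ u w (i s) (j s) (i (s + 1)) (j (s + 1))

theorem next_zero (σ : ℝ) (u w : ℕ → Plane) : next σ u w (0, 0) = (0, 0) := by
  unfold next
  split_ifs <;> rfl

theorem Peel.lt_add {i j i' j' : ℕ} (h : Peel σ u w i j i' j') :
    i' ≤ i ∧ j' ≤ j ∧ i ≤ i' + 1 ∧ j ≤ j' + 1 ∧ i' + j' < i + j := by
  rcases h with ⟨rfl, rfl, -⟩ | ⟨rfl, rfl, -⟩ | ⟨rfl, rfl, -⟩ <;> omega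

/-- The chords of the greedy peeling. -/
noncomputable def chord (σ : ℝ) (u w : ℕ → Plane) (a b s : ℕ) : ℕ × ℕ :=
  (next σ u w)^[s] (a, b)

theorem chord_succ (σ : ℝ) (u w : ℕ → Plane) (a b s : ℕ) :
    chord σ u w a b (s + 1) = next σ u w (chord σ u w a b s) :=
  Function.iterate_succ_apply' _ _ _

theorem valid_chord (hF : Funnel σ u w a b) (s : ℕ) :
    Valid σ u w a b (chord σ u w a b s).1 (chord σ u w a b s).2 := by
  induction s with
  | zero => exact Or.inl ⟨rfl, rfl⟩
  | succ s ih =>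
    rw [chord_succ]
    by_cases h0 : chord σ u w a b s = (0, 0)
    · rw [h0, next_zero]; rwa [h0] at ih
    · exact Or.inr ((hF.peel_next ih h0).valid hF ih)

/-- The greedy peeling ends at the base after at most `a + b` steps, one for each edge. -/
theorem exists_peeling (hF : Funnel σ u w a b) :
    ∃ m, 0 < m ∧ m ≤ a + b ∧ chord σ u w a b m = (0, 0) ∧
      (∀ s < m, chord σ u w a b s ≠ (0, 0)) ∧
      Peeling σ u w a b (fun s => (chord σ u w a b s).1) (fun s => (chord σ u w a b s).2) m := by
  classical
  have hdec : ∀ s, chord σ u w a b s = (0, 0) ∨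
      (chord σ u w a b s).1 + (chord σ u w a b s).2 + s ≤ a + b := by
    intro s
    induction s with
    | zero => exact Or.inr le_rfl
    | succ s ih =>
      by_cases h0 : chord σ u w a b s = (0, 0)
      · left; rw [chord_succ, h0, next_zero]
      · right
        have h1 := (hF.peel_next (hF.valid_chord s) h0).lt_add
        rw [← chord_succ] at h1
        have h2 := ih.resolve_left h0
        omega
  have hab : chord σ u w a b (a + b) = (0, 0) := by
    rcases hdec (a + b) with h | h
    · exact h
    · refine Prod.ext ?_ ?_ <;> simp only <;> omega
  have hex : ∃ m, chord σ u w a b m = (0, 0) := ⟨_, hab⟩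
  have hmin : ∀ s < Nat.find hex, chord σ u w a b s ≠ (0, 0) := fun s hs => Nat.find_min hex hs
  refine ⟨Nat.find hex, ?_, Nat.find_min' hex hab, Nat.find_spec hex, hmin, rfl, rfl, ?_, ?_, ?_⟩
  · by_contra! hc
    have h1 := Nat.find_spec hex
    rw [Nat.le_zero.1 hc] at h1
    have h2 : a = 0 := congrArg Prod.fst h1
    have := hF.left_pos
    omega
  · exact congrArg Prod.fst (Nat.find_spec hex)
  · exact congrArg Prod.snd (Nat.find_spec hex)
  · intro s hs
    have := hF.peel_next (hF.valid_chord s) (hmin s hs)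
    rwa [← chord_succ] at this

/-- The inner sides of the two edges below a chord contain the piece. -/
theorem Peel.inner (hF : Funnel σ u w a b) {i j i' j' : ℕ} (hV : Valid σ u w a b i j)
    (h : Peel σ u w i j i' j') : lam σ u i' (u i) = 0 ∧ lam σ u i' (w j) ≤ 0 := by
  rcases h with ⟨rfl, rfl, h1, -⟩ | h | ⟨rfl, rfl, h1, -⟩
  · exact ⟨lam_right _ _ _, h1.le⟩
  · have := h.lt hF.symm hV.symm
    rw [neg_neg] at this
    rw [h.2.1]
    refine ⟨lam_left _ _ _, ?_⟩
    rw [← h.2.1]; exact this.2.2.2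
  · exact ⟨lam_right _ _ _, h1⟩

/-- The lower vertices of a piece are below its upper chord. -/
theorem Peel.lid_nonpos (hF : Funnel σ u w a b) {i j i' j' : ℕ} (hV : Valid σ u w a b i j)
    (h : Peel σ u w i j i' j') : lid σ (u i) (w j) (u i') ≤ 0 := by
  rcases Nat.lt_or_ge i' i with h1 | h1
  · have h2 := (h.inner hF hV).2
    obtain rfl : i = i' + 1 := by have := h.lt_add; omega
    rwa [lam, ← orient_rotate] at h2
  · obtain rfl : i = i' := by have := h.lt_add; omega
    rw [lid_left]

namespace Peeling

variable {i j : ℕ → ℕ} {m : ℕ}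

theorem symm (h : Peeling σ u w a b i j m) : Peeling (-σ) w u b a j i m :=
  ⟨h.right_top, h.left_top, h.right_base, h.left_base, fun s hs => (h.peel s hs).symm⟩

theorem valid (h : Peeling σ u w a b i j m) (hF : Funnel σ u w a b) {s : ℕ} (hs : s ≤ m) :
    Valid σ u w a b (i s) (j s) := by
  induction s with
  | zero => exact Or.inl ⟨h.left_top, h.right_top⟩
  | succ s ih => exact Or.inr ((h.peel s hs).valid hF (ih (by omega)))

theorem inner (h : Peeling σ u w a b i j m) (hF : Funnel σ u w a b) {s : ℕ} (h0 : 0 < s)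
    (hs : s ≤ m) :
    i s < a ∧ j s < b ∧ lam σ u (i s) (w (j s)) ≤ 0 ∧ lam (-σ) w (j s) (u (i s)) ≤ 0 := by
  obtain ⟨r, rfl⟩ : ∃ r, s = r + 1 := ⟨s - 1, by omega⟩
  exact (h.peel r hs).valid hF (h.valid hF (by omega))

theorem left_anti (h : Peeling σ u w a b i j m) {s r : ℕ} (hsr : s ≤ r) (hr : r ≤ m) :
    i r ≤ i s := by
  induction r, hsr using Nat.le_induction with
  | base => exact le_rfl
  | succ r _ ih => exact (h.peel r hr).lt_add.1.trans (ih (by omega))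

theorem left_le (h : Peeling σ u w a b i j m) {s : ℕ} (hs : s ≤ m) : i s ≤ a :=
  (h.left_anti (Nat.zero_le s) hs).trans h.left_top.le

theorem piece_subset (h : Peeling σ u w a b i j m) (hF : Funnel σ u w a b) {s : ℕ} (hs : s < m) :
    piece u w (i s) (j s) (i (s + 1)) (j (s + 1)) ⊆ body σ u w a b := by
  have hconv : Convex ℝ (lid σ (u 0) (w 0) ⁻¹' Ici 0 ∩ lam σ u (i (s + 1)) ⁻¹' Iic 0 ∩
      lam (-σ) w (j (s + 1)) ⁻¹' Iic 0) :=
    (((convex_Ici 0).preimage_lid _ _ _).inter ((convex_Iic 0).preimage_lam _ _ _)).inter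
      ((convex_Iic 0).preimage_lam _ _ _)
  obtain ⟨h1, h2, h3, h4⟩ := h.inner hF (Nat.succ_pos s) hs
  have hV := h.valid hF hs.le
  obtain ⟨h5, h6⟩ := (h.peel s hs).inner hF hV
  obtain ⟨h7, h8⟩ := (h.peel s hs).symm.inner hF.symm hV.symm
  have g1 := hF.lid_vertex_nonneg (h.left_le (s := s) hs.le)
  have g2 := hF.symm.lid_vertex_nonneg (h.symm.left_le (s := s) hs.le)
  have g3 := hF.lid_vertex_nonneg (h.left_le (s := s + 1) hs)
  have g4 := hF.symm.lid_vertex_nonneg (h.symm.left_le (s := s + 1) hs)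
  rw [lid_symm] at g2 g4
  refine (convexHull_min ?_ hconv).trans fun x hx =>
    ⟨hx.1.1, ⟨_, h1, hx.1.2⟩, ⟨_, h2, hx.2⟩⟩
  rintro x (rfl | rfl | rfl | rfl)
  · exact ⟨⟨g3, (lam_left _ _ _).le⟩, h4⟩
  · exact ⟨⟨g1, h5.le⟩, h8⟩
  · exact ⟨⟨g2, h6⟩, h7.le⟩
  · exact ⟨⟨g4, h3⟩, (lam_left _ _ _).le⟩

theorem exists_mem_piece (h : Peeling σ u w a b i j m) (hF : Funnel σ u w a b) {x : Plane} {r : ℕ}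
    (hr : r ≤ m) (hx : Above σ u w a b (i r) (j r) x) :
    ∃ s < r, x ∈ piece u w (i s) (j s) (i (s + 1)) (j (s + 1)) := by
  induction r with
  | zero =>
    obtain ⟨-, ⟨k, h1, h2, -⟩, -⟩ := hx
    rw [h.left_top] at h1
    omega
  | succ r ih =>
    rcases hF.above_of_peel (h.valid hF (by omega)) (h.peel r hr) hx with h1 | h1
    · exact ⟨r, by omega, h1⟩
    · obtain ⟨s, hs, h2⟩ := ih (by omega) h1
      exact ⟨s, by omega, h2⟩

/-- The pieces cover the funnel: by induction, the pieces above a chord cover the part of the funnel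
above it. -/
theorem iUnion_piece (h : Peeling σ u w a b i j m) (hF : Funnel σ u w a b) :
    ⋃ s < m, piece u w (i s) (j s) (i (s + 1)) (j (s + 1)) = body σ u w a b := by
  apply Subset.antisymm
  · exact iUnion₂_subset fun s hs => h.piece_subset hF hs
  · rintro x ⟨h1, ⟨k, h2, h3⟩, l, h4, h5⟩
    have hA : Above σ u w a b (i m) (j m) x := by
      rw [h.left_base, h.right_base]
      exact ⟨h1, ⟨k, k.zero_le, h2, h3⟩, l, l.zero_le, h4, h5⟩
    obtain ⟨s, hs, h6⟩ := h.exists_mem_piece hF le_rfl hA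
    exact mem_iUnion₂.2 ⟨s, hs, h6⟩

/-- The upper vertices of the left chain are above a chord, so that chords separate the pieces. -/
theorem lid_nonneg_of_above (h : Peeling σ u w a b i j m) (hF : Funnel σ u w a b) {r k : ℕ}
    (h0 : 0 < r) (hr : r ≤ m) (hk : i r ≤ k) (hka : k ≤ a) :
    0 ≤ lid σ (u (i r)) (w (j r)) (u k) := by
  obtain ⟨h1, h2, h3, -⟩ := h.inner hF h0 hr
  have e := lid_sub σ (u (i r)) (w (j r)) (u k) (u (i r))
  rw [lid_left, sub_zero] at e
  rw [e]
  exact cr_sum_nonneg hk fun l h4 h5 => hF.cr_chord_nonneg h2 h3 h4 (by omega)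

theorem disjoint_piece (h : Peeling σ u w a b i j m) (hF : Funnel σ u w a b) {s r : ℕ} (hsr : s < r)
    (hr : r < m) :
    Disjoint (interior (piece u w (i s) (j s) (i (s + 1)) (j (s + 1))))
      (interior (piece u w (i r) (j r) (i (r + 1)) (j (r + 1)))) := by
  have h0 : 0 < r := by omega
  obtain ⟨h1, h2, -⟩ := h.inner hF h0 hr.le
  have hV := h.valid hF hr.le
  refine disjoint_interior_of_lid hF.sign_ne_zero (hF.left_ne_right h1 h2) ?_ ?_
  · refine convexHull_min ?_ ((convex_Ici 0).preimage_lid σ (u (i r)) (w (j r)))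
    have g1 : ∀ q, s ≤ q → q ≤ r → 0 ≤ lid σ (u (i r)) (w (j r)) (u (i q)) := fun q _ hq =>
      h.lid_nonneg_of_above hF h0 hr.le (h.left_anti hq hr.le) (h.left_le (by omega))
    have g2 : ∀ q, s ≤ q → q ≤ r → 0 ≤ lid σ (u (i r)) (w (j r)) (w (j q)) := fun q _ hq => by
      have := h.symm.lid_nonneg_of_above hF.symm h0 hr.le (h.symm.left_anti hq hr.le)
        (h.symm.left_le (by omega))
      rwa [lid_symm] at this
    rintro x (rfl | rfl | rfl | rfl)
    · exact g1 _ (by omega) hsr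
    · exact g1 _ le_rfl hsr.le
    · exact g2 _ le_rfl hsr.le
    · exact g2 _ (by omega) hsr
  · refine convexHull_min ?_ ((convex_Iic 0).preimage_lid σ (u (i r)) (w (j r)))
    rintro x (rfl | rfl | rfl | rfl)
    · exact (h.peel r hr).lid_nonpos hF hV
    · exact (lid_left _ _ _).le
    · exact (lid_right _ _ _).le
    · have := (h.peel r hr).symm.lid_nonpos hF.symm hV.symm
      rwa [lid_symm] at this

end Peeling

theorem PeelLeft.interior_nonempty {i j i' j' : ℕ} (h : PeelLeft σ u w i j i' j') :
    (interior (piece u w i j i' j')).Nonempty := by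
  obtain ⟨rfl, rfl, h1, -⟩ := h
  have : orient (u i') (u (i' + 1)) (w j) ≠ 0 := by
    intro h0
    rw [lam, h0, mul_zero] at h1
    exact h1.false
  refine (interior_triangle_nonempty this).mono (interior_mono (convexHull_mono ?_))
  intro y hy
  simp only [mem_insert_iff, mem_singleton_iff] at hy ⊢
  tauto

theorem Peel.interior_nonempty (hF : Funnel σ u w a b) {i j i' j' : ℕ} (hV : Valid σ u w a b i j)
    (h : Peel σ u w i j i' j') : (interior (piece u w i j i' j')).Nonempty := by
  have hle := h.valid hF hV
  rcases h with h | h | ⟨rfl, rfl, -, h1⟩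
  · exact h.interior_nonempty
  · have := h.interior_nonempty
    rwa [piece_symm] at this
  · have h2 : lam (-σ) w j' (u i') < 0 :=
      (hF.symm.lam_lt_lam hle.2.1 (Nat.lt_succ_self _) hle.1).trans_le h1
    have : orient (w j') (w (j' + 1)) (u i') ≠ 0 := by
      intro h0
      rw [lam, h0, mul_zero] at h2
      exact h2.false
    refine (interior_triangle_nonempty this).mono (interior_mono (convexHull_mono ?_))
    intro y hy
    simp only [mem_insert_iff, mem_singleton_iff] at hy ⊢
    tauto

theorem Peeling.piece_ne {i j : ℕ → ℕ} {m : ℕ} (h : Peeling σ u w a b i j m)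
    (hF : Funnel σ u w a b) {s r : ℕ} (hsr : s < r) (hr : r < m) :
    piece u w (i s) (j s) (i (s + 1)) (j (s + 1)) ≠
      piece u w (i r) (j r) (i (r + 1)) (j (r + 1)) := by
  intro e
  have h1 := h.disjoint_piece hF hsr hr
  rw [e, disjoint_self] at h1
  exact ((h.peel r hr).interior_nonempty hF (h.valid hF hr.le)).ne_empty h1

end Funnel

/-! ### The region of a funnel polygon -/

theorem exists_smul_of_orient_eq_zero {p q x : Plane} (hpq : p ≠ q) (h : orient p q x = 0) :
    ∃ t : ℝ, x = p + t • (q - p) := by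
  have h0 : (q.1 - p.1) ^ 2 + (q.2 - p.2) ^ 2 ≠ 0 := by
    intro h0
    refine hpq (Prod.ext ?_ ?_) <;> nlinarith [sq_nonneg (q.1 - p.1), sq_nonneg (q.2 - p.2)]
  refine ⟨((q.1 - p.1) * (x.1 - p.1) + (q.2 - p.2) * (x.2 - p.2)) /
    ((q.1 - p.1) ^ 2 + (q.2 - p.2) ^ 2), ?_⟩
  unfold orient at h
  ext
  · simp only [Prod.fst_add, Prod.smul_fst, Prod.fst_sub, smul_eq_mul]
    field_simp
    linear_combination (-(q.2 - p.2)) * h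
  · simp only [Prod.snd_add, Prod.smul_snd, Prod.snd_sub, smul_eq_mul]
    field_simp
    linear_combination (q.1 - p.1) * h

theorem not_isBounded_of_ray {K : Set Plane} {x d : Plane} (hd : d ≠ 0)
    (h : ∀ t : ℝ, 0 ≤ t → x + t • d ∈ K) : ¬ Bornology.IsBounded K := by
  intro hK
  obtain ⟨R, hR⟩ := hK.exists_norm_le
  have hdpos : 0 < ‖d‖ := norm_pos_iff.2 hd
  have hR0 : 0 ≤ R := (norm_nonneg _).trans (hR _ (h 0 le_rfl))
  set t : ℝ := (R + ‖x‖ + 1) / ‖d‖ with ht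
  have ht0 : 0 ≤ t := by positivity
  have h1 := hR _ (h t ht0)
  have h2 : ‖t • d‖ ≤ ‖x + t • d‖ + ‖x‖ := by
    have := norm_sub_le (x + t • d) x
    rwa [add_sub_cancel_left] at this
  rw [norm_smul, Real.norm_of_nonneg ht0, ht, div_mul_cancel₀ _ hdpos.ne'] at h2
  linarith

namespace Funnel

variable {σ : ℝ} {u w : ℕ → Plane} {a b : ℕ}

/-- The boundary of a funnel: the two chains and the base. -/
def outline (u w : ℕ → Plane) (a b : ℕ) : Set Plane :=
  (⋃ i < a, segment ℝ (u i) (u (i + 1))) ∪ (⋃ j < b, segment ℝ (w j) (w (j + 1))) ∪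
    segment ℝ (u 0) (w 0)

theorem body_symm (σ : ℝ) (u w : ℕ → Plane) (a b : ℕ) : body (-σ) w u b a = body σ u w a b := by
  ext x
  simp only [body, mem_ofPred_eq, lid_symm, neg_neg]
  tauto

theorem base_ne (hF : Funnel σ u w a b) : u 0 ≠ w 0 := hF.left_ne_right hF.left_pos hF.right_pos

theorem isCompact_body (hF : Funnel σ u w a b) : IsCompact (body σ u w a b) := by
  obtain ⟨m, -, -, -, -, h⟩ := hF.exists_peeling
  rw [← h.iUnion_piece hF]
  exact (finite_Iio m).isCompact_biUnion fun s _ => (toFinite _).isCompact_convexHull ℝ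

theorem isCompact_outline (u w : ℕ → Plane) (a b : ℕ) : IsCompact (outline u w a b) := by
  have hseg : ∀ p q : Plane, IsCompact (segment ℝ p q) := fun p q => by
    rw [← convexHull_pair]; exact (toFinite _).isCompact_convexHull ℝ
  exact (((finite_Iio a).isCompact_biUnion fun i _ => hseg _ _).union
    ((finite_Iio b).isCompact_biUnion fun i _ => hseg _ _)).union (hseg _ _)

theorem segment_subset_body (hF : Funnel σ u w a b) {i : ℕ} (hi : i < a) :
    segment ℝ (u i) (u (i + 1)) ⊆ body σ u w a b := by
  obtain ⟨q, hq⟩ : ∃ q, q + 1 = b := ⟨b - 1, by have := hF.right_pos; omega⟩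
  have hconv : Convex ℝ (lid σ (u 0) (w 0) ⁻¹' Ici 0 ∩ lam σ u i ⁻¹' Iic 0 ∩
      lam (-σ) w q ⁻¹' Iic 0) :=
    (((convex_Ici 0).preimage_lid _ _ _).inter ((convex_Iic 0).preimage_lam _ _ _)).inter
      ((convex_Iic 0).preimage_lam _ _ _)
  refine (hconv.segment_subset ?_ ?_).trans fun x hx =>
    ⟨hx.1.1, ⟨i, hi, hx.1.2⟩, ⟨q, by omega, hx.2⟩⟩
  · exact ⟨⟨hF.lid_vertex_nonneg hi.le, (lam_left _ _ _).le⟩, hF.symm.lam_top_nonpos hq hi.le⟩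
  · exact ⟨⟨hF.lid_vertex_nonneg hi, (lam_right _ _ _).le⟩, hF.symm.lam_top_nonpos hq hi⟩

theorem outline_subset_body (hF : Funnel σ u w a b) : outline u w a b ⊆ body σ u w a b := by
  have hconv : Convex ℝ (lid σ (u 0) (w 0) ⁻¹' Ici 0 ∩ lam σ u 0 ⁻¹' Iic 0 ∩
      lam (-σ) w 0 ⁻¹' Iic 0) :=
    (((convex_Ici 0).preimage_lid _ _ _).inter ((convex_Iic 0).preimage_lam _ _ _)).inter
      ((convex_Iic 0).preimage_lam _ _ _)
  refine union_subset (union_subset (iUnion₂_subset fun i hi => hF.segment_subset_body hi)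
    (iUnion₂_subset fun j hj => ?_)) ((hconv.segment_subset ?_ ?_).trans fun x hx =>
      ⟨hx.1.1, ⟨0, hF.left_pos, hx.1.2⟩, ⟨0, hF.right_pos, hx.2⟩⟩)
  · rw [← body_symm]; exact hF.symm.segment_subset_body hj
  · exact ⟨⟨(lid_left _ _ _).ge, (lam_left _ _ _).le⟩, (hF.symm.lam_base_neg hF.right_pos).le⟩
  · exact ⟨⟨(lid_right _ _ _).ge, (hF.lam_base_neg hF.left_pos).le⟩, (lam_left _ _ _).le⟩

theorem base_param_nonneg (hF : Funnel σ u w a b) {t : ℝ} {i : ℕ} (hi : i < a)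
    (h : lam σ u i (u 0 + t • (w 0 - u 0)) ≤ 0) : 0 ≤ t := by
  by_contra! ht
  have h1 := hF.lam_vertex_nonneg hi (Nat.zero_le a)
  have h2 := hF.left_up i hi
  have h3 := lam_sub σ u i (w 0) (u 0)
  rw [cr_swap] at h3
  rw [lam_add_smul, h3] at h
  nlinarith

theorem mem_segment_base (hF : Funnel σ u w a b) {x : Plane} (hx : x ∈ body σ u w a b)
    (h0 : lid σ (u 0) (w 0) x = 0) : x ∈ segment ℝ (u 0) (w 0) := by
  -- to the left of `u 0` on the line of the base, all points are outside the left chain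
  obtain ⟨-, ⟨i, hi, hix⟩, j, hj, hjx⟩ := hx
  obtain ⟨t, rfl⟩ := exists_smul_of_orient_eq_zero hF.base_ne
    ((mul_eq_zero.1 h0).resolve_left hF.sign_ne_zero)
  refine mem_segment_iff_add.2 ⟨t, hF.base_param_nonneg hi hix, ?_, rfl⟩
  have e : u 0 + t • (w 0 - u 0) = w 0 + (1 - t) • (u 0 - w 0) := by module
  rw [e] at hjx
  have := hF.symm.base_param_nonneg hj hjx
  linarith

/-- A point of the body that is strictly on the inner side of no edge of the chain `u` is on that
chain: it is on the line of some edge, and the edges next to it keep it between the endpoints. -/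
theorem mem_segment_chain (hF : Funnel σ u w a b) {x : Plane} (hx : x ∈ body σ u w a b)
    (h0 : ∀ k < a, 0 ≤ lam σ u k x) : ∃ i < a, x ∈ segment ℝ (u i) (u (i + 1)) := by
  obtain ⟨hb, ⟨i, hi, hix⟩, j, hj, hjx⟩ := hx
  have hne : u i ≠ u (i + 1) := by
    intro e
    have := hF.left_up i hi
    rw [e] at this
    simp [cr] at this
  have hz : lam σ u i x = 0 := le_antisymm hix (h0 i hi)
  obtain ⟨t, rfl⟩ := exists_smul_of_orient_eq_zero hne
    ((mul_eq_zero.1 hz).resolve_left hF.sign_ne_zero)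
  refine ⟨i, hi, mem_segment_iff_add.2 ⟨t, ?_, ?_, rfl⟩⟩
  · by_contra! ht
    rcases Nat.eq_zero_or_pos i with rfl | hpos
    · have e0 := lid_sub σ (u 0) (w 0) (u (0 + 1)) (u 0)
      rw [lid_left] at e0
      rw [lid_add_smul, lid_left, e0] at hb
      have := hF.left_up 0 hi
      nlinarith
    · obtain ⟨l, rfl⟩ : ∃ l, i = l + 1 := ⟨i - 1, by omega⟩
      have h1 := h0 l (by omega)
      rw [lam_add_smul, lam_sub, lam_right] at h1
      have := hF.left_turn l hi
      nlinarith
  · by_contra! ht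
    have e : u i + t • (u (i + 1) - u i) = u (i + 1) + (1 - t) • (u i - u (i + 1)) := by module
    rw [e] at hjx h0
    rcases Nat.lt_or_ge (i + 1) a with h1 | h1
    · have h2 := h0 (i + 1) h1
      have h3 := hF.lam_vertex_pos h1 (k := i) hi.le (by omega) (by omega)
      rw [lam_add_smul, lam_left] at h2
      nlinarith
    · have h2 : a = i + 1 := by omega
      rw [lam_add_smul, lam_sub] at hjx
      have h3 := hF.symm.lam_vertex_nonneg hj le_rfl
      rw [← hF.apex_eq, h2] at h3
      have h4 := hF.cross hi hj
      have h5 : -σ * cr (w (j + 1) - w j) (u i - u (i + 1)) =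
          -(σ * cr (u (i + 1) - u i) (w (j + 1) - w j)) := by
        simp only [cr, Prod.fst_sub, Prod.snd_sub]; ring
      rw [h5] at hjx
      nlinarith

theorem isOpen_body_diff (hF : Funnel σ u w a b) : IsOpen (body σ u w a b \ outline u w a b) := by
  have e : body σ u w a b \ outline u w a b =
      ({x | 0 < lid σ (u 0) (w 0) x} ∩ (⋃ i < a, {x | lam σ u i x < 0}) ∩
        (⋃ j < b, {x | lam (-σ) w j x < 0})) \ outline u w a b := by
    apply Subset.antisymm
    · rintro x ⟨hx, hxo⟩
      refine ⟨⟨⟨lt_of_le_of_ne hx.1 fun h0 => hxo (Or.inr (hF.mem_segment_base hx h0.symm)), ?_⟩,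
        ?_⟩, hxo⟩
      · by_contra! hc
        obtain ⟨i, hi, hix⟩ := hF.mem_segment_chain hx fun k hk => by
          by_contra! h1
          exact hc (mem_iUnion₂.2 ⟨k, hk, h1⟩)
        exact hxo (Or.inl (Or.inl (mem_iUnion₂.2 ⟨i, hi, hix⟩)))
      · by_contra! hc
        rw [← body_symm] at hx
        obtain ⟨i, hi, hix⟩ := hF.symm.mem_segment_chain hx fun k hk => by
          by_contra! h1
          exact hc (mem_iUnion₂.2 ⟨k, hk, h1⟩)
        exact hxo (Or.inl (Or.inr (mem_iUnion₂.2 ⟨i, hi, hix⟩)))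
    · rintro x ⟨⟨⟨h1, h2⟩, h3⟩, hxo⟩
      obtain ⟨i, hi, hix⟩ := mem_iUnion₂.1 h2
      obtain ⟨j, hj, hjx⟩ := mem_iUnion₂.1 h3
      exact ⟨⟨le_of_lt h1, ⟨i, hi, le_of_lt hix⟩, ⟨j, hj, le_of_lt hjx⟩⟩, hxo⟩
  rw [e]
  refine IsOpen.sdiff (((isOpen_lt continuous_const (continuous_lid _ _ _)).inter
    (isOpen_biUnion fun i _ => isOpen_lt (continuous_lam _ _ _) continuous_const)).inter
    (isOpen_biUnion fun i _ => isOpen_lt (continuous_lam _ _ _) continuous_const))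
    (isCompact_outline u w a b).isClosed

/-- The outside of a chain is convex, and unbounded in the direction of the base. -/
theorem not_isBounded_outer (hF : Funnel σ u w a b) {x : Plane} (hx : ∀ i < a, 0 < lam σ u i x) :
    ¬ Bornology.IsBounded (connectedComponentIn (outline u w a b)ᶜ x) := by
  set K : Set Plane := ⋂ i, ⋂ _ : i < a, lam σ u i ⁻¹' Ioi 0 with hK
  have hmem : ∀ y, y ∈ K ↔ ∀ i < a, 0 < lam σ u i y := fun y => by
    simp only [hK, mem_iInter, mem_preimage, mem_Ioi]
  have hconv : Convex ℝ K := convex_iInter₂ fun i _ => (convex_Ioi 0).preimage_lam _ _ _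
  have hsub : K ⊆ (outline u w a b)ᶜ := fun y hy hyo => by
    obtain ⟨-, ⟨i, hi, h1⟩, -⟩ := hF.outline_subset_body hyo
    exact absurd ((hmem y).1 hy i hi) h1.not_gt
  have hKc := hconv.isPreconnected.subset_connectedComponentIn ((hmem x).2 hx) hsub
  refine fun hB => not_isBounded_of_ray (x := x) (d := u 0 - w 0) (sub_ne_zero.2 hF.base_ne)
    (fun t ht => (hmem _).2 fun i hi => ?_) (hB.subset hKc)
  have h1 := lam_sub σ u i (x + t • (u 0 - w 0)) x
  have h2 : σ * cr (u (i + 1) - u i) (x + t • (u 0 - w 0) - x) =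
      t * (σ * cr (w 0 - u 0) (u (i + 1) - u i)) := by
    simp only [cr, Prod.fst_sub, Prod.snd_sub, Prod.fst_add, Prod.snd_add, Prod.smul_fst,
      Prod.smul_snd, smul_eq_mul]; ring
  have h3 := mul_nonneg ht (hF.left_up i hi).le
  have := hx i hi
  linarith

theorem outline_symm (u w : ℕ → Plane) (a b : ℕ) : outline w u b a = outline u w a b := by
  unfold outline
  rw [segment_symm, union_comm (⋃ i < b, _)]

/-- The body of a funnel is the region enclosed by its outline: without the outline it is open, and
its complement is the union of three convex unbounded sets (below the base, and outside either
chain). -/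
theorem region_eq_body (hF : Funnel σ u w a b) :
    outline u w a b ∪ {x | x ∉ outline u w a b ∧
      Bornology.IsBounded (connectedComponentIn (outline u w a b)ᶜ x)} = body σ u w a b := by
  apply Subset.antisymm
  · refine union_subset hF.outline_subset_body ?_
    rintro x ⟨hxo, hxb⟩
    by_contra hx
    have h3 : lid σ (u 0) (w 0) x < 0 ∨ (∀ i < a, 0 < lam σ u i x) ∨ ∀ j < b, 0 < lam (-σ) w j x := by
      by_contra! hc
      exact hx hc
    rcases h3 with h | h | h
    · have hsub : lid σ (u 0) (w 0) ⁻¹' Iio 0 ⊆ (outline u w a b)ᶜ := fun y hy hyo =>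
        absurd (hF.outline_subset_body hyo).1 (not_le.2 hy)
      have hKc := ((convex_Iio 0).preimage_lid σ (u 0) (w 0)).isPreconnected.subset_connectedComponentIn
        (x := x) h hsub
      refine not_isBounded_of_ray (x := x) (d := w 0 - u 0) (sub_ne_zero.2 hF.base_ne.symm)
        (fun t ht => ?_) (hxb.subset hKc)
      have h1 := lid_sub σ (u 0) (w 0) (x + t • (w 0 - u 0)) x
      have h2 : σ * cr (w 0 - u 0) (x + t • (w 0 - u 0) - x) = 0 := by
        simp only [cr, Prod.fst_sub, Prod.snd_sub, Prod.fst_add, Prod.snd_add, Prod.smul_fst,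
          Prod.smul_snd, smul_eq_mul]; ring
      change lid σ (u 0) (w 0) (x + t • (w 0 - u 0)) < 0
      linarith
    · exact hF.not_isBounded_outer h hxb
    · rw [← outline_symm] at hxb
      exact hF.symm.not_isBounded_outer h hxb
  · intro x hx
    by_cases hxo : x ∈ outline u w a b
    · exact Or.inl hxo
    right
    refine ⟨hxo, hF.isCompact_body.isBounded.subset ?_⟩
    refine (IsPreconnected.subset_left_of_subset_union hF.isOpen_body_diff
      hF.isCompact_body.isClosed.isOpen_compl ?_ ?_ ⟨x, mem_connectedComponentIn hxo, hx, hxo⟩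
      isPreconnected_connectedComponentIn).trans sdiff_subset
    · exact disjoint_compl_right.mono_left sdiff_subset
    · intro y hy
      by_cases hyb : y ∈ body σ u w a b
      · exact Or.inl ⟨hyb, connectedComponentIn_subset _ _ hy⟩
      · exact Or.inr hyb

end Funnel

theorem boundary_eq_outline {n t : ℕ} (hn : 0 < n) (P : Polygon Plane n) (htn : t + 1 < n) :
    P.boundary ℝ =
      Funnel.outline (cyc hn P) (fun j => cyc hn P (n - 1 - j)) t (n - 1 - t) := by
  rw [boundary_eq hn P]
  ext x
  simp only [Funnel.outline, mem_union, mem_iUnion, exists_prop]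
  have h0 : cyc hn P n = cyc hn P 0 := by
    have := (cyclic_cyc hn P).2 0
    rwa [Nat.zero_add] at this
  constructor
  · rintro ⟨i, hi, hx⟩
    rcases Nat.lt_or_ge i t with h1 | h1
    · exact Or.inl (Or.inl ⟨i, h1, hx⟩)
    rcases Nat.lt_or_ge (i + 1) n with h2 | h2
    · refine Or.inl (Or.inr ⟨n - 2 - i, by omega, ?_⟩)
      rwa [show n - 1 - (n - 2 - i) = i + 1 by omega, show n - 1 - (n - 2 - i + 1) = i by omega,
        segment_symm]
    · right
      rw [show i + 1 = n by omega, h0, show i = n - 1 by omega] at hx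
      rwa [segment_symm, Nat.sub_zero]
  · rintro ((⟨i, hi, hx⟩ | ⟨j, hj, hx⟩) | hx)
    · exact ⟨i, by omega, hx⟩
    · refine ⟨n - 2 - j, by omega, ?_⟩
      rwa [segment_symm, show n - 2 - j + 1 = n - 1 - j by omega,
        show n - 2 - j = n - 1 - (j + 1) by omega]
    · refine ⟨n - 1, by omega, ?_⟩
      rwa [show n - 1 + 1 = n by omega, h0, segment_symm, ← Nat.sub_zero (n - 1)]

/-! ### Hidden sets and convex covers -/

/-- A convex piece contains at most one point of a hidden set. -/
theorem encard_le_of_isHiddenSet {R H : Set Plane} {C : Set (Set Plane)} (hH : IsHiddenSet R H)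
    (hC : IsConvexCover R C) : H.encard ≤ C.encard := by
  have hex : ∀ p : Plane, ∃ K : Set Plane, p ∈ H → K ∈ C ∧ p ∈ K := by
    intro p
    by_cases hp : p ∈ H
    · have := hH.1 hp
      rw [← hC.2] at this
      obtain ⟨K, h1, h2⟩ := this
      exact ⟨K, fun _ => ⟨h1, h2⟩⟩
    · exact ⟨∅, fun h => absurd h hp⟩
  choose f hf using hex
  refine encard_le_encard_of_injOn (f := f) (fun p hp => (hf p hp).1) ?_
  intro p hp q hq e
  by_contra hne
  refine hH.2 p hp q hq hne ?_
  obtain ⟨-, S, -, hS⟩ := hC.1 _ (hf p hp).1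
  have hconv : Convex ℝ (f p) := by rw [hS]; exact convex_convexHull ℝ S
  refine (hconv.segment_subset (hf p hp).2 (by rw [e]; exact (hf q hq).2)).trans ?_
  rw [← hC.2]
  exact subset_sUnion_of_mem (hf p hp).1

theorem hiddenSetNumber_eq {R : Set Plane} {H : Finset Plane} {C : Finset (Set Plane)}
    (hH : IsHiddenSet R H) (hC : IsConvexCover R C) (h : H.card = C.card) :
    hiddenSetNumber R = H.card := by
  apply le_antisymm
  · refine iSup₂_le fun H' hH' => ?_
    have := encard_le_of_isHiddenSet hH' hC
    rwa [encard_coe_eq_coe_finsetCard, ← h] at this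
  · rw [← encard_coe_eq_coe_finsetCard]
    exact le_iSup₂_of_le (H : Set Plane) hH le_rfl

theorem convexCoverNumber_eq {R : Set Plane} {H : Finset Plane} {C : Finset (Set Plane)}
    (hH : IsHiddenSet R H) (hC : IsConvexCover R C) (h : H.card = C.card) :
    convexCoverNumber R = C.card := by
  apply le_antisymm
  · rw [← encard_coe_eq_coe_finsetCard]
    exact iInf₂_le_of_le (C : Set (Set Plane)) hC le_rfl
  · refine le_iInf₂ fun C' hC' => ?_
    have := encard_le_of_isHiddenSet hH hC'
    rwa [encard_coe_eq_coe_finsetCard, h] at this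

/-! ### The hidden set of a funnel -/

/-- The point of the segment from `p` to `q` in which an affine function `g` with `0 < g p` and
`g q < g p` takes the value `g p ^ 2 / (2 * g p - g q)`, which is positive. -/
noncomputable def pick (g : Plane → ℝ) (p q : Plane) : Plane :=
  p + (g p / (g p + (g p - g q))) • (q - p)

theorem pick_spec {σ : ℝ} {c d p q : Plane} (hp : 0 < lid σ c d p)
    (hq : lid σ c d q < lid σ c d p) :
    pick (lid σ c d) p q ∈ openSegment ℝ p q ∧ 0 < lid σ c d (pick (lid σ c d) p q) := by
  have hD : 0 < lid σ c d p + (lid σ c d p - lid σ c d q) := by linarith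
  refine ⟨mem_openSegment_iff_add.2 ⟨_, div_pos hp hD, (div_lt_one hD).2 (by linarith), rfl⟩, ?_⟩
  rw [pick, lid_add_smul]
  have e : lid σ c d p + lid σ c d p / (lid σ c d p + (lid σ c d p - lid σ c d q)) *
      (lid σ c d q - lid σ c d p) =
      lid σ c d p * lid σ c d p / (lid σ c d p + (lid σ c d p - lid σ c d q)) := by
    field_simp; ring
  rw [e]
  positivity

theorem Convex.mem_of_mem_openSegment {S : Set Plane} (hS : Convex ℝ S) {p q x : Plane} (hp : p ∈ S)
    (hq : q ∈ S) (hx : x ∈ openSegment ℝ p q) : x ∈ S :=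
  hS.segment_subset hp hq (openSegment_subset_segment ℝ p q hx)

theorem lid_pos_of_mem_openSegment {σ : ℝ} {c d p q x : Plane} (hp : 0 ≤ lid σ c d p)
    (hq : 0 ≤ lid σ c d q) (hpq : 0 < lid σ c d p ∨ 0 < lid σ c d q) (hx : x ∈ openSegment ℝ p q) :
    0 < lid σ c d x := by
  obtain ⟨t, h0, h1, rfl⟩ := mem_openSegment_iff_add.1 hx
  rw [lid_add_smul]
  rcases hpq with h | h <;> nlinarith

namespace Funnel

variable {σ : ℝ} {u w : ℕ → Plane} {a b : ℕ}

/-- A point in the relative interior of an edge of a chain does not see the points on the outer side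
of that edge: close to it, such a line of sight is on the outer side of the whole chain. -/
theorem not_sees (hF : Funnel σ u w a b) {i : ℕ} (hi : i < a) {p q : Plane}
    (hp : p ∈ openSegment ℝ (u i) (u (i + 1))) (hq : 0 < lam σ u i q) :
    ¬ Sees (body σ u w a b) p q := by
  intro hs
  have hpk : ∀ k < a, k ≠ i → 0 < lam σ u k p := by
    intro k hk hne
    refine lid_pos_of_mem_openSegment (hF.lam_vertex_nonneg hk hi.le)
      (hF.lam_vertex_nonneg hk hi) ?_ hp
    by_cases h1 : i = k + 1
    · exact Or.inr (hF.lam_vertex_pos hk hi (by omega) (by omega))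
    · exact Or.inl (hF.lam_vertex_pos hk hi.le (by omega) h1)
  have hpi : lam σ u i p = 0 := by
    rw [lam, orient_eq_zero_of_mem_segment (openSegment_subset_segment ℝ _ _ hp), mul_zero]
  have hev : ∀ k ∈ Iio a, ∀ᶠ t : ℝ in 𝓝[>] 0, 0 < lam σ u k (p + t • (q - p)) := by
    intro k hk
    by_cases hki : k = i
    · filter_upwards [self_mem_nhdsWithin] with t ht
      rw [hki, lam_add_smul, hpi, zero_add, sub_zero]
      exact mul_pos ht hq
    · have hc : Continuous fun t : ℝ => lam σ u k (p + t • (q - p)) :=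
        (continuous_lam σ u k).comp (by fun_prop)
      have h0 : 0 < lam σ u k (p + (0 : ℝ) • (q - p)) := by
        rw [zero_smul, add_zero]; exact hpk k hk hki
      exact (hc.continuousAt.eventually (lt_mem_nhds h0)).filter_mono nhdsWithin_le_nhds
  have h1 : ∀ᶠ t : ℝ in 𝓝[>] 0, t < 1 :=
    (eventually_lt_nhds zero_lt_one).filter_mono nhdsWithin_le_nhds
  obtain ⟨t, ⟨ht, ht1⟩, ht0⟩ :=
    ((((finite_Iio a).eventually_all.2 hev).and h1).and self_mem_nhdsWithin).exists
  obtain ⟨-, ⟨k, hk, hkx⟩, -⟩ := hs (mem_segment_iff_add.2 ⟨t, le_of_lt ht0, ht1.le, rfl⟩)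
  exact absurd (ht k hk) hkx.not_gt

/-- The choice of a point on the boundary of each piece of a peeling. The side `sd s` is `true`
if the point `pt s` is on the left chain. A piece with edges on both chains follows the piece below
it. The function `gL s` is the position with respect to the edge of the last point on the
left chain at or below the level `s`, or to the base if there is no such point; `gR s` is the same
for the right chain. -/
structure Selection (σ : ℝ) (u w : ℕ → Plane) (i j : ℕ → ℕ) (m : ℕ) (sd : ℕ → Bool)
    (gL gR : ℕ → Plane → ℝ) (pt : ℕ → Plane) : Prop where
  side_left : ∀ s < m, j (s + 1) = j s → sd s = true
  side_right : ∀ s < m, i (s + 1) = i s → sd s = false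
  side_both : ∀ s, s + 1 < m → i (s + 1) ≠ i s → j (s + 1) ≠ j s → sd s = sd (s + 1)
  left_base : gL m = lid σ (u 0) (w 0)
  right_base : gR m = lid σ (u 0) (w 0)
  left_of_left : ∀ s < m, sd s = true → gL s = lam σ u (i (s + 1))
  left_of_right : ∀ s < m, sd s = false → gL s = gL (s + 1)
  right_of_left : ∀ s < m, sd s = true → gR s = gR (s + 1)
  right_of_right : ∀ s < m, sd s = false → gR s = lam (-σ) w (j (s + 1))
  point_left : ∀ s < m, sd s = true → pt s = pick (gR s) (u (i s)) (u (i (s + 1)))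
  point_right : ∀ s < m, sd s = false → pt s = pick (gL s) (w (j s)) (w (j (s + 1)))

namespace Selection

variable {i j : ℕ → ℕ} {m : ℕ} {sd : ℕ → Bool} {gL gR : ℕ → Plane → ℝ} {pt : ℕ → Plane}

theorem symm (hS : Selection σ u w i j m sd gL gR pt) :
    Selection (-σ) w u j i m (fun s => !sd s) gR gL pt where
  side_left s hs h := by simp [hS.side_right s hs h]
  side_right s hs h := by simp [hS.side_left s hs h]
  side_both s hs h h' := by simp [hS.side_both s hs h' h]
  left_base := by rw [hS.right_base]; ext x; rw [lid_symm]
  right_base := by rw [hS.left_base]; ext x; rw [lid_symm]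
  left_of_left s hs h := hS.right_of_right s hs (by simpa using h)
  left_of_right s hs h := hS.right_of_left s hs (by simpa using h)
  right_of_left s hs h := hS.left_of_right s hs (by simpa using h)
  right_of_right s hs h := by rw [neg_neg]; exact hS.left_of_left s hs (by simpa using h)
  point_left s hs h := hS.point_right s hs (by simpa using h)
  point_right s hs h := hS.point_left s hs (by simpa using h)

theorem step_of_left (hS : Selection σ u w i j m sd gL gR pt) (hP : Peeling σ u w a b i j m) {s : ℕ}
    (hs : s < m) (h : sd s = true) : i s = i (s + 1) + 1 := by
  have h1 := (hP.peel s hs).lt_add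
  have h2 : i (s + 1) ≠ i s := fun e => by
    have := hS.side_right s hs e
    rw [h] at this
    exact absurd this (by simp)
  omega

theorem step_of_right (hS : Selection σ u w i j m sd gL gR pt) (hP : Peeling σ u w a b i j m)
    {s : ℕ} (hs : s < m) (h : sd s = false) : j s = j (s + 1) + 1 :=
  hS.symm.step_of_left hP.symm hs (by simp [h])

theorem right_eq (hS : Selection σ u w i j m sd gL gR pt) {s : ℕ} (hs : s ≤ m) :
    (∃ r, s ≤ r ∧ r < m ∧ sd r = false ∧ (∀ q, s ≤ q → q < r → sd q = true) ∧
      gR s = lam (-σ) w (j (r + 1))) ∨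
      ((∀ r, s ≤ r → r < m → sd r = true) ∧ gR s = lid σ (u 0) (w 0)) := by
  induction hs using Nat.decreasingInduction with
  | self => exact Or.inr ⟨fun r h1 h2 => by omega, hS.right_base⟩
  | of_succ s hs ih =>
    cases h : sd s with
    | false =>
      exact Or.inl ⟨s, le_rfl, hs, h, fun q h1 h2 => by omega, hS.right_of_right s hs h⟩
    | true =>
      have hext : ∀ q, s ≤ q → (s + 1 ≤ q → sd q = true) → sd q = true := fun q h1 h2 => by
        rcases h1.eq_or_lt with rfl | h1
        · exact h
        · exact h2 h1
      rw [hS.right_of_left s hs h]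
      rcases ih with ⟨r, h1, h2, h3, h4, h5⟩ | ⟨h1, h2⟩
      · exact Or.inl ⟨r, by omega, h2, h3,
          fun q h6 h7 => hext q h6 fun h8 => h4 q h8 h7, h5⟩
      · exact Or.inr ⟨fun r h6 h7 => hext r h6 fun h8 => h1 r h8 h7, h2⟩

/-- Below a run of points on the left chain, the edge of the first point on the right chain has the
top of the run on its outer side: the piece just above that point has an edge on the left chain
only, and such an edge is peeled off alone because it hides above the right edge below it. -/
theorem lam_pos_top (hS : Selection σ u w i j m sd gL gR pt) (hF : Funnel σ u w a b)
    (hP : Peeling σ u w a b i j m) {s r : ℕ} (hsr : s < r) (hr : r < m) (hsd : sd r = false)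
    (hrun : ∀ q, s ≤ q → q < r → sd q = true) : 0 < lam (-σ) w (j (r + 1)) (u (i s)) := by
  obtain ⟨q, rfl⟩ : ∃ q, r = q + 1 := ⟨r - 1, by omega⟩
  have hq := hrun q (by omega) (by omega)
  have hstep := hS.step_of_left hP (s := q) (by omega) hq
  have hj := hS.step_of_right hP hr hsd
  have hjb : j (q + 1 + 1) < b := (hP.inner hF (Nat.succ_pos _) hr).2.1
  have hpos : 0 < lam (-σ) w (j (q + 1 + 1)) (u (i q)) := by
    rcases hP.peel q (by omega) with h | h | h
    · obtain ⟨-, h1, -, h2 | ⟨k, h2, h3⟩⟩ := h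
      · omega
      · obtain rfl : k = j (q + 1 + 1) := by omega
        exact h3
    · have := h.2.1
      omega
    · have h1 := h.2.1
      have := hS.side_both q hr (by omega) (by omega)
      rw [hq, hsd] at this
      exact absurd this (by simp)
  exact hpos.trans_le (hF.symm.lam_le_lam hjb (hP.left_anti (by omega) (by omega))
    (hP.left_le (by omega)))

theorem point_spec (hS : Selection σ u w i j m sd gL gR pt) (hF : Funnel σ u w a b)
    (hP : Peeling σ u w a b i j m) {s : ℕ} (hs : s < m) (hsd : sd s = true) :
    pt s ∈ openSegment ℝ (u (i (s + 1))) (u (i (s + 1) + 1)) ∧ 0 < gR s (pt s) := by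
  have hstep := hS.step_of_left hP hs hsd
  have hia := hP.left_le hs.le
  rw [hS.point_left s hs hsd, openSegment_symm, ← hstep]
  rcases hS.right_eq hs.le with ⟨r, h1, h2, h3, h4, h5⟩ | ⟨-, h5⟩
  · have hsr : s < r := by
      rcases h1.eq_or_lt with rfl | h1
      · rw [hsd] at h3; exact absurd h3 (by simp)
      · exact h1
    have hjb : j (r + 1) < b := (hP.inner hF (Nat.succ_pos _) h2).2.1
    rw [h5]
    exact pick_spec (hS.lam_pos_top hF hP hsr h2 h3 h4)
      (hF.symm.lam_lt_lam hjb (by omega) hia)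
  · rw [h5]
    have h6 := hF.lid_vertex_lt (i := i (s + 1)) (k := i s) (by omega) hia
    exact pick_spec ((hF.lid_vertex_nonneg (by omega)).trans_lt h6) h6

/-- A point on the left chain hides above the edges of all lower points on the right chain: it does
so for the first of these edges, and the edges that see it are consecutive up to the top. -/
theorem lam_point_pos (hS : Selection σ u w i j m sd gL gR pt) (hF : Funnel σ u w a b)
    (hP : Peeling σ u w a b i j m) {s r : ℕ} (hsr : s < r) (hr : r < m) (hsd : sd s = true)
    (hsd' : sd r = false) : 0 < lam (-σ) w (j (r + 1)) (pt s) := by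
  obtain ⟨h1, h2⟩ := hS.point_spec hF hP (hsr.trans hr) hsd
  rcases hS.right_eq (hsr.trans hr).le with ⟨q, h3, h4, h5, h6, h7⟩ | ⟨h3, -⟩
  · have hqr : q ≤ r := by
      by_contra! h8
      have := h6 r hsr.le h8
      rw [hsd'] at this
      exact absurd this (by simp)
    rw [h7] at h2
    by_contra! hc
    obtain ⟨p, hp⟩ : ∃ p, p + 1 = b := ⟨b - 1, by have := hF.right_pos; omega⟩
    have hia : i (s + 1) < a := (hP.inner hF (Nat.succ_pos _) (hsr.trans hr)).1
    have htop : lam (-σ) w p (pt s) ≤ 0 :=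
      ((convex_Iic 0).preimage_lam (-σ) w p).mem_of_mem_openSegment
        (hF.symm.lam_top_nonpos hp hia.le) (hF.symm.lam_top_nonpos hp hia) h1
    have := hF.symm.lam_nonpos_of_le hp htop (hP.symm.left_anti (s := q + 1) (r := r + 1)
      (by omega) (by omega)) (hP.inner hF (Nat.succ_pos _) h4).2.1 hc
    exact absurd h2 this.not_gt
  · have := h3 r hsr.le hr
    rw [hsd'] at this
    exact absurd this (by simp)

theorem not_sees_of_left (hS : Selection σ u w i j m sd gL gR pt) (hF : Funnel σ u w a b)
    (hP : Peeling σ u w a b i j m) {s r : ℕ} (hsr : s < r) (hr : r < m) (hsd : sd s = true) :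
    ¬ Sees (body σ u w a b) (pt s) (pt r) := by
  obtain ⟨h1, -⟩ := hS.point_spec hF hP (hsr.trans hr) hsd
  have hia : i (s + 1) < a := (hP.inner hF (Nat.succ_pos _) (hsr.trans hr)).1
  cases hsd' : sd r with
  | true =>
    obtain ⟨h2, -⟩ := hS.point_spec hF hP hr hsd'
    have h3 := hS.step_of_left hP hr hsd'
    have h4 := hP.left_anti (s := s + 1) (r := r) hsr hr.le
    refine hF.not_sees hia h1 (lid_pos_of_mem_openSegment (hF.lam_vertex_nonneg hia (by omega))
      (hF.lam_vertex_nonneg hia (by omega)) (Or.inl ?_) h2)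
    exact hF.lam_vertex_pos hia (by omega) (by omega) (by omega)
  | false =>
    obtain ⟨h2, -⟩ := hS.symm.point_spec hF.symm hP.symm hr (by simp [hsd'])
    have hjb : j (r + 1) < b := (hP.inner hF (Nat.succ_pos _) hr).2.1
    have h3 := hF.symm.not_sees hjb h2 (hS.lam_point_pos hF hP hsr hr hsd hsd')
    rw [body_symm, Sees, segment_symm] at h3
    exact h3

theorem not_sees (hS : Selection σ u w i j m sd gL gR pt) (hF : Funnel σ u w a b)
    (hP : Peeling σ u w a b i j m) {s r : ℕ} (hsr : s < r) (hr : r < m) :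
    ¬ Sees (body σ u w a b) (pt s) (pt r) := by
  cases hsd : sd s with
  | true => exact hS.not_sees_of_left hF hP hsr hr hsd
  | false =>
    have := hS.symm.not_sees_of_left hF.symm hP.symm hsr hr (by simp [hsd])
    rwa [body_symm] at this

theorem point_mem_outline (hS : Selection σ u w i j m sd gL gR pt) (hF : Funnel σ u w a b)
    (hP : Peeling σ u w a b i j m) {s : ℕ} (hs : s < m) : pt s ∈ outline u w a b := by
  obtain ⟨h1, h2, -⟩ := hP.inner hF (Nat.succ_pos s) hs
  left
  cases hsd : sd s with
  | true =>
    exact Or.inl (mem_iUnion₂.2 ⟨_, h1,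
      openSegment_subset_segment ℝ _ _ (hS.point_spec hF hP hs hsd).1⟩)
  | false =>
    exact Or.inr (mem_iUnion₂.2 ⟨_, h2, openSegment_subset_segment ℝ _ _
      (hS.symm.point_spec hF.symm hP.symm hs (by simp [hsd])).1⟩)

theorem injOn (hS : Selection σ u w i j m sd gL gR pt) (hF : Funnel σ u w a b)
    (hP : Peeling σ u w a b i j m) : InjOn pt (Iio m) := by
  have key : ∀ s r, s < r → r < m → pt s ≠ pt r := by
    intro s r hsr hr e
    refine hS.not_sees hF hP hsr hr ?_
    rw [Sees, e, segment_same, singleton_subset_iff]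
    exact hF.outline_subset_body (hS.point_mem_outline hF hP hr)
  intro s hs r hr e
  rcases lt_trichotomy s r with h | h | h
  · exact absurd e (key s r h hr)
  · exact h
  · exact absurd e.symm (key r s h hs)

theorem isHiddenSet (hS : Selection σ u w i j m sd gL gR pt) (hF : Funnel σ u w a b)
    (hP : Peeling σ u w a b i j m) : IsHiddenSet (body σ u w a b) (pt '' Iio m) := by
  refine ⟨?_, ?_⟩
  · rintro _ ⟨s, hs, rfl⟩
    exact hF.outline_subset_body (hS.point_mem_outline hF hP hs)
  · rintro _ ⟨s, hs, rfl⟩ _ ⟨r, hr, rfl⟩ hne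
    rcases lt_trichotomy s r with h | rfl | h
    · exact hS.not_sees hF hP h hr
    · exact absurd rfl hne
    · rw [Sees, segment_symm]
      exact hS.not_sees hF hP h hs

end Selection

theorem Peeling.isConvexDecomposition {i j : ℕ → ℕ} {m : ℕ} (hP : Peeling σ u w a b i j m)
    (hF : Funnel σ u w a b) : IsConvexDecomposition (body σ u w a b)
      ((fun s => piece u w (i s) (j s) (i (s + 1)) (j (s + 1))) '' Iio m) := by
  refine ⟨⟨?_, ?_⟩, ?_⟩
  · rintro _ ⟨s, hs, rfl⟩
    exact ⟨(hP.peel s hs).interior_nonempty hF (hP.valid hF (le_of_lt hs)), _, toFinite _, rfl⟩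
  · rw [sUnion_image]
    exact hP.iUnion_piece hF
  · rintro _ ⟨s, hs, rfl⟩ _ ⟨r, hr, rfl⟩ hne
    rcases lt_trichotomy s r with h | rfl | h
    · exact hP.disjoint_piece hF h hr
    · exact absurd rfl hne
    · exact (hP.disjoint_piece hF h hs).symm

theorem Peeling.injOn_piece {i j : ℕ → ℕ} {m : ℕ} (hP : Peeling σ u w a b i j m)
    (hF : Funnel σ u w a b) :
    InjOn (fun s => piece u w (i s) (j s) (i (s + 1)) (j (s + 1))) (Iio m) := by
  intro s hs r hr e
  rcases lt_trichotomy s r with h | h | h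
  · exact absurd e (hP.piece_ne hF h hr)
  · exact h
  · exact absurd e.symm (hP.piece_ne hF h hs)

/-- The vertices of a piece are in clockwise order. -/
theorem Peel.orient_nonpos (hF : Funnel 1 u w a b) {i j i' j' : ℕ} (hV : Valid 1 u w a b i j)
    (h : Peel 1 u w i j i' j') : orient (u i') (u i) (w j) ≤ 0 ∧ orient (u i') (u i) (w j') ≤ 0 ∧
      orient (u i') (w j) (w j') ≤ 0 ∧ orient (u i) (w j) (w j') ≤ 0 := by
  have key : ∀ {σ : ℝ} {u w : ℕ → Plane} {a b i j i' j' : ℕ}, Funnel σ u w a b →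
      Valid σ u w a b i j → Peel σ u w i j i' j' →
      σ * orient (u i') (u i) (w j) ≤ 0 ∧ σ * orient (u i') (u i) (w j') ≤ 0 := by
    intro σ u w a b i j i' j' hF hV h
    have h1 := h.lt_add
    obtain ⟨h2, h3, h4, h5⟩ := h.valid hF hV
    rcases Nat.lt_or_ge i' i with h6 | h6
    · obtain rfl : i = i' + 1 := by omega
      exact ⟨(h.inner hF hV).2, h4⟩
    · obtain rfl : i = i' := by omega
      simp [orient]
  obtain ⟨h1, h2⟩ := key hF hV h
  obtain ⟨h3, h4⟩ := key hF.symm hV.symm h.symm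
  have e1 : orient (w j') (w j) (u i) = -orient (u i) (w j) (w j') := by
    simp only [orient]; ring
  have e2 : orient (w j') (w j) (u i') = -orient (u i') (w j) (w j') := by
    simp only [orient]; ring
  rw [e1] at h3
  rw [e2] at h4
  exact ⟨by linarith, by linarith, by linarith, by linarith⟩

end Funnel

/-! ### Running programs of the real RAM -/

namespace RealRAM

/-- A sequence of programs, to be run one after the other. -/
def block : List Program → Program
  | [] => .skip
  | p :: l => .seq p (block l)

/-- The number of steps that suffices for a run of a program without loops. -/
def Program.bound : Program → ℕ
  | .skip => 1
  | .setNat _ e => e.cost + 1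
  | .setReal _ e => e.cost + 1
  | .putNat _ i e => i.cost + e.cost + 1
  | .putReal _ i e => i.cost + e.cost + 1
  | .seq p q => p.bound + q.bound
  | .branch b p q => b.cost + (p.bound + q.bound) + 1
  | .loop _ _ => 0

/-- The weakest precondition for a program without loops to end in a state with the property `Q`. -/
def wp : Program → (State → Prop) → State → Prop
  | .skip, Q, s => Q s
  | .setNat x e, Q, s => Q { s with natVar := Function.update s.natVar x (e.eval s) }
  | .setReal x e, Q, s => Q { s with realVar := Function.update s.realVar x (e.eval s) }
  | .putNat a i e, Q, s =>
      Q { s with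
          natArr := Function.update s.natArr a
            (Function.update (s.natArr a) (i.eval s) (e.eval s)) }
  | .putReal a i e, Q, s =>
      Q { s with
          realArr := Function.update s.realArr a
            (Function.update (s.realArr a) (i.eval s) (e.eval s)) }
  | .seq p q, Q, s => wp p (wp q Q) s
  | .branch b p q, Q, s => (b.Holds s → wp p Q s) ∧ (¬ b.Holds s → wp q Q s)
  | .loop _ _, _, _ => False

theorem wp_mono {p : Program} {Q Q' : State → Prop} (h : ∀ s, Q s → Q' s) {s : State}
    (hp : wp p Q s) : wp p Q' s := by
  induction p generalizing Q Q' s with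
  | seq p q ihp ihq => exact ihp (fun s => ihq h) hp
  | branch b p q ihp ihq => exact ⟨fun hb => ihp h (hp.1 hb), fun hb => ihq h (hp.2 hb)⟩
  | loop b p => exact hp
  | _ => exact h _ hp

/-- Started in `s`, the program halts after at most `c` steps in a state with the property `Q`. -/
def Halts (p : Program) (s : State) (c : ℕ) (Q : State → Prop) : Prop :=
  ∃ s' k, Exec p s s' k ∧ k ≤ c ∧ Q s'

theorem halts_of_wp {p : Program} {Q : State → Prop} {s : State} (h : wp p Q s) :
    Halts p s p.bound Q := by
  induction p generalizing Q s with
  | skip => exact ⟨_, _, .skip s, le_rfl, h⟩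
  | setNat x e => exact ⟨_, _, .setNat s x e, le_rfl, h⟩
  | setReal x e => exact ⟨_, _, .setReal s x e, le_rfl, h⟩
  | putNat a i e => exact ⟨_, _, .putNat s a i e, le_rfl, h⟩
  | putReal a i e => exact ⟨_, _, .putReal s a i e, le_rfl, h⟩
  | seq p q ihp ihq =>
    obtain ⟨s', k, h1, h2, h3⟩ := ihp h
    obtain ⟨s'', l, h4, h5, h6⟩ := ihq h3
    exact ⟨s'', _, .seq h1 h4, Nat.add_le_add h2 h5, h6⟩
  | branch b p q ihp ihq =>
    by_cases hb : b.Holds s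
    · obtain ⟨s', k, h1, h2, h3⟩ := ihp (h.1 hb)
      exact ⟨s', _, .branch_true hb h1, by simp only [Program.bound]; omega, h3⟩
    · obtain ⟨s', k, h1, h2, h3⟩ := ihq (h.2 hb)
      exact ⟨s', _, .branch_false hb h1, by simp only [Program.bound]; omega, h3⟩
  | loop b p => exact h.elim

theorem Halts.seq {p q : Program} {s : State} {c d : ℕ} {R Q : State → Prop} (hp : Halts p s c R)
    (hq : ∀ s', R s' → Halts q s' d Q) : Halts (.seq p q) s (c + d) Q := by
  obtain ⟨s', k, h1, h2, h3⟩ := hp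
  obtain ⟨s'', l, h4, h5, h6⟩ := hq s' h3
  exact ⟨s'', _, .seq h1 h4, Nat.add_le_add h2 h5, h6⟩

/-- A loop with an invariant `I` that bounds the number of rounds left. -/
theorem Halts.loop {b : Test} {p : Program} (I : ℕ → State → Prop)
    (hI : ∀ q s, I q s → b.Holds s → wp p (fun s' => ∃ q' < q, I q' s') s) {q : ℕ} {s : State}
    (h : I q s) :
    Halts (.loop b p) s ((q + 1) * (b.cost + p.bound + 1))
      (fun s' => ¬ b.Holds s' ∧ ∃ q', I q' s') := by
  induction q using Nat.strong_induction_on generalizing s with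
  | _ q ih =>
    by_cases hb : b.Holds s
    · obtain ⟨s', k, h1, h2, q', hq', h3⟩ := halts_of_wp (hI q s h hb)
      obtain ⟨s'', l, h4, h5, h6⟩ := ih q' hq' h3
      refine ⟨s'', _, .loop_true hb h1 h4, ?_, h6⟩
      have : (q' + 1 + 1) * (b.cost + p.bound + 1) ≤ (q + 1) * (b.cost + p.bound + 1) :=
        Nat.mul_le_mul_right _ (by omega)
      rw [Nat.succ_mul] at this
      omega
    · refine ⟨s, _, .loop_false hb, ?_, hb, q, h⟩
      have : 1 * (b.cost + p.bound + 1) ≤ (q + 1) * (b.cost + p.bound + 1) :=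
        Nat.mul_le_mul_right _ (by omega)
      omega

/-! ### Geometric expressions -/

/-- The value of a pair of real expressions. -/
noncomputable def evalPoint (s : State) (p : RealExpr × RealExpr) : Plane := (p.1.eval s, p.2.eval s)

/-- The input vertex with a given index. -/
def vertex (e : NatExpr) : RealExpr × RealExpr := (.get 0 e, .get 1 e)

/-- The expression for the orientation test. -/
def orientExpr (p q r : RealExpr × RealExpr) : RealExpr :=
  .sub (.mul (.sub q.1 p.1) (.sub r.2 p.2)) (.mul (.sub q.2 p.2) (.sub r.1 p.1))

theorem eval_orientExpr (s : State) (p q r : RealExpr × RealExpr) :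
    (orientExpr p q r).eval s = orient (evalPoint s p) (evalPoint s q) (evalPoint s r) := rfl

/-- The expression for the point `pick (orient A B) p q`. -/
def pickExpr (A B p q : RealExpr × RealExpr) : RealExpr × RealExpr :=
  let r := RealExpr.div (orientExpr A B p)
    (.add (orientExpr A B p) (.sub (orientExpr A B p) (orientExpr A B q)))
  (.add p.1 (.mul r (.sub q.1 p.1)), .add p.2 (.mul r (.sub q.2 p.2)))

theorem evalPoint_pickExpr (s : State) (A B p q : RealExpr × RealExpr) :
    evalPoint s (pickExpr A B p q) =
      pick (orient (evalPoint s A) (evalPoint s B)) (evalPoint s p) (evalPoint s q) := rfl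

/-- The input is still in the memory. -/
structure HasInput {n : ℕ} (P : Polygon Plane n) (s : State) : Prop where
  size : s.natVar 0 = n
  fst : s.realArr 0 = (inputState P).realArr 0
  snd : s.realArr 1 = (inputState P).realArr 1

theorem HasInput.evalPoint_vertex {n : ℕ} {P : Polygon Plane n} {s : State} (h : HasInput P s)
    (hn : 0 < n) {e : NatExpr} (he : e.eval s < n) :
    evalPoint s (vertex e) = cyc hn P (e.eval s) := by
  have h1 := cyc_val hn P ⟨e.eval s, he⟩
  simp only at h1
  rw [h1]
  simp only [evalPoint, vertex, RealExpr.eval, h.fst, h.snd, inputState, he, dif_pos, if_true,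
    one_ne_zero, if_false]

end RealRAM

/-! ### The linear-time algorithm: the programs

The integer registers are used as follows: `0` for the number of vertices, `1` and `2` for the
numbers of points and pieces, `3` for the index of the apex, `4` and `5` for the current chord and
`7` and `8` for the next one, `6` for the current level on the way back up, `9` for the side of the
last point, `10` and `11` for the edge of the last point on the left chain, `12` and `13` for that on
the right chain. The integer arrays `1` and `2` record the chords. -/

namespace RealRAM

/-- The index in the polygon of a vertex of the right chain, given its number on that chain. -/
def rightIndex (e : NatExpr) : NatExpr := .sub (.sub (.var 0) (.const 1)) e

/-- Stores a point in the arrays `a` and `b`. -/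
def putPoint (a b : ℕ) (i : NatExpr) (p : RealExpr × RealExpr) : Program :=
  .seq (.putReal a i p.1) (.putReal b i p.2)

/-- Tests whether there is no right turn at the candidate for the apex. -/
def apexTest : Test :=
  .realLe (.const 0) (orientExpr (vertex (.sub (.var 3) (.const 1))) (vertex (.var 3))
    (vertex (.add (.var 3) (.const 1))))

def apexStep : Program := .setNat 3 (.add (.var 3) (.const 1))

/-- Computes `Funnel.next`. -/
def chooseChord : Program :=
  .branch (.neg (.realLe (.const 0) (orientExpr (vertex (rightIndex (.sub (.var 5) (.const 1))))
      (vertex (rightIndex (.var 5))) (vertex (.var 4)))))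
    (.seq (.setNat 7 (.sub (.var 4) (.const 1))) (.setNat 8 (.var 5)))
    (.branch (.neg (.realLe (orientExpr (vertex (.sub (.var 4) (.const 1))) (vertex (.var 4))
        (vertex (rightIndex (.var 5)))) (.const 0)))
      (.seq (.setNat 7 (.var 4)) (.setNat 8 (.sub (.var 5) (.const 1))))
      (.seq (.setNat 7 (.sub (.var 4) (.const 1))) (.setNat 8 (.sub (.var 5) (.const 1)))))

/-- Four times an integer. -/
def quadruple (e : NatExpr) : NatExpr := .add (.add e e) (.add e e)

/-- Writes the vertex number `k` of the current piece, each piece being given by four points. -/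
def putVertex (k : ℕ) (e : NatExpr) : Program :=
  putPoint 4 5 (.add (quadruple (.var 2)) (.const k)) (vertex e)

def peelTest : Test := .neg (.natLe (.add (.var 4) (.var 5)) (.const 0))

/-- Peels off one piece: it writes its vertices and records the next chord. -/
def peelStep : Program :=
  block [chooseChord, putVertex 0 (.var 7), putVertex 1 (.var 4), putVertex 2 (rightIndex (.var 5)),
    putVertex 3 (rightIndex (.var 8)), .setNat 2 (.add (.var 2) (.const 1)), .setNat 4 (.var 7),
    .setNat 5 (.var 8), .putNat 0 (.var 2) (quadruple (.var 2)), .putNat 1 (.var 2) (.var 4),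
    .putNat 2 (.var 2) (.var 5)]

def levelTest : Test := .neg (.natLe (.var 6) (.const 0))

/-- Goes up one level and chooses the chain of the next point. A piece with edges on both chains
keeps the side of the piece below it. -/
def sideStep : Program :=
  .seq (.setNat 6 (.sub (.var 6) (.const 1)))
    (.branch (.natLe (.get 2 (.var 6)) (.get 2 (.add (.var 6) (.const 1))))
      (.setNat 9 (.const 0))
      (.branch (.natLe (.get 1 (.var 6)) (.get 1 (.add (.var 6) (.const 1))))
        (.setNat 9 (.const 1)) .skip))

/-- Writes the point at the current level and records its edge. -/
def pointStep : Program :=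
  .branch (.natLe (.var 9) (.const 0))
    (block [putPoint 2 3 (.var 6) (pickExpr (vertex (.var 12)) (vertex (.var 13))
        (vertex (.get 1 (.var 6))) (vertex (.get 1 (.add (.var 6) (.const 1))))),
      .setNat 10 (.get 1 (.add (.var 6) (.const 1))), .setNat 11 (.get 1 (.var 6))])
    (block [putPoint 2 3 (.var 6) (pickExpr (vertex (.var 10)) (vertex (.var 11))
        (vertex (rightIndex (.get 2 (.var 6))))
        (vertex (rightIndex (.get 2 (.add (.var 6) (.const 1)))))),
      .setNat 12 (rightIndex (.get 2 (.var 6))),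
      .setNat 13 (rightIndex (.get 2 (.add (.var 6) (.const 1))))])

def peelInit : Program :=
  block [.setNat 4 (.var 3), .setNat 5 (rightIndex (.var 3)), .putNat 1 (.const 0) (.var 4),
    .putNat 2 (.const 0) (.var 5)]

/-- Before the first point, the base stands in for the last edge on both chains. -/
def levelInit : Program :=
  block [.setNat 1 (.var 2), .setNat 6 (.var 2), .setNat 11 (rightIndex (.const 0)),
    .setNat 13 (rightIndex (.const 0))]

/-- The algorithm: find the apex, peel the funnel from the apex down to the base, and select the
points of the hidden set from the base back up to the apex. -/
def funnelProgram : Program :=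
  .seq (.setNat 3 (.const 1)) (.seq (.loop apexTest apexStep) (.seq peelInit
    (.seq (.loop peelTest peelStep) (.seq levelInit (.loop levelTest (.seq sideStep pointStep))))))

/-! ### The linear-time algorithm: single steps -/

theorem NatExpr.eval_congr {s s' : State} (h : s'.natVar = s.natVar)
    (h' : s'.natArr = s.natArr) (e : NatExpr) : e.eval s' = e.eval s := by
  induction e with
  | const c => rfl
  | var x => exact congrFun h x
  | get a i ih => simp only [NatExpr.eval, ih, h']
  | add e f ihe ihf => simp only [NatExpr.eval, ihe, ihf]
  | sub e f ihe ihf => simp only [NatExpr.eval, ihe, ihf]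

/-- The state after the point `p` has been stored at the index `i` of the arrays `a` and `b`. -/
def State.store (s : State) (a b i : ℕ) (p : Plane) : State :=
  { s with realArr := Function.update (Function.update s.realArr a
      (Function.update (s.realArr a) i p.1)) b (Function.update (s.realArr b) i p.2) }

theorem NatExpr.eval_store (e : NatExpr) (s : State) (a b i : ℕ) (p : Plane) :
    e.eval (s.store a b i p) = e.eval s :=
  NatExpr.eval_congr (s := s) (s' := s.store a b i p) rfl rfl e

section

variable {n : ℕ} {P : Polygon Plane n} {s : State}

theorem HasInput.congr {s' : State} (h : HasInput P s) (h0 : s'.natVar 0 = s.natVar 0)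
    (h1 : s'.realArr = s.realArr) : HasInput P s' :=
  ⟨h0.trans h.size, by rw [h1]; exact h.fst, by rw [h1]; exact h.snd⟩

theorem HasInput.store (h : HasInput P s) {a b : ℕ} (ha : 2 ≤ a) (hb : 2 ≤ b) (i : ℕ) (p : Plane) :
    HasInput P (s.store a b i p) := by
  refine ⟨h.size, ?_, ?_⟩
  · rw [← h.fst]; simp only [State.store]
    rw [Function.update_of_ne (by omega), Function.update_of_ne (by omega)]
  · rw [← h.snd]; simp only [State.store]
    rw [Function.update_of_ne (by omega), Function.update_of_ne (by omega)]

theorem outVertex_store (s : State) (i k : ℕ) (p : Plane) :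
    outVertex (s.store 4 5 i p) k = if k = i then p else outVertex s k := by
  simp only [outVertex, State.store, Function.update_apply]
  split_ifs <;> simp_all

theorem outVertex_store_points (s : State) (i k : ℕ) (p : Plane) :
    outVertex (s.store 2 3 i p) k = outVertex s k := by
  simp [outVertex, State.store]

theorem outPoint_store (s : State) (i k : ℕ) (p : Plane) :
    outPoint (s.store 2 3 i p) k = if k = i then p else outPoint s k := by
  simp only [outPoint, State.store, Function.update_apply]
  split_ifs <;> simp_all

/-- The point expression `p` has the value `x` in the state `s`, and as long as only real registers
and output arrays change. -/
def Denotes (P : Polygon Plane n) (s : State) (p : RealExpr × RealExpr) (x : Plane) : Prop :=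
  ∀ s', s'.natVar = s.natVar → s'.natArr = s.natArr → HasInput P s' → evalPoint s' p = x

theorem denotes_vertex (hn : 0 < n) {e : NatExpr} {k : ℕ} (he : e.eval s = k) (hk : k < n) :
    Denotes P s (vertex e) (cyc hn P k) := by
  intro s' h1 h2 h3
  have h4 : e.eval s' = k := (NatExpr.eval_congr h1 h2 e).trans he
  rw [h3.evalPoint_vertex hn (by rw [h4]; exact hk), h4]

theorem denotes_pickExpr {A B p q : RealExpr × RealExpr} {A' B' p' q' : Plane}
    (hA : Denotes P s A A') (hB : Denotes P s B B') (hp : Denotes P s p p')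
    (hq : Denotes P s q q') : Denotes P s (pickExpr A B p q) (pick (orient A' B') p' q') := by
  intro s' h1 h2 h3
  rw [evalPoint_pickExpr, hA s' h1 h2 h3, hB s' h1 h2 h3, hp s' h1 h2 h3, hq s' h1 h2 h3]

theorem wp_putPoint {a b : ℕ} (hab : a ≠ b) (ha : 2 ≤ a) {i : NatExpr}
    {p : RealExpr × RealExpr} {x : Plane} (hx : Denotes P s p x) (h : HasInput P s)
    {Q : State → Prop} (hQ : Q (s.store a b (i.eval s) x)) : wp (putPoint a b i p) Q s := by
  have h1 := hx s rfl rfl h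
  simp only [putPoint, wp]
  have h2 := hx
    { s with
      realArr := Function.update s.realArr a
        (Function.update (s.realArr a) (i.eval s) (p.1.eval s)) } rfl rfl
    ⟨h.size, by rw [← h.fst]; exact Function.update_of_ne (by omega) _ _,
      by rw [← h.snd]; exact Function.update_of_ne (by omega) _ _⟩
  have h3 : p.1.eval s = x.1 := congrArg Prod.fst h1
  have h4 := congrArg Prod.snd h2
  simp only [evalPoint] at h4
  have h5 : ∀ ρ, i.eval { s with realArr := ρ } = i.eval s := fun ρ =>
    NatExpr.eval_congr (s := s) (s' := { s with realArr := ρ }) rfl rfl i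
  rw [h4, h5 (Function.update s.realArr a (Function.update (s.realArr a) (i.eval s) (p.1.eval s))),
    Function.update_of_ne hab.symm, h3]
  exact hQ

theorem eval_rightIndex (h : HasInput P s) {e : NatExpr} {j : ℕ} (he : e.eval s = j) :
    (rightIndex e).eval s = n - 1 - j := by
  simp only [rightIndex, NatExpr.eval, h.size, he]

theorem wp_seq {p q : Program} {Q : State → Prop} (h : wp p (wp q Q) s) : wp (.seq p q) Q s := h

theorem wp_block_cons {p : Program} {l : List Program} {Q : State → Prop}
    (h : wp p (wp (block l) Q) s) : wp (block (p :: l)) Q s := h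

theorem wp_chooseChord (hn : 0 < n) (h : HasInput P s) {i j : ℕ} (h4 : s.natVar 4 = i)
    (h5 : s.natVar 5 = j) (hi : i < n) :
    wp chooseChord (fun s' => s'.realArr = s.realArr ∧ s'.natArr = s.natArr ∧
      s'.natVar 7 = (Funnel.next 1 (cyc hn P) (fun k => cyc hn P (n - 1 - k)) (i, j)).1 ∧
      s'.natVar 8 = (Funnel.next 1 (cyc hn P) (fun k => cyc hn P (n - 1 - k)) (i, j)).2 ∧
      ∀ x, x ≠ 7 → x ≠ 8 → s'.natVar x = s.natVar x) s := by
  have v : ∀ {e : NatExpr} {k : ℕ}, e.eval s = k → k < n →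
      evalPoint s (vertex e) = cyc hn P k := fun he hk => denotes_vertex hn he hk s rfl rfl h
  have hv4 : (NatExpr.var 4).eval s = i := h4
  have hv5 : (NatExpr.var 5).eval s = j := h5
  have hp4 : (NatExpr.sub (.var 4) (.const 1)).eval s = i - 1 := by
    simp only [NatExpr.eval, h4]
  have hp5 : (NatExpr.sub (.var 5) (.const 1)).eval s = j - 1 := by
    simp only [NatExpr.eval, h5]
  simp only [chooseChord, wp, Test.Holds, eval_orientExpr, RealExpr.eval, Int.cast_zero, not_le,
    not_lt, v hv4 hi, v hp4 (by omega : i - 1 < n),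
    v (eval_rightIndex h hv5) (by omega : n - 1 - j < n),
    v (eval_rightIndex h hp5) (by omega : n - 1 - (j - 1) < n)]
  unfold Funnel.next
  dsimp only
  have hframe : ∀ (v v' x : ℕ), x ≠ 7 → x ≠ 8 →
      Function.update (Function.update s.natVar 7 v) 8 v' x = s.natVar x := fun v v' x h1 h2 => by
    rw [Function.update_of_ne h2, Function.update_of_ne h1]
  refine ⟨fun h1 => ?_, fun h1 => ⟨fun h2 => ?_, fun h2 => ?_⟩⟩
  · rw [if_pos (by linarith)]
    exact ⟨trivial, trivial, by simp [NatExpr.eval, h4], by simp [NatExpr.eval, h5], hframe _ _⟩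
  · rw [if_neg (by linarith), if_pos (by linarith)]
    exact ⟨trivial, trivial, by simp [NatExpr.eval, h4], by simp [NatExpr.eval, h5], hframe _ _⟩
  · rw [if_neg (by linarith), if_neg (by linarith)]
    exact ⟨trivial, trivial, by simp [NatExpr.eval, h4], by simp [NatExpr.eval, h5], hframe _ _⟩

/-- The chords up to the level `r` have been recorded. -/
structure Recorded (i j : ℕ → ℕ) (r : ℕ) (s : State) : Prop where
  delimiter : ∀ q ≤ r, s.natArr 0 q = 4 * q
  left : ∀ q ≤ r, s.natArr 1 q = i q
  right : ∀ q ≤ r, s.natArr 2 q = j q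

/-- The vertices of the pieces above the level `r` have been written to the output. -/
def Written (u w : ℕ → Plane) (i j : ℕ → ℕ) (r : ℕ) (s : State) : Prop :=
  ∀ q < r, outVertex s (4 * q) = u (i (q + 1)) ∧ outVertex s (4 * q + 1) = u (i q) ∧
    outVertex s (4 * q + 2) = w (j q) ∧ outVertex s (4 * q + 3) = w (j (q + 1))

theorem eval_quadruple (e : NatExpr) (s : State) : (quadruple e).eval s = 4 * e.eval s := by
  simp only [quadruple, NatExpr.eval]; omega

theorem wp_putVertex (hn : 0 < n) {k : ℕ} {e : NatExpr} {l : ℕ} (h : HasInput P s)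
    (he : e.eval s = l) (hl : l < n) {Q : State → Prop}
    (hQ : Q (s.store 4 5 (4 * s.natVar 2 + k) (cyc hn P l))) : wp (putVertex k e) Q s := by
  refine wp_putPoint (P := P) (by norm_num) (by norm_num) (denotes_vertex hn he hl) h ?_
  have : (NatExpr.add (quadruple (.var 2)) (.const k)).eval s = 4 * s.natVar 2 + k := by
    simp only [NatExpr.eval, eval_quadruple]
  rwa [this]

theorem wp_putVertices (hn : 0 < n) {e₀ e₁ e₂ e₃ : NatExpr} {k₀ k₁ k₂ k₃ : ℕ} (h : HasInput P s)
    (h₀ : e₀.eval s = k₀) (h₁ : e₁.eval s = k₁) (h₂ : e₂.eval s = k₂) (h₃ : e₃.eval s = k₃)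
    (hk₀ : k₀ < n) (hk₁ : k₁ < n) (hk₂ : k₂ < n) (hk₃ : k₃ < n) {l : List Program}
    {Q : State → Prop}
    (hQ : ∀ s', s'.natVar = s.natVar → s'.natArr = s.natArr → HasInput P s' →
      (∀ k, outVertex s' k = if k = 4 * s.natVar 2 + 3 then cyc hn P k₃ else
        if k = 4 * s.natVar 2 + 2 then cyc hn P k₂ else if k = 4 * s.natVar 2 + 1 then cyc hn P k₁ else
        if k = 4 * s.natVar 2 then cyc hn P k₀ else outVertex s k) → wp (block l) Q s') :
    wp (block (putVertex 0 e₀ :: putVertex 1 e₁ :: putVertex 2 e₂ :: putVertex 3 e₃ :: l)) Q s := by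
  have hst : ∀ {s' : State} (k : ℕ) (x : Plane), HasInput P s' → HasInput P (s'.store 4 5 k x) :=
    fun k x h => h.store (by norm_num) (by norm_num) k x
  refine wp_block_cons (wp_putVertex hn h h₀ hk₀ ?_)
  refine wp_block_cons (wp_putVertex hn (hst _ _ h)
    (by simp only [NatExpr.eval_store, h₁]) hk₁ ?_)
  refine wp_block_cons (wp_putVertex hn (hst _ _ (hst _ _ h))
    (by simp only [NatExpr.eval_store, h₂]) hk₂ ?_)
  refine wp_block_cons (wp_putVertex hn (hst _ _ (hst _ _ (hst _ _ h)))
    (by simp only [NatExpr.eval_store, h₃]) hk₃ ?_)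
  refine hQ _ rfl rfl (hst _ _ (hst _ _ (hst _ _ (hst _ _ h)))) fun k => ?_
  rw [outVertex_store, outVertex_store, outVertex_store, outVertex_store]
  rfl

theorem wp_peelStep (hn : 0 < n) (h : HasInput P s) {i j : ℕ → ℕ} {r : ℕ}
    (hi : ∀ q, i q < n)
    (hnext : (i (r + 1), j (r + 1)) =
      Funnel.next 1 (cyc hn P) (fun k => cyc hn P (n - 1 - k)) (i r, j r))
    (h2 : s.natVar 2 = r) (h4 : s.natVar 4 = i r) (h5 : s.natVar 5 = j r)
    (hrec : Recorded i j r s)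
    (hwr : Written (cyc hn P) (fun k => cyc hn P (n - 1 - k)) i j r s) :
    wp peelStep (fun s' => HasInput P s' ∧ s'.natVar 2 = r + 1 ∧ s'.natVar 4 = i (r + 1) ∧
      s'.natVar 5 = j (r + 1) ∧ (∀ x, 9 ≤ x → s'.natVar x = s.natVar x) ∧ Recorded i j (r + 1) s' ∧
      Written (cyc hn P) (fun k => cyc hn P (n - 1 - k)) i j (r + 1) s') s := by
  refine wp_block_cons (wp_mono ?_ (wp_chooseChord hn h h4 h5 (hi r)))
  rintro s₁ ⟨hR, hN, h7, h8, hV⟩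
  rw [← hnext] at h7 h8
  dsimp only at h7 h8
  have hin₁ : HasInput P s₁ := h.congr (hV 0 (by norm_num) (by norm_num)) hR
  have g2 : s₁.natVar 2 = r := (hV 2 (by norm_num) (by norm_num)).trans h2
  have g4 : s₁.natVar 4 = i r := (hV 4 (by norm_num) (by norm_num)).trans h4
  have g5 : s₁.natVar 5 = j r := (hV 5 (by norm_num) (by norm_num)).trans h5
  refine wp_putVertices hn hin₁ (e₀ := .var 7) (e₁ := .var 4) (k₀ := i (r + 1)) (k₁ := i r) (k₂ := n - 1 - j r)
    (k₃ := n - 1 - j (r + 1)) h7 g4 (eval_rightIndex hin₁ (e := .var 5) g5)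
    (eval_rightIndex hin₁ (e := .var 8) h8) (hi _) (hi _) (by omega) (by omega) ?_
  intro s₂ hV₂ hN₂ hin₂ hout
  rw [hN] at hN₂
  rw [g2] at hout
  have hout₀ : ∀ k, outVertex s₁ k = outVertex s k := fun k => by simp only [outVertex, hR]
  simp only [block, wp, NatExpr.eval, eval_quadruple]
  refine ⟨hin₂.congr (by simp) rfl, by simp [hV₂, g2], by simp [hV₂, h7], by simp [hV₂, h8], ?_,
    ⟨?_, ?_, ?_⟩, ?_⟩
  · intro x hx
    rw [Function.update_of_ne (by omega), Function.update_of_ne (by omega),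
      Function.update_of_ne (by omega), hV₂]
    exact hV x (by omega) (by omega)
  · intro q hq
    simp only [Function.update_apply, hV₂, g2, hN₂]
    by_cases hqr : q = r + 1
    · simp [hqr]
    · simp [hqr, hrec.delimiter q (by omega)]
  · intro q hq
    simp only [Function.update_apply, hV₂, g2, hN₂]
    by_cases hqr : q = r + 1
    · simp [hqr, h7]
    · simp [hqr, hrec.left q (by omega)]
  · intro q hq
    simp only [Function.update_apply, hV₂, g2, hN₂]
    by_cases hqr : q = r + 1
    · simp [hqr, h8]
    · simp [hqr, hrec.right q (by omega)]
  · intro q hq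
    change outVertex s₂ _ = _ ∧ outVertex s₂ _ = _ ∧ outVertex s₂ _ = _ ∧ outVertex s₂ _ = _
    simp only [hout, hout₀]
    by_cases hqr : q = r
    · subst hqr; simp
    · have hne : ∀ c d, c < 4 → d < 4 → 4 * q + c ≠ 4 * r + d := by omega
      obtain ⟨w₀, w₁, w₂, w₃⟩ := hwr q (by omega)
      have hold : ∀ c < 4, (if 4 * q + c = 4 * r + 3 then cyc hn P (n - 1 - j (r + 1)) else
          if 4 * q + c = 4 * r + 2 then cyc hn P (n - 1 - j r) else
          if 4 * q + c = 4 * r + 1 then cyc hn P (i r) else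
          if 4 * q + c = 4 * r then cyc hn P (i (r + 1)) else outVertex s (4 * q + c)) =
          outVertex s (4 * q + c) := fun c hc => by
        rw [if_neg (hne c 3 hc (by omega)), if_neg (hne c 2 hc (by omega)),
          if_neg (hne c 1 hc (by omega)), if_neg (by omega)]
      exact ⟨(hold 0 (by omega)).trans w₀, (hold 1 (by omega)).trans w₁,
        (hold 2 (by omega)).trans w₂, (hold 3 (by omega)).trans w₃⟩

end

end RealRAM

/-! ### The linear-time algorithm: the points of the hidden set -/

namespace RealRAM

/-- The memory on the way back up: the side of the last point (`0` for the left chain) and the edges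
of the last points on the two chains, by the indices of their endpoints in the polygon. -/
structure Registers where
  side : ℕ
  leftA : ℕ
  leftB : ℕ
  rightA : ℕ
  rightB : ℕ

/-- The side of the point at the level `s`, given the side of the point below it. -/
def newSide (i j : ℕ → ℕ) (s side : ℕ) : ℕ :=
  if j s ≤ j (s + 1) then 0 else if i s ≤ i (s + 1) then 1 else side

def Registers.step (n : ℕ) (i j : ℕ → ℕ) (s : ℕ) (R : Registers) : Registers :=
  if newSide i j s R.side ≤ 0 then
    ⟨newSide i j s R.side, i (s + 1), i s, R.rightA, R.rightB⟩
  else ⟨newSide i j s R.side, R.leftA, R.leftB, n - 1 - j s, n - 1 - j (s + 1)⟩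

/-- The registers `k` levels above the base. -/
def registers (n : ℕ) (i j : ℕ → ℕ) (m : ℕ) : ℕ → Registers
  | 0 => ⟨0, 0, n - 1, 0, n - 1⟩
  | k + 1 => (registers n i j m k).step n i j (m - (k + 1))

theorem registers_sub (n : ℕ) (i j : ℕ → ℕ) {m s : ℕ} (hs : s < m) :
    registers n i j m (m - s) = (registers n i j m (m - (s + 1))).step n i j s := by
  rw [show m - s = m - (s + 1) + 1 by omega, registers,
    show m - (m - (s + 1) + 1) = s by omega]

theorem Registers.step_of_le {n : ℕ} {i j : ℕ → ℕ} {s : ℕ} {R : Registers}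
    (h : newSide i j s R.side ≤ 0) : R.step n i j s =
      ⟨newSide i j s R.side, i (s + 1), i s, R.rightA, R.rightB⟩ := if_pos h

theorem Registers.step_of_not_le {n : ℕ} {i j : ℕ → ℕ} {s : ℕ} {R : Registers}
    (h : ¬ newSide i j s R.side ≤ 0) : R.step n i j s =
      ⟨newSide i j s R.side, R.leftA, R.leftB, n - 1 - j s, n - 1 - j (s + 1)⟩ := if_neg h

theorem Registers.step_side (n : ℕ) (i j : ℕ → ℕ) (s : ℕ) (R : Registers) :
    (R.step n i j s).side = newSide i j s R.side := by
  unfold step; split_ifs <;> rfl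

/-- The point at the level `s`. -/
noncomputable def levelPoint (f : ℕ → Plane) (n : ℕ) (i j : ℕ → ℕ) (s : ℕ) (R : Registers) : Plane :=
  if R.side ≤ 0 then pick (orient (f R.rightA) (f R.rightB)) (f (i s)) (f (i (s + 1)))
  else pick (orient (f R.leftA) (f R.leftB)) (f (n - 1 - j s)) (f (n - 1 - j (s + 1)))

/-- The indices in the registers are in range. -/
def Registers.InRange (n : ℕ) (R : Registers) : Prop :=
  R.leftA < n ∧ R.leftB < n ∧ R.rightA < n ∧ R.rightB < n

theorem registers_inRange {n : ℕ} (hn : 0 < n) {i : ℕ → ℕ} (hi : ∀ q, i q < n) (j : ℕ → ℕ) (m k : ℕ) :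
    (registers n i j m k).InRange n := by
  induction k with
  | zero => exact ⟨hn, by simp only [registers]; omega, hn, by simp only [registers]; omega⟩
  | succ k ih =>
    obtain ⟨h1, h2, h3, h4⟩ := ih
    simp only [registers, Registers.step]
    split_ifs
    · exact ⟨hi _, hi _, h3, h4⟩
    · exact ⟨h1, h2, by simp only; omega, by simp only; omega⟩

/-- The registers of the machine hold `R`. -/
structure HoldsRegisters (R : Registers) (s : State) : Prop where
  side : s.natVar 9 = R.side
  leftA : s.natVar 10 = R.leftA
  leftB : s.natVar 11 = R.leftB
  rightA : s.natVar 12 = R.rightA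
  rightB : s.natVar 13 = R.rightB

section

variable {n : ℕ} {P : Polygon Plane n} {s : State} {i j : ℕ → ℕ} {m r : ℕ}

theorem wp_sideStep (h6 : s.natVar 6 = r + 1) (hr : r < m) (hrec : Recorded i j m s) :
    wp sideStep (fun s' => s'.realArr = s.realArr ∧ s'.natArr = s.natArr ∧ s'.natVar 6 = r ∧
      s'.natVar 9 = newSide i j r (s.natVar 9) ∧
      ∀ x, x ≠ 6 → x ≠ 9 → s'.natVar x = s.natVar x) s := by
  have e6 : Function.update s.natVar 6 (s.natVar 6 - 1) 6 = r := by
    rw [Function.update_self, h6, Nat.add_sub_cancel]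
  simp only [sideStep, wp, Test.Holds, NatExpr.eval, e6, hrec.left r hr.le, hrec.left (r + 1) hr,
    hrec.right r hr.le, hrec.right (r + 1) hr, newSide]
  have hframe : ∀ (v v' x : ℕ), x ≠ 6 → x ≠ 9 →
      Function.update (Function.update s.natVar 6 v) 9 v' x = s.natVar x := fun v v' x h1 h2 => by
    rw [Function.update_of_ne h2, Function.update_of_ne h1]
  refine ⟨fun h1 => ?_, fun h1 => ⟨fun h2 => ?_, fun h2 => ?_⟩⟩
  · rw [if_pos h1]
    exact ⟨trivial, trivial, by simp [h6], by simp, hframe _ _⟩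
  · rw [if_neg h1, if_pos h2]
    exact ⟨trivial, trivial, by simp [h6], by simp, hframe _ _⟩
  · rw [if_neg h1, if_neg h2]
    exact ⟨trivial, trivial, trivial, by simp, fun x h3 _ => Function.update_of_ne h3 _ _⟩

theorem wp_pointStep (hn : 0 < n) (h : HasInput P s) (hi : ∀ q, i q < n) (hr : r < m)
    (h6 : s.natVar 6 = r) (hrec : Recorded i j m s) {R : Registers} (hR : R.InRange n)
    (h9 : s.natVar 9 = newSide i j r R.side) (h10 : s.natVar 10 = R.leftA)
    (h11 : s.natVar 11 = R.leftB) (h12 : s.natVar 12 = R.rightA) (h13 : s.natVar 13 = R.rightB) :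
    wp pointStep (fun s' => HasInput P s' ∧ s'.natArr = s.natArr ∧
      (∀ x < 9, s'.natVar x = s.natVar x) ∧ HoldsRegisters (R.step n i j r) s' ∧
      (∀ q, outVertex s' q = outVertex s q) ∧
      ∀ q, outPoint s' q = if q = r then levelPoint (cyc hn P) n i j r (R.step n i j r)
        else outPoint s q) s := by
  have e6 : (NatExpr.var 6).eval s = r := h6
  have ei : (NatExpr.get 1 (.var 6)).eval s = i r := by
    simp only [NatExpr.eval, h6, hrec.left r hr.le]
  have ei' : (NatExpr.get 1 (.add (.var 6) (.const 1))).eval s = i (r + 1) := by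
    simp only [NatExpr.eval, h6, hrec.left (r + 1) hr]
  have ej : (NatExpr.get 2 (.var 6)).eval s = j r := by
    simp only [NatExpr.eval, h6, hrec.right r hr.le]
  have ej' : (NatExpr.get 2 (.add (.var 6) (.const 1))).eval s = j (r + 1) := by
    simp only [NatExpr.eval, h6, hrec.right (r + 1) hr]
  obtain ⟨b1, b2, b3, b4⟩ := hR
  refine ⟨fun hle => ?_, fun hle => ?_⟩
  · have hle' : newSide i j r R.side ≤ 0 := by
      simpa only [Test.Holds, NatExpr.eval, h9] using hle
    rw [Registers.step_of_le hle']
    refine wp_block_cons (wp_putPoint (by norm_num) (by norm_num)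
      (denotes_pickExpr (denotes_vertex hn (e := .var 12) h12 b3)
        (denotes_vertex hn (e := .var 13) h13 b4) (denotes_vertex hn ei (hi _))
        (denotes_vertex hn ei' (hi _))) h ?_)
    have hin := h.store (a := 2) (b := 3) (by norm_num) (by norm_num) ((NatExpr.var 6).eval s)
      (pick (orient (cyc hn P R.rightA) (cyc hn P R.rightB)) (cyc hn P (i r))
        (cyc hn P (i (r + 1))))
    rw [e6] at hin ⊢
    have hlp : levelPoint (cyc hn P) n i j r
        ⟨newSide i j r R.side, i (r + 1), i r, R.rightA, R.rightB⟩ =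
        pick (orient (cyc hn P R.rightA) (cyc hn P R.rightB)) (cyc hn P (i r))
          (cyc hn P (i (r + 1))) := if_pos hle'
    rw [hlp]
    generalize hx : pick (orient (cyc hn P R.rightA) (cyc hn P R.rightB)) (cyc hn P (i r))
        (cyc hn P (i (r + 1))) = x at hin ⊢
    have q1 : ∀ q, outVertex (s.store 2 3 r x) q = outVertex s q :=
      fun q => outVertex_store_points s r q x
    have q2 : ∀ q, outPoint (s.store 2 3 r x) q = if q = r then x else outPoint s q :=
      fun q => outPoint_store s r q x
    refine ⟨hin.congr (by simp) rfl, rfl, fun y hy => ?_, ⟨?_, ?_, ?_, ?_, ?_⟩, q1, q2⟩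
    · simp only
      rw [Function.update_of_ne (by omega), Function.update_of_ne (by omega)]; rfl
    · simpa [State.store] using h9
    · simpa [NatExpr.eval, State.store] using ei'
    · simpa [NatExpr.eval, State.store] using ei
    · simpa [State.store] using h12
    · simpa [State.store] using h13
  · have hle' : ¬ newSide i j r R.side ≤ 0 := by
      simpa only [Test.Holds, NatExpr.eval, h9] using hle
    rw [Registers.step_of_not_le hle']
    have ek := eval_rightIndex h ej
    have ek' := eval_rightIndex h ej'
    refine wp_block_cons (wp_putPoint (by norm_num) (by norm_num)
      (denotes_pickExpr (denotes_vertex hn (e := .var 10) h10 b1)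
        (denotes_vertex hn (e := .var 11) h11 b2) (denotes_vertex hn ek (by omega))
        (denotes_vertex hn ek' (by omega))) h ?_)
    have hin := h.store (a := 2) (b := 3) (by norm_num) (by norm_num) ((NatExpr.var 6).eval s)
      (pick (orient (cyc hn P R.leftA) (cyc hn P R.leftB)) (cyc hn P (n - 1 - j r))
        (cyc hn P (n - 1 - j (r + 1))))
    rw [e6] at hin ⊢
    have hlp : levelPoint (cyc hn P) n i j r
        ⟨newSide i j r R.side, R.leftA, R.leftB, n - 1 - j r, n - 1 - j (r + 1)⟩ =
        pick (orient (cyc hn P R.leftA) (cyc hn P R.leftB)) (cyc hn P (n - 1 - j r))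
          (cyc hn P (n - 1 - j (r + 1))) := if_neg hle'
    rw [hlp]
    generalize hx : pick (orient (cyc hn P R.leftA) (cyc hn P R.leftB)) (cyc hn P (n - 1 - j r))
        (cyc hn P (n - 1 - j (r + 1))) = x at hin ⊢
    have q1 : ∀ q, outVertex (s.store 2 3 r x) q = outVertex s q :=
      fun q => outVertex_store_points s r q x
    have q2 : ∀ q, outPoint (s.store 2 3 r x) q = if q = r then x else outPoint s q :=
      fun q => outPoint_store s r q x
    refine ⟨hin.congr (by simp) rfl, rfl, fun y hy => ?_, ⟨?_, ?_, ?_, ?_, ?_⟩, q1, q2⟩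
    · simp only
      rw [Function.update_of_ne (by omega), Function.update_of_ne (by omega)]; rfl
    · simpa [State.store] using h9
    · simpa [State.store] using h10
    · simpa [State.store] using h11
    · simpa [NatExpr.eval, rightIndex, State.store] using ek
    · simpa [NatExpr.eval, rightIndex, State.store] using ek'

theorem wp_levelStep (hn : 0 < n) (h : HasInput P s) (hi : ∀ q, i q < n) (hr : r < m)
    (h6 : s.natVar 6 = r + 1) (hrec : Recorded i j m s) {R : Registers} (hR : R.InRange n)
    (hreg : HoldsRegisters R s) :
    wp (.seq sideStep pointStep) (fun s' => HasInput P s' ∧ s'.natArr = s.natArr ∧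
      s'.natVar 1 = s.natVar 1 ∧ s'.natVar 2 = s.natVar 2 ∧ s'.natVar 6 = r ∧
      HoldsRegisters (R.step n i j r) s' ∧ (∀ q, outVertex s' q = outVertex s q) ∧
      ∀ q, outPoint s' q = if q = r then levelPoint (cyc hn P) n i j r (R.step n i j r)
        else outPoint s q) s := by
  refine wp_seq (wp_mono ?_ (wp_sideStep h6 hr hrec))
  rintro s₁ ⟨g1, g2, g3, g4, g5⟩
  have hrec₁ : Recorded i j m s₁ := ⟨by rw [g2]; exact hrec.delimiter, by rw [g2]; exact hrec.left,
    by rw [g2]; exact hrec.right⟩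
  have hv : ∀ q, outVertex s₁ q = outVertex s q := fun q => by simp only [outVertex, g1]
  have hp : ∀ q, outPoint s₁ q = outPoint s q := fun q => by simp only [outPoint, g1]
  refine wp_mono ?_ (wp_pointStep hn (h.congr (g5 0 (by norm_num) (by norm_num)) g1) hi hr g3 hrec₁ hR
    (by rw [g4, hreg.side]) ((g5 10 (by norm_num) (by norm_num)).trans hreg.leftA)
    ((g5 11 (by norm_num) (by norm_num)).trans hreg.leftB)
    ((g5 12 (by norm_num) (by norm_num)).trans hreg.rightA)
    ((g5 13 (by norm_num) (by norm_num)).trans hreg.rightB))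
  rintro s₂ ⟨f1, f2, f3, f4, f5, f6⟩
  refine ⟨f1, f2.trans g2, (f3 1 (by norm_num)).trans (g5 1 (by norm_num) (by norm_num)),
    (f3 2 (by norm_num)).trans (g5 2 (by norm_num) (by norm_num)), (f3 6 (by norm_num)).trans g3, f4,
    fun q => (f5 q).trans (hv q), fun q => ?_⟩
  rw [f6, hp]

end

/-! ### The linear-time algorithm: correctness -/

/-- A bound on the number of steps per vertex. The loops run for at most `n` rounds, so that each of
them contributes at most `n + 1 ≤ 2 * n` times the cost of a round. -/
def stepsPerVertex : ℕ :=
  (Program.setNat 3 (.const 1)).bound + 2 * (apexTest.cost + apexStep.bound + 1) +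
    peelInit.bound + 2 * (peelTest.cost + peelStep.bound + 1) + levelInit.bound +
    2 * (levelTest.cost + (Program.seq sideStep pointStep).bound + 1)

theorem hasInput_inputState {n : ℕ} (P : Polygon Plane n) : HasInput P (inputState P) :=
  ⟨rfl, rfl, rfl⟩

/-- The program halts in linear time, with the chords `(i s, j s)` of the greedy peeling recorded, and
the vertices of the pieces and the selected points written to the output. -/
theorem halts_funnelProgram {n t m : ℕ} (hn : 0 < n) (P : Polygon Plane n) (ht : 0 < t)
    (htn : t + 1 < n)
    (hreflex : ∀ i, 0 < i → i < t → 0 < orient (cyc hn P (i - 1)) (cyc hn P i) (cyc hn P (i + 1)))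
    (hapex : orient (cyc hn P (t - 1)) (cyc hn P t) (cyc hn P (t + 1)) < 0) {i j : ℕ → ℕ}
    (hi0 : i 0 = t) (hj0 : j 0 = n - 1 - t) (him : i m = 0) (hjm : j m = 0)
    (hi : ∀ q, i q < n) (hpos : ∀ q < m, i q + j q ≠ 0) (hm : m < n)
    (hnext : ∀ q, (i (q + 1), j (q + 1)) =
      Funnel.next 1 (cyc hn P) (fun k => cyc hn P (n - 1 - k)) (i q, j q)) :
    Halts funnelProgram (inputState P) (stepsPerVertex * n) (fun s => s.natVar 1 = m ∧
      s.natVar 2 = m ∧ Recorded i j m s ∧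
      Written (cyc hn P) (fun k => cyc hn P (n - 1 - k)) i j m s ∧
      ∀ q < m, outPoint s q = levelPoint (cyc hn P) n i j q (registers n i j m (m - q))) := by
  have main : Halts funnelProgram (inputState P)
      ((Program.setNat 3 (.const 1)).bound + ((t - 1 + 1) * (apexTest.cost + apexStep.bound + 1) +
        (peelInit.bound + ((m + 1) * (peelTest.cost + peelStep.bound + 1) + (levelInit.bound +
        (m + 1) * (levelTest.cost + (Program.seq sideStep pointStep).bound + 1))))))
      (fun s => s.natVar 1 = m ∧ s.natVar 2 = m ∧ Recorded i j m s ∧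
        Written (cyc hn P) (fun k => cyc hn P (n - 1 - k)) i j m s ∧
        ∀ q < m, outPoint s q = levelPoint (cyc hn P) n i j q (registers n i j m (m - q))) := by
    -- the invariants of the three loops
    let I₁ : ℕ → State → Prop := fun q s => HasInput P s ∧ 0 < s.natVar 3 ∧ s.natVar 3 + q = t ∧
      s.natArr 0 0 = 0 ∧ s.natVar 2 = 0 ∧ ∀ x, 9 ≤ x → s.natVar x = 0
    let I₂ : ℕ → State → Prop := fun q s => HasInput P s ∧ (∀ x, 9 ≤ x → s.natVar x = 0) ∧
      ∃ r, r + q = m ∧ s.natVar 2 = r ∧ s.natVar 4 = i r ∧ s.natVar 5 = j r ∧ Recorded i j r s ∧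
        Written (cyc hn P) (fun k => cyc hn P (n - 1 - k)) i j r s
    let I₃ : ℕ → State → Prop := fun r s => HasInput P s ∧ s.natVar 1 = m ∧ s.natVar 2 = m ∧
      s.natVar 6 = r ∧ r ≤ m ∧ Recorded i j m s ∧
      Written (cyc hn P) (fun k => cyc hn P (n - 1 - k)) i j m s ∧
      HoldsRegisters (registers n i j m (m - r)) s ∧ ∀ q, r ≤ q → q < m →
        outPoint s q = levelPoint (cyc hn P) n i j q (registers n i j m (m - q))
    have hapexTest : ∀ s, HasInput P s → 0 < s.natVar 3 → s.natVar 3 ≤ t → (apexTest.Holds s ↔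
        0 ≤ orient (cyc hn P (s.natVar 3 - 1)) (cyc hn P (s.natVar 3))
          (cyc hn P (s.natVar 3 + 1))) := by
      intro s h h0 h1
      have v : ∀ {e : NatExpr} {k : ℕ}, e.eval s = k → k < n →
          evalPoint s (vertex e) = cyc hn P k := fun he hk => denotes_vertex hn he hk s rfl rfl h
      simp only [apexTest, Test.Holds, eval_orientExpr, RealExpr.eval, Int.cast_zero,
        v (e := .sub (.var 3) (.const 1)) rfl (by simp only [NatExpr.eval]; omega),
        v (e := .var 3) rfl (by simp only [NatExpr.eval]; omega),
        v (e := .add (.var 3) (.const 1)) rfl (by simp only [NatExpr.eval]; omega), NatExpr.eval]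
    refine Halts.seq (R := I₁ (t - 1)) (halts_of_wp ?_) fun s hs => ?_
    · refine ⟨(hasInput_inputState P).congr (by simp) rfl, ?_, ?_, rfl, ?_, fun x hx => ?_⟩
      · simp [NatExpr.eval]
      · simp [NatExpr.eval]; omega
      · simp [inputState]
      · simp only
        rw [Function.update_of_ne (by omega)]
        simp only [inputState]
        rw [if_neg (by omega)]
    refine Halts.seq (Halts.loop I₁ ?_ hs) ?_
    · rintro q s ⟨h1, h2, h3, h4, hz, h5⟩ hb
      rw [hapexTest s h1 h2 (by omega)] at hb
      have hlt : s.natVar 3 < t := by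
        rcases Nat.lt_or_ge (s.natVar 3) t with h | h
        · exact h
        · rw [show s.natVar 3 = t by omega] at hb
          exact absurd hapex hb.not_gt
      refine ⟨q - 1, by omega, h1.congr (by simp) rfl, ?_, ?_, h4, ?_, fun x hx => ?_⟩
      · simp [NatExpr.eval]
      · simp [NatExpr.eval]; omega
      · simpa using hz
      · simp only
        rw [Function.update_of_ne (by omega)]
        exact h5 x hx
    rintro s ⟨hb, q, h1, h2, h3, h4, hz, h5⟩
    rw [hapexTest s h1 h2 (by omega)] at hb
    have h3t : s.natVar 3 = t := by
      by_contra hne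
      exact hb (hreflex _ h2 (by omega)).le
    refine Halts.seq (R := I₂ m) (halts_of_wp ?_) fun s hs => ?_
    · simp only [peelInit, block, wp]
      have e5 : (rightIndex (.var 3)).eval { s with
          natVar := Function.update s.natVar 4 ((NatExpr.var 3).eval s) } = n - 1 - t := by
        simp [rightIndex, NatExpr.eval, h1.size, h3t]
      rw [e5]
      refine ⟨h1.congr (by simp) rfl, fun x hx => ?_, 0, Nat.zero_add m, ?_, ?_, ?_,
        ⟨?_, ?_, ?_⟩, fun q hq => absurd hq (by omega)⟩
      · simp only
        rw [Function.update_of_ne (by omega), Function.update_of_ne (by omega)]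
        exact h5 x hx
      · simpa using hz
      · simp [NatExpr.eval, h3t, hi0]
      · simp [hj0]
      · intro q hq
        obtain rfl : q = 0 := by omega
        simp [h4]
      · intro q hq
        obtain rfl : q = 0 := by omega
        simp [NatExpr.eval, h3t, hi0]
      · intro q hq
        obtain rfl : q = 0 := by omega
        simp [NatExpr.eval, hj0]
    refine Halts.seq (Halts.loop I₂ ?_ hs) ?_
    · rintro q s ⟨h1, h2, r, h3, h4, h5, h6, h7, h8⟩ hb
      have hrm : r < m := by
        rcases Nat.lt_or_ge r m with h | h
        · exact h
        · obtain rfl : r = m := by omega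
          simp [peelTest, Test.Holds, NatExpr.eval, h5, h6, him, hjm] at hb
      refine wp_mono ?_ (wp_peelStep hn h1 hi (hnext r) h4 h5 h6 h7 h8)
      rintro s' ⟨g1, g2, g3, g4, g5, g6, g7⟩
      exact ⟨q - 1, by omega, g1, fun x hx => (g5 x hx).trans (h2 x hx), r + 1, by omega, g2, g3, g4,
        g6, g7⟩
    rintro s ⟨hb, q, h1, h2, r, h3, h4, h5, h6, h7, h8⟩
    obtain rfl : r = m := by
      by_contra hne
      refine hb ?_
      simp only [peelTest, Test.Holds, NatExpr.eval, h5, h6]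
      have := hpos r (by omega)
      omega
    refine Halts.seq (R := I₃ r) (halts_of_wp ?_) fun s hs => ?_
    · have hk : ∀ f : ℕ → ℕ, f 0 = n →
          (rightIndex (.const 0)).eval { s with natVar := f } = n - 1 := fun f hf => by
        simp [rightIndex, NatExpr.eval, hf]
      have e0 := h1.size
      refine ⟨h1.congr (by simp) rfl, ?_, ?_, ?_, le_rfl, ⟨h7.1, h7.2, h7.3⟩, h8, ⟨?_, ?_, ?_, ?_, ?_⟩,
        fun q h1 h2 => absurd h2 (by omega)⟩
      all_goals
        simp [NatExpr.eval, rightIndex, h4, h2, e0, registers]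
    obtain ⟨s', k, g1, g2, g3, q', g4⟩ := Halts.loop (b := levelTest)
      (p := .seq sideStep pointStep) I₃ (by
        rintro q s ⟨h1, h2, h3, h4, h5, h6, h7, h8, h9⟩ hb
        obtain ⟨p, rfl⟩ : ∃ p, q = p + 1 := by
          refine ⟨q - 1, ?_⟩
          simp only [levelTest, Test.Holds, NatExpr.eval, h4] at hb
          omega
        refine wp_mono ?_ (wp_levelStep hn h1 hi h5 h4 h6 (registers_inRange hn hi j r _) h8)
        rintro s' ⟨g1, g2, g3, g4, g5, g6, g7, g8⟩
        rw [← registers_sub n i j h5] at g6 g8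
        refine ⟨p, by omega, g1, g3.trans h2, g4.trans h3, g5, by omega,
          ⟨by rw [g2]; exact h6.1, by rw [g2]; exact h6.2, by rw [g2]; exact h6.3⟩, ?_, g6, ?_⟩
        · intro q hq
          simp only [g7]
          exact h7 q hq
        · intro q hq hqm
          rw [g8]
          split_ifs with hqp
          · rw [hqp]
          · exact h9 q (by omega) hqm) hs
    obtain ⟨f1, f2, f3, f4, f5, f6, f7, f8, f9⟩ := g4
    have hz : q' = 0 := by
      simp only [levelTest, Test.Holds, NatExpr.eval, f4] at g3
      omega
    exact ⟨s', k, g1, g2, f2, f3, f6, f7, fun q hq => f9 q (by omega) hq⟩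
  obtain ⟨s, k, h1, h2, h3⟩ := main
  refine ⟨s, k, h1, h2.trans ?_, h3⟩
  unfold stepsPerVertex
  generalize (Program.setNat 3 (.const 1)).bound = c₁
  generalize peelInit.bound = c₂
  generalize levelInit.bound = c₃
  generalize apexTest.cost + apexStep.bound + 1 = K₁
  generalize peelTest.cost + peelStep.bound + 1 = K₂
  generalize levelTest.cost + (Program.seq sideStep pointStep).bound + 1 = K₃
  have e1 : (t - 1 + 1) * K₁ ≤ 2 * n * K₁ := Nat.mul_le_mul_right _ (by omega)
  have e2 : (m + 1) * K₂ ≤ 2 * n * K₂ := Nat.mul_le_mul_right _ (by omega)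
  have e3 : (m + 1) * K₃ ≤ 2 * n * K₃ := Nat.mul_le_mul_right _ (by omega)
  have e4 : ∀ c : ℕ, c ≤ c * n := fun c => Nat.le_mul_of_pos_right c hn
  calc c₁ + ((t - 1 + 1) * K₁ + (c₂ + ((m + 1) * K₂ + (c₃ + (m + 1) * K₃))))
      ≤ c₁ * n + (2 * n * K₁ + (c₂ * n + (2 * n * K₂ + (c₃ * n + 2 * n * K₃)))) := by
        gcongr <;> exact e4 _
    _ = (c₁ + 2 * K₁ + c₂ + 2 * K₂ + c₃ + 2 * K₃) * n := by ring

end RealRAM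

namespace RealRAM

open Funnel in
/-- The algorithm selects points of a hidden set. -/
theorem selection_registers {n t m : ℕ} {f : ℕ → Plane} {i j : ℕ → ℕ}
    (hP : Peeling 1 f (fun k => f (n - 1 - k)) t (n - 1 - t) i j m) :
    Selection 1 f (fun k => f (n - 1 - k)) i j m
      (fun s => decide ((registers n i j m (m - s)).side ≤ 0))
      (fun s => orient (f (registers n i j m (m - s)).leftA) (f (registers n i j m (m - s)).leftB))
      (fun s => orient (f (registers n i j m (m - s)).rightA)
        (f (registers n i j m (m - s)).rightB))
      (fun s => levelPoint f n i j s (registers n i j m (m - s))) := by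
  have hleft : ∀ s < m, j (s + 1) = j s → (registers n i j m (m - s)).side ≤ 0 := by
    intro s hs h
    rw [registers_sub n i j hs, Registers.step_side, newSide, if_pos h.ge]
  have hright : ∀ s < m, i (s + 1) = i s → ¬ (registers n i j m (m - s)).side ≤ 0 := by
    intro s hs h
    have := (hP.peel s hs).lt_add
    rw [registers_sub n i j hs, Registers.step_side, newSide, if_neg (by omega), if_pos h.ge]
    omega
  have hstepL : ∀ s < m, (registers n i j m (m - s)).side ≤ 0 → i (s + 1) + 1 = i s := by
    intro s hs h
    have h1 := (hP.peel s hs).lt_add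
    have h2 : i (s + 1) ≠ i s := fun e => hright s hs e h
    omega
  have hstepR : ∀ s < m, ¬ (registers n i j m (m - s)).side ≤ 0 → j (s + 1) + 1 = j s := by
    intro s hs h
    have h1 := (hP.peel s hs).lt_add
    have h2 : j (s + 1) ≠ j s := fun e => h (hleft s hs e)
    omega
  have hregL : ∀ s < m, (registers n i j m (m - s)).side ≤ 0 →
      (registers n i j m (m - s)).leftA = i (s + 1) ∧ (registers n i j m (m - s)).leftB = i s ∧
      (registers n i j m (m - s)).rightA = (registers n i j m (m - (s + 1))).rightA ∧
      (registers n i j m (m - s)).rightB = (registers n i j m (m - (s + 1))).rightB := by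
    intro s hs h
    rw [registers_sub n i j hs, Registers.step_side] at h
    rw [registers_sub n i j hs, Registers.step_of_le h]
    exact ⟨rfl, rfl, rfl, rfl⟩
  have hregR : ∀ s < m, ¬ (registers n i j m (m - s)).side ≤ 0 →
      (registers n i j m (m - s)).rightA = n - 1 - j s ∧
      (registers n i j m (m - s)).rightB = n - 1 - j (s + 1) ∧
      (registers n i j m (m - s)).leftA = (registers n i j m (m - (s + 1))).leftA ∧
      (registers n i j m (m - s)).leftB = (registers n i j m (m - (s + 1))).leftB := by
    intro s hs h
    rw [registers_sub n i j hs, Registers.step_side] at h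
    rw [registers_sub n i j hs, Registers.step_of_not_le h]
    exact ⟨rfl, rfl, rfl, rfl⟩
  constructor
  · exact fun s hs h => decide_eq_true (hleft s hs h)
  · exact fun s hs h => decide_eq_false (hright s hs h)
  · intro s hs h1 h2
    have h3 := (hP.peel s (by omega)).lt_add
    congr 2
    rw [registers_sub n i j (by omega : s < m), Registers.step_side, newSide, if_neg (by omega),
      if_neg (by omega)]
  · ext x
    simp only [Nat.sub_self, registers, lid, Nat.sub_zero, one_mul]
  · ext x
    simp only [Nat.sub_self, registers, lid, Nat.sub_zero, one_mul]
  · intro s hs h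
    have h' := of_decide_eq_true h
    obtain ⟨h1, h2, -, -⟩ := hregL s hs h'
    ext x
    simp only [h1, h2, lam, one_mul, hstepL s hs h']
  · intro s hs h
    obtain ⟨-, -, h1, h2⟩ := hregR s hs (of_decide_eq_false h)
    simp only [h1, h2]
  · intro s hs h
    obtain ⟨-, -, h1, h2⟩ := hregL s hs (of_decide_eq_true h)
    simp only [h1, h2]
  · intro s hs h
    have h' := of_decide_eq_false h
    obtain ⟨h1, h2, -, -⟩ := hregR s hs h'
    ext x
    simp only [h1, h2, lam, hstepR s hs h', orient]
    ring
  · intro s hs h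
    exact if_pos (of_decide_eq_true h)
  · intro s hs h
    exact if_neg (of_decide_eq_false h)

theorem outPiece_eq {u w : ℕ → Plane} {i j : ℕ → ℕ} {m q : ℕ} {s : State}
    (hrec : Recorded i j m s) (hwr : Written u w i j m s) (hq : q < m) :
    outPiece s q = Funnel.piece u w (i q) (j q) (i (q + 1)) (j (q + 1)) := by
  obtain ⟨h0, h1, h2, h3⟩ := hwr q hq
  unfold outPiece Funnel.piece
  rw [hrec.delimiter q hq.le, hrec.delimiter (q + 1) hq, ← h0, ← h1, ← h2, ← h3]
  have : Ico (4 * q) (4 * (q + 1)) = {4 * q, 4 * q + 1, 4 * q + 2, 4 * q + 3} := by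
    ext k
    simp only [mem_Ico, mem_insert_iff, mem_singleton_iff]
    omega
  rw [this, image_insert_eq, image_insert_eq, image_insert_eq, image_singleton]

theorem outPiece_clockwise {u w : ℕ → Plane} {a b : ℕ} {i j : ℕ → ℕ} {m q : ℕ} {s : State}
    (hF : Funnel 1 u w a b) (hP : Funnel.Peeling 1 u w a b i j m) (hrec : Recorded i j m s)
    (hwr : Written u w i j m s) (hq : q < m) (k l p : ℕ) (hk : s.natArr 0 q ≤ k) (hkl : k < l)
    (hlp : l < p) (hp : p < s.natArr 0 (q + 1)) :
    orient (outVertex s k) (outVertex s l) (outVertex s p) ≤ 0 := by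
  obtain ⟨h0, h1, h2, h3⟩ := hwr q hq
  rw [hrec.delimiter q hq.le] at hk
  rw [hrec.delimiter (q + 1) hq] at hp
  obtain ⟨o1, o2, o3, o4⟩ := (hP.peel q hq).orient_nonpos hF (hP.valid hF hq.le)
  have hcase : (k = 4 * q ∧ l = 4 * q + 1 ∧ p = 4 * q + 2) ∨
      (k = 4 * q ∧ l = 4 * q + 1 ∧ p = 4 * q + 3) ∨
      (k = 4 * q ∧ l = 4 * q + 2 ∧ p = 4 * q + 3) ∨
      (k = 4 * q + 1 ∧ l = 4 * q + 2 ∧ p = 4 * q + 3) := by omega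
  rcases hcase with ⟨rfl, rfl, rfl⟩ | ⟨rfl, rfl, rfl⟩ | ⟨rfl, rfl, rfl⟩ | ⟨rfl, rfl, rfl⟩
  · rwa [h0, h1, h2]
  · rwa [h0, h1, h3]
  · rwa [h0, h2, h3]
  · rwa [h1, h2, h3]

end RealRAM

end

theorem theorem1 :
    ∃ (prog : RealRAM.Program) (κ : ℕ), ∀ (n : ℕ) (P : Polygon Plane n), P.IsFunnel →
      ∃ (H : Finset Plane) (C : Finset (Set Plane)),
        IsHiddenSet P.region (H : Set Plane) ∧
        (H : Set Plane) ⊆ P.boundary ℝ ∧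
        IsConvexDecomposition P.region (C : Set (Set Plane)) ∧
        H.card = C.card ∧
        hiddenSetNumber P.region = (H.card : ℕ∞) ∧
        convexCoverNumber P.region = (C.card : ℕ∞) ∧
        ∃ (s : RealRAM.State) (k : ℕ),
          RealRAM.Exec prog (RealRAM.inputState P) s k ∧ k ≤ κ * n ∧ RealRAM.Outputs s H C := by
  classical
  refine ⟨RealRAM.funnelProgram, RealRAM.stepsPerVertex, fun n P hPf => ?_⟩
  have hn : 0 < n := by have := hPf.simple.three_le; omega
  obtain ⟨t, ht, htn, hreflex, hapex, hF⟩ := hPf.exists_funnel hn P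
  have hregion : P.region = Funnel.body 1 (cyc hn P) (fun k => cyc hn P (n - 1 - k)) t (n - 1 - t) := by
    rw [Polygon.region, boundary_eq_outline hn P htn, hF.region_eq_body]
  obtain ⟨m, hm0, hm, hend, hmin, hP⟩ := hF.exists_peeling
  set i : ℕ → ℕ :=
    fun q => (Funnel.chord 1 (cyc hn P) (fun k => cyc hn P (n - 1 - k)) t (n - 1 - t) q).1
  set j : ℕ → ℕ :=
    fun q => (Funnel.chord 1 (cyc hn P) (fun k => cyc hn P (n - 1 - k)) t (n - 1 - t) q).2
  have hi : ∀ q, i q < n := fun q => by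
    rcases hF.valid_chord q with ⟨h, -⟩ | ⟨h, -⟩ <;> simp only [i] <;> omega
  obtain ⟨s, k, hexec, hk, hs1, hs2, hrec, hwr, hpt⟩ :=
    RealRAM.halts_funnelProgram hn P ht htn hreflex hapex (i := i) (j := j) hP.left_top hP.right_top hP.left_base
      hP.right_base hi (fun q hq h => hmin q hq (Prod.ext (Nat.eq_zero_of_add_eq_zero_right h)
        (Nat.eq_zero_of_add_eq_zero_left h)))
      (by omega) (fun q => Funnel.chord_succ _ _ _ _ _ q)
  have hS := RealRAM.selection_registers hP
  set pt : ℕ → Plane := fun q =>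
    RealRAM.levelPoint (cyc hn P) n i j q (RealRAM.registers n i j m (m - q))
  set pc : ℕ → Set Plane := fun q => Funnel.piece (cyc hn P) (fun k => cyc hn P (n - 1 - k))
    (i q) (j q) (i (q + 1)) (j (q + 1))
  have hHset : (((Finset.range m).image pt : Finset Plane) : Set Plane) = pt '' Set.Iio m := by
    rw [Finset.coe_image, Finset.coe_range]
  have hCset : (((Finset.range m).image pc : Finset (Set Plane)) : Set (Set Plane)) =
      pc '' Set.Iio m := by
    rw [Finset.coe_image, Finset.coe_range]
  have hHcard : ((Finset.range m).image pt).card = m := by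
    rw [Finset.card_image_of_injOn, Finset.card_range]
    rw [Finset.coe_range]
    exact hS.injOn hF hP
  have hCcard : ((Finset.range m).image pc).card = m := by
    rw [Finset.card_image_of_injOn, Finset.card_range]
    rw [Finset.coe_range]
    exact hP.injOn_piece hF
  have hH : IsHiddenSet P.region (((Finset.range m).image pt : Finset Plane) : Set Plane) := by
    rw [hHset, hregion]
    exact hS.isHiddenSet hF hP
  have hC : IsConvexDecomposition P.region
      (((Finset.range m).image pc : Finset (Set Plane)) : Set (Set Plane)) := by
    rw [hCset, hregion]
    exact hP.isConvexDecomposition hF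
  refine ⟨(Finset.range m).image pt, (Finset.range m).image pc, hH, ?_, hC, hHcard.trans hCcard.symm,
    hiddenSetNumber_eq hH hC.1 (hHcard.trans hCcard.symm),
    convexCoverNumber_eq hH hC.1 (hHcard.trans hCcard.symm), s, k, hexec, hk, ?_⟩
  · rw [hHset, boundary_eq_outline hn P htn]
    rintro _ ⟨q, hq, rfl⟩
    exact hS.point_mem_outline hF hP hq
  · refine ⟨by rw [hs1, hHcard], ?_, by rw [hs2, hCcard], ?_, ?_⟩
    · rw [hHset, hs1]
      exact (Set.image_congr fun q hq => hpt q hq).symm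
    · rw [hCset, hs2]
      exact (Set.image_congr fun q hq => RealRAM.outPiece_eq hrec hwr hq).symm
    · intro q hq x y z hx hxy hyz hz
      rw [hs2] at hq
      exact RealRAM.outPiece_clockwise hF hP hrec hwr hq x y z hx hxy hyz hz
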